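/- **Definitions.** Let $V$ be a finite-dimensional real inner product space, $V\neq 0$, let $\mathrm{Sym}^2(V)$ be its space of self-adjoint endomorphisms with $\langle A,B\rangle=\mathrm{tr}(AB)$, $\mathcal P=\{A\ge 0\}$, and let $\mathrm{Sym}^2_0(V)$ be the traceless part. A *subequation* is a nonempty proper closed convex cone $F\subset \mathrm{Sym}^2(V)$ with $\mathcal P\subset F$; its *edge* is $F\cap(-F)$. A *basic edge* is a linear subspace $E\subset\mathrm{Sym}^2(V)$ with $E\cap\mathcal P=\{0\}$, and a *minimal subequation* is a set $E+\mathcal P$ with $E$ a basic edge. The *invariance group* of a set $F$ is $\{g\in \mathrm O(V): gFg^{-1}=F\}$. For a family $\mathcal G$ of linear subspaces put $\mathcal P(\mathcal G)=\{A\in\mathrm{Sym}^2(V):\mathrm{tr}(A|_W)\ge0\ \forall\, W\in\mathcal G\}$, and put $\Delta=\{A\in\mathrm{Sym}^2(V):\mathrm{tr}A\ge0\}$. For an orthogonal complex structure $J$ on $V$ let $\mathrm{Herm}_0^{\rm sym}(J)$ be the traceless symmetric $A$ with $AJ=JA$, $\mathrm{Herm}^{\rm skew}(J)$ the symmetric $A$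 with $AJ=-JA$, $\mathbb P_J$ the set of $J$-complex lines and $\mathrm{Lag}_J$ the set of $W$ with $JW=W^\perp$. On $\mathbb H^n=\mathbb R^{4n}$ let $R_q$ be right multiplication by $q$ and let $\mathbb P(\mathbb H^n)$ be the set of quaternionic lines; let $E_0$ be the traceless symmetric $\mathbb H$-linear maps, $E_p=R_p\cdot\{B\ \mathbb H\text{-linear}: B^*=-B\}$ for imaginary $p$, and $\mathrm{Im}\,\mathbb H\otimes\mathrm{Herm}^{\rm skew}$ the sum of all $E_p$. For an orthonormal basis $b=(p,q,r)$ of $\mathrm{Im}\,\mathbb H$ let $\mathcal G_b$ be the set of real subspaces that are $R_p$-complex and both $R_q$- and $R_r$-Lagrangian; let $S^1_p$ be the circle of unit quaternions $\cos\theta+p\sin\theta$, acting on the right. **Theorem.** Let $n\ge1$. (1) If $E$ is a basic edge in $\mathrm{Sym}^2(V)$, then $E+\mathcal P$ is a subequation with edge $E$, it is contained in every subequation with edge $E$, and it has the same invariance group as $E$. If $G\subset \mathrm O(V)$ is a subgroup and $\mathrm{Sym}^2(V)=\mathbb R\,\mathrm{Id}\oplus C_1\oplus\dots\oplus C_k$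 is an orthogonal decomposition with $G$-irreducible $C_i$, then $\bigoplus_i C_i=\mathrm{Sym}_0^2(V)$, and every sum of some of the $C_i$ (including the empty sum) is a $G$-invariant basic edge. (2) $\{0\}+\mathcal P=\mathcal P$ (real Monge–Ampère) and $\mathrm{Sym}^2_0(V)+\mathcal P=\Delta$ (Laplacian) both have invariance group $\mathrm O(V)$. For every orthogonal complex structure $J$ on $V$, $\mathrm{Herm}^{\rm skew}(J)+\mathcal P=\mathcal P(\mathbb P_J)$ (complex Monge–Ampère) and $\mathrm{Herm}_0^{\rm sym}(J)+\mathcal P=\mathcal P(\mathrm{Lag}_J)$ (Lagrangian), and both have invariance group $\{g\in\mathrm O(V): gJ=\pm Jg\}$. (3) In each case below, $\mathrm{Sym}^2$ is the orthogonal sum of $\mathbb R\,\mathrm{Id}$ and the listed components; these are $G$-irreducible (for $\mathrm{Sym}^2_0(\mathbb R^n)$, $\mathrm{Herm}_0^{\rm sym}$ and $E_0$ irreducibility is asserted when $n\ge2$), the $G$-invariant basic edges are exactly the sums of some of the components, and the $G$-invariant minimal subequations are exactly the listed ones. - $G=\mathrm O_n$ on $\mathbb R^n$: component $\mathrm{Sym}_0^2(\mathbb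 R^n)$; minimal subequations $\mathcal P,\ \Delta$. - $G=\mathrm U_n$ on $\mathbb C^n$, $J=i$: components $\mathrm{Herm}^{\rm sym}_0(J)$, $\mathrm{Herm}^{\rm skew}(J)$; minimal subequations $\mathcal P,\ \Delta,\ \mathcal P(\mathbb P_J),\ \mathcal P(\mathrm{Lag}_J)$. - $G=\mathrm{Sp}_n\cdot\mathrm{Sp}_1$ on $\mathbb H^n$: components $E_0$, $\mathrm{Im}\,\mathbb H\otimes\mathrm{Herm}^{\rm skew}$; minimal subequations $\mathcal P$, $\Delta$, $\mathrm{Im}\,\mathbb H\otimes\mathrm{Herm}^{\rm skew}+\mathcal P=\mathcal P(\mathbb P(\mathbb H^n))$ and $E_0+\mathcal P$. If $n\ge2$, the last two have invariance group exactly $\mathrm{Sp}_n\cdot\mathrm{Sp}_1$. - $G=\mathrm{Sp}_n$ on $\mathbb H^n$: for every orthonormal basis $(p,q,r)$ of $\mathrm{Im}\,\mathbb H$, components $E_0,E_p,E_q,E_r$; every sum of some of these, for some choice of $(p,q,r)$, and nothing else, is a $G$-invariant basic edge. Minimal subequations: $\mathcal P$, $\Delta$, $\mathcal P(\mathbb P(\mathbb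 H^n))$, $E_0+\mathcal P$, and, for some orthonormal basis $b=(p,q,r)$ of $\mathrm{Im}\,\mathbb H$, $\mathcal P(\mathbb P_{R_p})$, $\mathcal P(\mathrm{Lag}_{R_p})$, $\mathcal P(\mathcal G_b)$, $E_p+\mathcal P$. - $G=\mathrm{Sp}_n\cdot S^1_p$ on $\mathbb H^n$, where $b=(p,q,r)$ is any orthonormal basis of $\mathrm{Im}\,\mathbb H$: components $E_0$, $E_p$, $E_q\oplus E_r$; minimal subequations $\mathcal P$, $\Delta$, $\mathcal P(\mathbb P(\mathbb H^n))$, $E_0+\mathcal P$, $\mathcal P(\mathbb P_{R_p})$, $\mathcal P(\mathrm{Lag}_{R_p})$, and the two new ones $\mathcal P(\mathcal G_b)$ and $E_p+\mathcal P$. Here $\mathrm{Im}\,\mathbb H\otimes\mathrm{Herm}^{\rm skew}=E_p\oplus E_q\oplus E_r$, $\mathrm{Herm}^{\rm skew}(R_p)=E_q\oplus E_r$, $\mathrm{Herm}_0^{\rm sym}(R_p)=E_0\oplus E_p$, and $\mathcal P(\mathcal G_b)=(E_0\oplus E_q\oplus E_r)+\mathcal P$. The two new subequations have invariance group exactly $\mathrm{Sp}_n\cdot(S^1_p\cup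 q\,S^1_p)$, which contains $\mathrm{Sp}_n\cdot S^1_p$ with index two. (4) No minimal subequation on $\mathbb H^n$ has invariance group exactly $\mathrm{Sp}_n$. -/

import Mathlib

open scoped Quaternion Pointwise

noncomputable section

section General

variable {V : Type*} [NormedAddCommGroup V] [InnerProductSpace ℝ V]

/-- `Sym²(V)`: the self-adjoint endomorphisms of the euclidean space `V`. -/
def SymEnd (V : Type*) [NormedAddCommGroup V] [InnerProductSpace ℝ V] :
    Submodule ℝ (V →L[ℝ] V) where
  carrier := {A | ∀ x y : V, inner ℝ (A x) y = inner ℝ x (A y)}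
  add_mem' := by
    intro A B hA hB x y
    simp [inner_add_left, inner_add_right, hA x y, hB x y]
  zero_mem' := by
    intro x y
    simp
  smul_mem' := by
    intro c A hA x y
    simp [inner_smul_left, inner_smul_right, hA x y]

/-- The real trace of an endomorphism. -/
def tr : (V →L[ℝ] V) →ₗ[ℝ] ℝ :=
  (LinearMap.trace ℝ V).comp (ContinuousLinearMap.coeLM ℝ)

/-- The traceless part of `Sym²(V)`. -/
def traceless (V : Type*) [NormedAddCommGroup V] [InnerProductSpace ℝ V] :
    Submodule ℝ (V →L[ℝ] V) :=
  SymEnd V ⊓ LinearMap.ker (tr (V := V))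

/-- The cone `𝒫 = {A : A ≥ 0}`. -/
def psdCone (V : Type*) [NormedAddCommGroup V] [InnerProductSpace ℝ V] : Set (V →L[ℝ] V) :=
  {A | A ∈ SymEnd V ∧ ∀ x : V, 0 ≤ inner ℝ (A x) x}

/-- The Laplacian subequation `Δ = {A : tr A ≥ 0}`. -/
def laplacian (V : Type*) [NormedAddCommGroup V] [InnerProductSpace ℝ V] :
    Set (V →L[ℝ] V) :=
  {A | A ∈ SymEnd V ∧ 0 ≤ tr A}

/-- A (convex cone) subequation: a nonempty proper closed convex cone in `Sym²(V)`
containing `𝒫`. -/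
structure IsSubequation (F : Set (V →L[ℝ] V)) : Prop where
  subset_sym : F ⊆ SymEnd V
  nonempty : F.Nonempty
  proper : F ≠ SymEnd V
  closed : IsClosed F
  add_mem : ∀ A ∈ F, ∀ B ∈ F, A + B ∈ F
  smul_mem : ∀ c : ℝ, 0 ≤ c → ∀ A ∈ F, c • A ∈ F
  positivity : psdCone V ⊆ F

/-- The edge `F ∩ (-F)` of a convex cone `F`. -/
def edge (F : Set (V →L[ℝ] V)) : Set (V →L[ℝ] V) := F ∩ -F

/-- A basic edge: a subspace `E` of `Sym²(V)` with `E ∩ 𝒫 = {0}`. -/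
def IsBasicEdge (E : Submodule ℝ (V →L[ℝ] V)) : Prop :=
  E ≤ SymEnd V ∧ (E : Set (V →L[ℝ] V)) ∩ psdCone V = {0}

/-- The set `E + 𝒫`. -/
def minimalSubeq (E : Submodule ℝ (V →L[ℝ] V)) : Set (V →L[ℝ] V) :=
  (E : Set (V →L[ℝ] V)) + psdCone V

/-- `F` is a minimal subequation: `F = E + 𝒫` for a basic edge `E`. -/
def IsMinimalSubequation (F : Set (V →L[ℝ] V)) : Prop :=
  ∃ E : Submodule ℝ (V →L[ℝ] V), IsBasicEdge E ∧ F = minimalSubeq E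

/-- The action `A ↦ g A g⁻¹` of an orthogonal transformation on endomorphisms. -/
def act (g : V ≃ₗᵢ[ℝ] V) (A : V →L[ℝ] V) : V →L[ℝ] V :=
  (g : V →L[ℝ] V) ∘L A ∘L ((g⁻¹ : V ≃ₗᵢ[ℝ] V) : V →L[ℝ] V)

theorem isometryEquiv_mul_apply (g h : V ≃ₗᵢ[ℝ] V) (x : V) : (g * h) x = g (h x) := rfl

theorem act_one (A : V →L[ℝ] V) : act 1 A = A := by
  ext x
  simp [act]

theorem act_mul (g h : V ≃ₗᵢ[ℝ] V) (A : V →L[ℝ] V) : act (g * h) A = act g (act h A) := by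
  ext x
  simp [act, mul_inv_rev]

/-- The (compact) invariance group `{g ∈ O(V) : g F = F}` of a set `F` of endomorphisms. -/
def invGroup (F : Set (V →L[ℝ] V)) : Subgroup (V ≃ₗᵢ[ℝ] V) where
  carrier := {g | act g '' F = F}
  one_mem' := by
    have h : (act (1 : V ≃ₗᵢ[ℝ] V)) = id := funext act_one
    simp [h]
  mul_mem' := by
    intro g h hg hh
    have e : act (g * h) = act g ∘ act h := funext (act_mul g h)
    simp only [Set.mem_ofPred_eq] at *
    rw [e, Set.image_comp, hh, hg]
  inv_mem' := by
    intro g hg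
    have e : act g⁻¹ ∘ act g = id := by
      funext A
      simp [← act_mul, act_one]
    simp only [Set.mem_ofPred_eq] at *
    conv_lhs => rw [← hg]
    rw [← Set.image_comp, e, Set.image_id]

/-- `E` is a nonzero `G`-invariant subspace without proper nonzero `G`-invariant subspaces. -/
def IsIrreducibleUnder (G : Subgroup (V ≃ₗᵢ[ℝ] V)) (E : Submodule ℝ (V →L[ℝ] V)) : Prop :=
  G ≤ invGroup (E : Set (V →L[ℝ] V)) ∧ E ≠ ⊥ ∧
    ∀ E' : Submodule ℝ (V →L[ℝ] V), E' ≤ E → G ≤ invGroup (E' : Set (V →L[ℝ] V)) →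
      E' = ⊥ ∨ E' = E

/-- `Sym²(V)` is the orthogonal sum, for `⟨A, B⟩ = tr (A B)`, of the line `ℝ · Id` and the
subspaces `C i`. -/
def IsSymDecomposition {k : ℕ} (C : Fin k → Submodule ℝ (V →L[ℝ] V)) : Prop :=
  Submodule.span ℝ {ContinuousLinearMap.id ℝ V} ⊔ (⨆ i, C i) = SymEnd V ∧
    (∀ i, ∀ A ∈ C i, tr A = 0) ∧
    ∀ i j, i ≠ j → ∀ A ∈ C i, ∀ B ∈ C j, tr (A ∘L B) = 0

/-- The geometrically defined set `𝒫(𝒢) = {A ∈ Sym²(V) : tr (A|_W) ≥ 0 for all W ∈ 𝒢}`, where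
`tr (A|_W) = tr (A P_W)` with `P_W` the orthogonal projection onto `W`. -/
def geomSubeq [FiniteDimensional ℝ V] (𝒢 : Set (Submodule ℝ V)) : Set (V →L[ℝ] V) :=
  {A | A ∈ SymEnd V ∧ ∀ W ∈ 𝒢, 0 ≤ tr (A ∘L W.starProjection)}

/-- An orthogonal complex structure on `V`. -/
structure IsComplexStructure (J : V →L[ℝ] V) : Prop where
  sq : ∀ x, J (J x) = -x
  isometry : ∀ x y, inner ℝ (J x) (J y) = inner ℝ x y

/-- `Herm^{ℂ-sym}` for the complex structure `J`: symmetric `A` with `A J = J A`. -/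
def hermSym (J : V →L[ℝ] V) : Submodule ℝ (V →L[ℝ] V) where
  carrier := {A | A ∈ SymEnd V ∧ ∀ x, A (J x) = J (A x)}
  add_mem' := by
    intro A B hA hB
    exact ⟨add_mem hA.1 hB.1, fun x => by simp [hA.2 x, hB.2 x]⟩
  zero_mem' := ⟨zero_mem _, fun x => by simp⟩
  smul_mem' := by
    intro c A hA
    exact ⟨Submodule.smul_mem _ c hA.1, fun x => by simp [hA.2 x]⟩

/-- `Herm₀^{ℂ-sym}`: the traceless part of `Herm^{ℂ-sym}`. -/
def hermSym0 (J : V →L[ℝ] V) : Submodule ℝ (V →L[ℝ] V) := hermSym J ⊓ traceless V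

/-- `Herm^{ℂ-skew}` for the complex structure `J`: symmetric `A` with `A J = - J A`. -/
def hermSkew (J : V →L[ℝ] V) : Submodule ℝ (V →L[ℝ] V) where
  carrier := {A | A ∈ SymEnd V ∧ ∀ x, A (J x) = -J (A x)}
  add_mem' := by
    intro A B hA hB
    exact ⟨add_mem hA.1 hB.1, fun x => by simp [hA.2 x, hB.2 x, add_comm]⟩
  zero_mem' := ⟨zero_mem _, fun x => by simp⟩
  smul_mem' := by
    intro c A hA
    exact ⟨Submodule.smul_mem _ c hA.1, fun x => by simp [hA.2 x]⟩

/-- The complex lines of `(V, J)`: `J`-stable real 2-planes. -/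
def complexLines (J : V →L[ℝ] V) : Set (Submodule ℝ V) :=
  {W | Module.finrank ℝ W = 2 ∧ W.map (J : V →ₗ[ℝ] V) = W}

/-- The Lagrangian subspaces of `(V, J)`: `J W = W^⊥`. -/
def lagrangians (J : V →L[ℝ] V) : Set (Submodule ℝ V) :=
  {W | W.map (J : V →ₗ[ℝ] V) = Wᗮ}

/-- The subspaces that are `I`-complex and both `J`- and `K`-Lagrangian. -/
def complexLagrangians (I J K : V →L[ℝ] V) : Set (Submodule ℝ V) :=
  {W | W.map (I : V →ₗ[ℝ] V) = W ∧ W ∈ lagrangians J ∧ W ∈ lagrangians K}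

end General

/-- Multiplication by `i` on `ℂⁿ`. -/
def mulI (n : ℕ) : EuclideanSpace ℂ (Fin n) →L[ℝ] EuclideanSpace ℂ (Fin n) :=
  Complex.I • ContinuousLinearMap.id ℝ (EuclideanSpace ℂ (Fin n))

/-- The unitary group `U_n`: the complex linear orthogonal transformations of `ℂⁿ = ℝ²ⁿ`. -/
def unitaryGrp (n : ℕ) :
    Subgroup (EuclideanSpace ℂ (Fin n) ≃ₗᵢ[ℝ] EuclideanSpace ℂ (Fin n)) where
  carrier := {g | ∀ (c : ℂ) x, g (c • x) = c • g x}
  one_mem' := by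
    intro c x
    rfl
  mul_mem' := by
    intro g h hg hh c x
    simp only [isometryEquiv_mul_apply]
    rw [hh c x, hg c (h x)]
  inv_mem' := by
    intro g hg c x
    apply g.injective
    rw [hg]
    simp

/-- Quaternionic space `ℍⁿ` with its euclidean structure `ℝ⁴ⁿ`. -/
def QSpace (n : ℕ) : Type := PiLp 2 (fun _ : Fin n => ℍ[ℝ])

instance (n : ℕ) : NormedAddCommGroup (QSpace n) :=
  inferInstanceAs (NormedAddCommGroup (PiLp 2 (fun _ : Fin n => ℍ[ℝ])))

instance (n : ℕ) : InnerProductSpace ℝ (QSpace n) :=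
  inferInstanceAs (InnerProductSpace ℝ (PiLp 2 (fun _ : Fin n => ℍ[ℝ])))

instance (n : ℕ) : FiniteDimensional ℝ (QSpace n) :=
  inferInstanceAs (FiniteDimensional ℝ (PiLp 2 (fun _ : Fin n => ℍ[ℝ])))

/-- The coordinates of a vector of `ℍⁿ`. -/
def QSpace.coord {n : ℕ} (x : QSpace n) (l : Fin n) : ℍ[ℝ] :=
  WithLp.ofLp (show PiLp 2 (fun _ : Fin n => ℍ[ℝ]) from x) l

/-- The vector of `ℍⁿ` with given coordinates. -/
def QSpace.mk {n : ℕ} (v : Fin n → ℍ[ℝ]) : QSpace n :=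
  (WithLp.toLp 2 v : PiLp 2 (fun _ : Fin n => ℍ[ℝ]))

theorem QSpace.ext_coord {n : ℕ} {x y : QSpace n} (h : ∀ l, x.coord l = y.coord l) : x = y :=
  WithLp.ofLp_injective 2 (funext h)

theorem QSpace.coord_mk {n : ℕ} (v : Fin n → ℍ[ℝ]) (l : Fin n) : (QSpace.mk v).coord l = v l :=
  rfl

theorem QSpace.coord_add {n : ℕ} (x y : QSpace n) (l : Fin n) :
    (x + y).coord l = x.coord l + y.coord l := rfl

theorem QSpace.coord_smul {n : ℕ} (c : ℝ) (x : QSpace n) (l : Fin n) :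
    (c • x).coord l = c • x.coord l := rfl

theorem QSpace.inner_eq {n : ℕ} (x y : QSpace n) :
    inner ℝ x y = ∑ l, inner ℝ (x.coord l) (y.coord l) := rfl

/-- The right multiplication `R_q : x ↦ x q` on `ℍⁿ`. -/
def rmul (n : ℕ) (q : ℍ[ℝ]) : QSpace n →L[ℝ] QSpace n :=
  LinearMap.toContinuousLinearMap
    { toFun := fun x => QSpace.mk (fun l => x.coord l * q)
      map_add' := by
        intro x y
        refine QSpace.ext_coord fun l => ?_
        simp [QSpace.coord_mk, QSpace.coord_add, add_mul]
      map_smul' := by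
        intro c x
        refine QSpace.ext_coord fun l => ?_
        simp [QSpace.coord_mk, QSpace.coord_smul] }

theorem rmul_coord (n : ℕ) (q : ℍ[ℝ]) (x : QSpace n) (l : Fin n) :
    (rmul n q x).coord l = x.coord l * q := rfl

theorem rmul_rmul (n : ℕ) (p q : ℍ[ℝ]) (x : QSpace n) :
    rmul n p (rmul n q x) = rmul n (q * p) x := by
  refine QSpace.ext_coord fun l => ?_
  simp [rmul_coord, mul_assoc]

theorem rmul_one (n : ℕ) (x : QSpace n) : rmul n 1 x = x := by
  refine QSpace.ext_coord fun l => ?_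
  simp [rmul_coord]

/-- The standard quaternionic hermitian form `ε(x, y) = ∑ x̄_l y_l` on `ℍⁿ`. -/
def qForm (n : ℕ) (x y : QSpace n) : ℍ[ℝ] := ∑ l, star (x.coord l) * y.coord l

/-- `Sp_n`: the right `ℍ`-linear maps preserving `ε`. -/
def spGrp (n : ℕ) : Subgroup (QSpace n ≃ₗᵢ[ℝ] QSpace n) where
  carrier := {g | (∀ q x, g (rmul n q x) = rmul n q (g x)) ∧
    ∀ x y, qForm n (g x) (g y) = qForm n x y}
  one_mem' := ⟨fun _ _ => rfl, fun _ _ => rfl⟩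
  mul_mem' := by
    intro g h hg hh
    refine ⟨fun q x => ?_, fun x y => ?_⟩
    · simp only [isometryEquiv_mul_apply]
      rw [hh.1, hg.1]
    · simp only [isometryEquiv_mul_apply]
      rw [hg.2, hh.2]
  inv_mem' := by
    intro g hg
    refine ⟨fun q x => ?_, fun x y => ?_⟩
    · apply g.injective
      rw [hg.1]
      simp
    · rw [← hg.2]
      simp

/-- The group `{R_u : u ∈ T}` of right multiplications by the elements of a group `T` of unit
quaternions. -/
def rightScalars (n : ℕ) (T : Subgroup (unitary ℍ[ℝ])) :
    Subgroup (QSpace n ≃ₗᵢ[ℝ] QSpace n) where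
  carrier := {g | ∃ u ∈ T, ∀ x, g x = rmul n (u : ℍ[ℝ]) x}
  one_mem' := ⟨1, T.one_mem, fun x => by simp [rmul_one]⟩
  mul_mem' := by
    rintro g h ⟨u, hu, hg⟩ ⟨v, hv, hh⟩
    refine ⟨v * u, T.mul_mem hv hu, fun x => ?_⟩
    rw [isometryEquiv_mul_apply, hg, hh, rmul_rmul]
    rfl
  inv_mem' := by
    rintro g ⟨u, hu, hg⟩
    refine ⟨u⁻¹, T.inv_mem hu, fun x => ?_⟩
    apply g.injective
    have h : ((u⁻¹ : unitary ℍ[ℝ]) : ℍ[ℝ]) * (u : ℍ[ℝ]) = 1 := by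
      rw [← Submonoid.coe_mul, inv_mul_cancel, Submonoid.coe_one]
    rw [hg (rmul n _ x), rmul_rmul, h, rmul_one]
    simp

/-- The unit quaternions commuting with `p`. For a unit imaginary `p` this is the circle
`S¹ = {cos θ + p sin θ}`. -/
def circleGrp (p : ℍ[ℝ]) : Subgroup (unitary ℍ[ℝ]) where
  carrier := {u | (u : ℍ[ℝ]) * p * star (u : ℍ[ℝ]) = p}
  one_mem' := by simp
  mul_mem' := by
    intro u v hu hv
    simp only [Set.mem_ofPred_eq, Submonoid.coe_mul, star_mul] at *
    calc (u : ℍ[ℝ]) * v * p * (star (v : ℍ[ℝ]) * star (u : ℍ[ℝ]))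
        = u * (v * p * star (v : ℍ[ℝ])) * star (u : ℍ[ℝ]) := by simp only [mul_assoc]
      _ = p := by rw [hv, hu]
  inv_mem' := by
    intro u hu
    simp only [Set.mem_ofPred_eq] at *
    have h1 : star (u : ℍ[ℝ]) * u = 1 := Unitary.coe_star_mul_self u
    rw [← Unitary.star_eq_inv, Unitary.coe_star, star_star]
    calc star (u : ℍ[ℝ]) * p * u
        = star (u : ℍ[ℝ]) * (u * p * star (u : ℍ[ℝ])) * u := by rw [hu]
      _ = (star (u : ℍ[ℝ]) * u) * p * (star (u : ℍ[ℝ]) * u) := by simp only [mul_assoc]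
      _ = p := by rw [h1, one_mul, mul_one]

/-- The unit quaternions `u` with `u p u⁻¹ = ± p`. For a unit imaginary `p` this is
`S¹ ∪ q S¹`, with `S¹ = {cos θ + p sin θ}` and `q` any unit imaginary quaternion orthogonal
to `p`. -/
def circleNormalizer (p : ℍ[ℝ]) : Subgroup (unitary ℍ[ℝ]) where
  carrier := {u | (u : ℍ[ℝ]) * p * star (u : ℍ[ℝ]) = p ∨
    (u : ℍ[ℝ]) * p * star (u : ℍ[ℝ]) = -p}
  one_mem' := by simp
  mul_mem' := by
    intro u v hu hv
    simp only [Set.mem_ofPred_eq, Submonoid.coe_mul, star_mul] at *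
    have e : (u : ℍ[ℝ]) * v * p * (star (v : ℍ[ℝ]) * star (u : ℍ[ℝ]))
        = u * (v * p * star (v : ℍ[ℝ])) * star (u : ℍ[ℝ]) := by simp only [mul_assoc]
    rw [e]
    rcases hv with hv | hv <;> rcases hu with hu | hu <;> simp [hv, hu]
  inv_mem' := by
    intro u hu
    simp only [Set.mem_ofPred_eq] at *
    have h1 : star (u : ℍ[ℝ]) * u = 1 := Unitary.coe_star_mul_self u
    rw [← Unitary.star_eq_inv, Unitary.coe_star, star_star]
    have e : star (u : ℍ[ℝ]) * (u * p * star (u : ℍ[ℝ])) * u = p := by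
      calc star (u : ℍ[ℝ]) * (u * p * star (u : ℍ[ℝ])) * u
          = (star (u : ℍ[ℝ]) * u) * p * (star (u : ℍ[ℝ]) * u) := by simp only [mul_assoc]
        _ = p := by rw [h1, one_mul, mul_one]
    rcases hu with hu | hu
    · left
      rw [hu] at e
      exact e
    · right
      rw [hu] at e
      rw [← neg_eq_iff_eq_neg]
      simpa using e

/-- The group `Sp_n · Sp_1`. -/
def spSp1Grp (n : ℕ) : Subgroup (QSpace n ≃ₗᵢ[ℝ] QSpace n) := spGrp n ⊔ rightScalars n ⊤

/-- The group `Sp_n · S¹`, with `S¹` the circle of unit quaternions through `p`. -/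
def spS1Grp (n : ℕ) (p : ℍ[ℝ]) : Subgroup (QSpace n ≃ₗᵢ[ℝ] QSpace n) :=
  spGrp n ⊔ rightScalars n (circleGrp p)

/-- The group `Sp_n · (S¹ ∪ q S¹)`, with `S¹` the circle of unit quaternions through `p`. -/
def spPinGrp (n : ℕ) (p : ℍ[ℝ]) : Subgroup (QSpace n ≃ₗᵢ[ℝ] QSpace n) :=
  spGrp n ⊔ rightScalars n (circleNormalizer p)

/-- `Herm^{ℍ-sym}(ℍⁿ)`: the symmetric `ℍ`-linear maps. -/
def qHermSym (n : ℕ) : Submodule ℝ (QSpace n →L[ℝ] QSpace n) where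
  carrier := {A | A ∈ SymEnd (QSpace n) ∧ ∀ q x, A (rmul n q x) = rmul n q (A x)}
  add_mem' := by
    intro A B hA hB
    exact ⟨add_mem hA.1 hB.1, fun q x => by simp [hA.2 q x, hB.2 q x]⟩
  zero_mem' := ⟨zero_mem _, fun q x => by simp⟩
  smul_mem' := by
    intro c A hA
    exact ⟨Submodule.smul_mem _ c hA.1, fun q x => by simp [hA.2 q x]⟩

/-- `E_0 = Herm₀^{ℍ-sym}(ℍⁿ)`: the traceless part of `Herm^{ℍ-sym}(ℍⁿ)`. -/
def qHermSym0 (n : ℕ) : Submodule ℝ (QSpace n →L[ℝ] QSpace n) :=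
  qHermSym n ⊓ traceless (QSpace n)

/-- `Herm^{ℍ-skew}(ℍⁿ)`: the skew-adjoint `ℍ`-linear maps. -/
def qHermSkew (n : ℕ) : Submodule ℝ (QSpace n →L[ℝ] QSpace n) where
  carrier := {A | (∀ x y, inner ℝ (A x) y = -inner ℝ x (A y)) ∧
    ∀ q x, A (rmul n q x) = rmul n q (A x)}
  add_mem' := by
    intro A B hA hB
    refine ⟨fun x y => ?_, fun q x => by simp [hA.2 q x, hB.2 q x]⟩
    simp only [_root_.add_apply, inner_add_left, inner_add_right, hA.1 x y, hB.1 x y]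
    ring
  zero_mem' := ⟨fun x y => by simp, fun q x => by simp⟩
  smul_mem' := by
    intro c A hA
    refine ⟨fun x y => ?_, fun q x => by simp [hA.2 q x]⟩
    simp [real_inner_smul_left, real_inner_smul_right, hA.1 x y]

/-- `E_p = R_p Herm^{ℍ-skew}(ℍⁿ)`; for imaginary `p` it consists of symmetric maps. -/
def qEdge (n : ℕ) (p : ℍ[ℝ]) : Submodule ℝ (QSpace n →L[ℝ] QSpace n) where
  carrier := {A | ∃ B ∈ qHermSkew n, A = rmul n p ∘L B}
  add_mem' := by
    rintro _ _ ⟨A, hA, rfl⟩ ⟨B, hB, rfl⟩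
    exact ⟨A + B, add_mem hA hB, by ext1 x; simp⟩
  zero_mem' := ⟨0, zero_mem _, by ext1 x; simp⟩
  smul_mem' := by
    rintro c _ ⟨A, hA, rfl⟩
    exact ⟨c • A, Submodule.smul_mem _ c hA, by ext1 x; simp⟩

/-- `Im ℍ ⊗ Herm^{ℍ-skew}(ℍⁿ)`: the span of all `R_p B` with `p` imaginary and `B` in
`Herm^{ℍ-skew}(ℍⁿ)`. -/
def imHermSkew (n : ℕ) : Submodule ℝ (QSpace n →L[ℝ] QSpace n) :=
  ⨆ p ∈ {p : ℍ[ℝ] | p.re = 0}, qEdge n p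

/-- The quaternionic lines in `ℍⁿ`: real 4-planes stable under right multiplication. -/
def quaternionicLines (n : ℕ) : Set (Submodule ℝ (QSpace n)) :=
  {W | Module.finrank ℝ W = 4 ∧ ∀ q, ∀ x ∈ W, rmul n q x ∈ W}

/-- An orthonormal basis of `Im ℍ`, such as `i, j, k`. -/
def IsImFrame (b : Fin 3 → ℍ[ℝ]) : Prop :=
  Orthonormal ℝ b ∧ ∀ m, (b m).re = 0

end

/-! Minimal subequations. If E ∩ 𝒫 = {0}, the positive endomorphisms of norm one form a compact set
disjoint from E, so ‖p‖ is bounded by a constant times ‖e + p‖, and E + 𝒫 is closed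
(`isClosed_minimalSubeq`). Since 𝒫 is pointed and O(V)-invariant, E + 𝒫 determines E as its edge and
both have the same invariance group. Classifying invariant minimal subequations therefore means
classifying invariant basic edges.

Classification. The orthogonal projection π onto a G-invariant E is computed explicitly. The x⊗x
with x a unit vector span Sym², and G is transitive on the unit sphere, so π is determined by e =
π(x⊗x) for a single x. Let R_a be the orthonormal family of operators commuting with G: 1 for O_n;
1, J for U_n; 1, R_p, R_q, R_pq for Sp_n. The stabilizer of x fixes e and is transitive on the
spheres in the complement of the span of the R_a x, whence e = Σ c_ab R_a x ⊗ R_b x + d Id, and π(A)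
= Σ c_ab R_a A R_b* + d tr(A) Id (`exists_sandwich_projection`). A basic edge contains no nonzero
multiple of Id, so π(Id) = 0. On the other components π is a real scalar (Sym²_0, Herm_0^sym, E_0),
a complex number β + γJ (Herm^skew), or R_v B ↦ R_{φ(v)} B (Im ℍ ⊗ Herm^skew), and its image can be
read off. For Sp_n the edge is the sum of the E_v with v in a subspace U of Im ℍ, with or without
E_0 (`eq_of_invariant_spGrp`). The larger groups act on U by rotations. Every U is adapted to an
orthonormal basis in which one axis b 0 is singled out, so the edge is always invariant under R_{b
0} as well: no invariance group is exactly Sp_n.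

Geometric descriptions. An endomorphism anticommuting with J has trace zero on J-stable subspaces;
one commuting with J has half its trace on every Lagrangian subspace. This gives one inclusion. For
complex and quaternionic lines the converse is an average over the line. For Lagrangian subspaces,
an S anticommuting with J admits an S-stable Lagrangian W on which S ≤ 0; then |S| commutes with J
and tr |S| = -2 tr(S|_W), so positivity on W controls the whole trace
(`exists_lagrangian_commuting_majorant`).

Invariance groups. The skew part of J determines J up to sign. The right multiplications by
quaternions are the commutant of the symmetric ℍ-linear maps (for n ≥ 2), and also of the products
of two skew ones, so an isometry preserving E_0 or E_p normalizes them. It then induces an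
automorphism of ℍ, which is inner, and hence is a symplectic map times a right multiplication
(`exists_mem_spGrp_of_normalizes`). -/

open InnerProductSpace (rankOne)

noncomputable section

/-! ### Trace form, symmetric endomorphisms and the positive cone -/

section TraceAndSym

variable {V : Type*} [NormedAddCommGroup V] [InnerProductSpace ℝ V]

theorem tr_comp_comm (A B : V →L[ℝ] V) : tr (A ∘L B) = tr (B ∘L A) :=
  LinearMap.trace_mul_comm ℝ (A : V →ₗ[ℝ] V) (B : V →ₗ[ℝ] V)

theorem symEnd_isSymmetric {A : V →L[ℝ] V} (hA : A ∈ SymEnd V) :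
    (A : V →ₗ[ℝ] V).IsSymmetric := hA

theorem id_mem_symEnd : ContinuousLinearMap.id ℝ V ∈ SymEnd V := fun _ _ => rfl

theorem rankOne_self_mem_symEnd (x : V) : rankOne ℝ x x ∈ SymEnd V := fun y z => by
  simp [inner_smul_left, inner_smul_right, real_inner_comm, mul_comm]

theorem symEnd_ext {A B : V →L[ℝ] V} (hA : A ∈ SymEnd V) (hB : B ∈ SymEnd V)
    (h : ∀ x, inner ℝ (A x) x = inner ℝ (B x) x) : A = B := by
  have hs : ((A - B : V →L[ℝ] V) : V →ₗ[ℝ] V).IsSymmetric := sub_mem hA hB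
  have := hs.inner_map_self_eq_zero.1 (fun x => by simp [inner_sub_left, h x])
  rw [← sub_eq_zero]
  ext x
  exact congrArg (fun f : V →ₗ[ℝ] V => f x) this

variable [FiniteDimensional ℝ V]

omit [FiniteDimensional ℝ V] in
theorem tr_eq_sum_inner {ι : Type*} [Fintype ι] (b : OrthonormalBasis ι ℝ V) (A : V →L[ℝ] V) :
    tr A = ∑ i, inner ℝ (b i) (A (b i)) :=
  LinearMap.trace_eq_sum_inner (A : V →ₗ[ℝ] V) b

theorem tr_rankOne (x y : V) : tr (rankOne ℝ x y) = inner ℝ y x :=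
  InnerProductSpace.trace_rankOne x y

theorem tr_id : tr (ContinuousLinearMap.id ℝ V) = Module.finrank ℝ V :=
  LinearMap.trace_id ℝ V

theorem tr_comp_rankOne (A : V →L[ℝ] V) (x y : V) :
    tr (A ∘L rankOne ℝ x y) = inner ℝ y (A x) := by
  rw [show A ∘L rankOne ℝ x y = rankOne ℝ (A x) y by ext z; simp, tr_rankOne]

/-- Spectral theorem. It reduces linear statements about symmetric endomorphisms to projections onto
unit vectors, which the groups below permute transitively. -/
theorem symEnd_le_span :
    SymEnd V ≤ Submodule.span ℝ {T | ∃ x : V, ‖x‖ = 1 ∧ T = rankOne ℝ x x} := by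
  intro A hA
  have hs := symEnd_isSymmetric hA
  set b := hs.eigenvectorBasis rfl
  have key : A = ∑ i, hs.eigenvalues rfl i • rankOne ℝ (b i) (b i) := by
    ext x
    have := b.sum_repr' x
    conv_lhs => rw [← this]
    simp only [map_sum, map_smul, _root_.sum_apply, _root_.smul_apply,
      InnerProductSpace.rankOne_apply]
    refine Finset.sum_congr rfl fun i _ => ?_
    have h2 : A (b i) = hs.eigenvalues rfl i • b i := hs.apply_eigenvectorBasis rfl i
    rw [h2, smul_comm]
  rw [key]
  exact Submodule.sum_mem _ fun i _ => Submodule.smul_mem _ _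
    (Submodule.subset_span ⟨b i, b.orthonormal.1 i, rfl⟩)

/-- In an orthonormal basis tr(A²) is the sum of the ‖A bᵢ‖². This definiteness of the trace form is
what turns orthogonality into equality throughout. -/
theorem eq_zero_of_tr_comp_self {A : V →L[ℝ] V} (hA : A ∈ SymEnd V) (h : tr (A ∘L A) = 0) :
    A = 0 := by
  set b := stdOrthonormalBasis ℝ V
  rw [tr_eq_sum_inner b, Finset.sum_eq_zero_iff_of_nonneg] at h
  · have h2 : (A : V →ₗ[ℝ] V) = 0 := by
      refine b.toBasis.ext fun i => ?_
      have := h i (Finset.mem_univ _)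
      rw [ContinuousLinearMap.comp_apply, ← hA] at this
      simpa using inner_self_eq_zero.1 this
    ext x
    exact congrArg (fun f : V →ₗ[ℝ] V => f x) h2
  · intro i _
    rw [ContinuousLinearMap.comp_apply, ← hA]
    exact real_inner_self_nonneg

theorem tr_nonneg {A : V →L[ℝ] V} (hA : A ∈ psdCone V) : 0 ≤ tr A := by
  rw [tr_eq_sum_inner (stdOrthonormalBasis ℝ V)]
  exact Finset.sum_nonneg fun i _ => by rw [real_inner_comm]; exact hA.2 _

/-- The eigenvalues are nonnegative and add up to zero. -/
theorem eq_zero_of_psd_of_tr {A : V →L[ℝ] V} (hA : A ∈ psdCone V) (h : tr A = 0) : A = 0 := by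
  have hs := symEnd_isSymmetric hA.1
  set b := hs.eigenvectorBasis rfl
  rw [tr_eq_sum_inner b, Finset.sum_eq_zero_iff_of_nonneg] at h
  · have h2 : (A : V →ₗ[ℝ] V) = 0 := by
      refine b.toBasis.ext fun i => ?_
      have := h i (Finset.mem_univ _)
      have h3 : A (b i) = hs.eigenvalues rfl i • b i := hs.apply_eigenvectorBasis rfl i
      rw [h3, inner_smul_right, real_inner_self_eq_norm_sq, b.orthonormal.1 i] at this
      simp only [one_pow, mul_one] at this
      simp only [OrthonormalBasis.coe_toBasis, ContinuousLinearMap.coe_coe, h3]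
      simp [this]
    ext x
    exact congrArg (fun f : V →ₗ[ℝ] V => f x) h2
  · exact fun i _ => by rw [real_inner_comm]; exact hA.2 _

omit [FiniteDimensional ℝ V] in
theorem id_mem_psdCone : ContinuousLinearMap.id ℝ V ∈ psdCone V :=
  ⟨id_mem_symEnd, fun _ => real_inner_self_nonneg⟩

omit [FiniteDimensional ℝ V] in
theorem zero_mem_psdCone : (0 : V →L[ℝ] V) ∈ psdCone V := ⟨zero_mem _, fun x => by simp⟩

omit [FiniteDimensional ℝ V] in
theorem add_mem_psdCone {A B : V →L[ℝ] V} (hA : A ∈ psdCone V) (hB : B ∈ psdCone V) :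
    A + B ∈ psdCone V :=
  ⟨add_mem hA.1 hB.1, fun x => by
    simpa [inner_add_left] using add_nonneg (hA.2 x) (hB.2 x)⟩

omit [FiniteDimensional ℝ V] in
theorem smul_mem_psdCone {A : V →L[ℝ] V} {c : ℝ} (hc : 0 ≤ c) (hA : A ∈ psdCone V) :
    c • A ∈ psdCone V :=
  ⟨Submodule.smul_mem _ _ hA.1, fun x => by
    simpa [inner_smul_left] using mul_nonneg hc (hA.2 x)⟩

omit [FiniteDimensional ℝ V] in
theorem eq_zero_of_psd_of_neg_psd {A : V →L[ℝ] V} (hA : A ∈ psdCone V) (hB : -A ∈ psdCone V) :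
    A = 0 :=
  symEnd_ext hA.1 (zero_mem _) fun x => by
    have h1 := hA.2 x
    have h2 := hB.2 x
    simp only [_root_.neg_apply, inner_neg_left] at h2
    simp only [_root_.zero_apply, inner_zero_left]
    linarith

omit [FiniteDimensional ℝ V] in
theorem isBasicEdge_iff {E : Submodule ℝ (V →L[ℝ] V)} :
    IsBasicEdge E ↔ E ≤ SymEnd V ∧ ∀ A ∈ E, A ∈ psdCone V → A = 0 := by
  refine and_congr_right fun _ => ⟨fun h A h1 h2 => ?_, fun h => ?_⟩
  · have : A ∈ (E : Set (V →L[ℝ] V)) ∩ psdCone V := ⟨h1, h2⟩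
    rwa [h] at this
  · ext A
    refine ⟨fun hA => h A hA.1 hA.2, fun hA => ?_⟩
    rw [Set.mem_singleton_iff] at hA
    subst hA
    exact ⟨zero_mem _, zero_mem_psdCone⟩

theorem isBasicEdge_of_le_traceless {E : Submodule ℝ (V →L[ℝ] V)} (h : E ≤ traceless V) :
    IsBasicEdge E :=
  isBasicEdge_iff.2 ⟨fun _ hA => (h hA).1, fun _ hA hp => eq_zero_of_psd_of_tr hp (h hA).2⟩

end TraceAndSym

/-! ### Conjugation by orthogonal transformations and invariance groups -/

section Act

variable {V : Type*} [NormedAddCommGroup V] [InnerProductSpace ℝ V]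

theorem act_apply (g : V ≃ₗᵢ[ℝ] V) (A : V →L[ℝ] V) (x : V) : act g A x = g (A (g⁻¹ x)) := rfl

theorem isometryEquiv_apply_inv (g : V ≃ₗᵢ[ℝ] V) (x : V) : g (g⁻¹ x) = x :=
  g.apply_symm_apply x

theorem isometryEquiv_inv_apply (g : V ≃ₗᵢ[ℝ] V) (x : V) : g⁻¹ (g x) = x :=
  g.symm_apply_apply x

theorem act_apply_apply (g : V ≃ₗᵢ[ℝ] V) (A : V →L[ℝ] V) (x : V) : act g A (g x) = g (A x) := by
  rw [act_apply, isometryEquiv_inv_apply]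

theorem act_inv_act (g : V ≃ₗᵢ[ℝ] V) (A : V →L[ℝ] V) : act g⁻¹ (act g A) = A := by
  rw [← act_mul, inv_mul_cancel, act_one]

theorem act_act_inv (g : V ≃ₗᵢ[ℝ] V) (A : V →L[ℝ] V) : act g (act g⁻¹ A) = A := by
  rw [← act_mul, mul_inv_cancel, act_one]

theorem act_add (g : V ≃ₗᵢ[ℝ] V) (A B : V →L[ℝ] V) : act g (A + B) = act g A + act g B := by
  ext x; simp [act_apply]

theorem act_smul (g : V ≃ₗᵢ[ℝ] V) (c : ℝ) (A : V →L[ℝ] V) : act g (c • A) = c • act g A := by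
  ext x; simp [act_apply]

theorem act_comp (g : V ≃ₗᵢ[ℝ] V) (A B : V →L[ℝ] V) :
    act g (A ∘L B) = act g A ∘L act g B := by
  ext x; simp [act_apply]

theorem act_id (g : V ≃ₗᵢ[ℝ] V) : act g (ContinuousLinearMap.id ℝ V) = .id ℝ V := by
  ext x; simp [act_apply]

/-- The action of an orthogonal transformation on endomorphisms as a linear map. -/
def actₗ (g : V ≃ₗᵢ[ℝ] V) : (V →L[ℝ] V) →ₗ[ℝ] (V →L[ℝ] V) where
  toFun := act g
  map_add' := act_add g
  map_smul' := act_smul g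

theorem inner_isometryEquiv_left (g : V ≃ₗᵢ[ℝ] V) (x y : V) :
    inner ℝ (g x) y = inner ℝ x (g⁻¹ y) := by
  rw [← g.inner_map_map x, isometryEquiv_apply_inv]

theorem act_rankOne (g : V ≃ₗᵢ[ℝ] V) (x y : V) :
    act g (rankOne ℝ x y) = rankOne ℝ (g x) (g y) := by
  ext z
  simp [act_apply, inner_isometryEquiv_left g y z]

theorem act_mem_symEnd (g : V ≃ₗᵢ[ℝ] V) {A : V →L[ℝ] V} (hA : A ∈ SymEnd V) :
    act g A ∈ SymEnd V := fun x y => by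
  rw [act_apply, act_apply, inner_isometryEquiv_left, hA, ← g.inner_map_map,
    isometryEquiv_apply_inv]

theorem act_mem_psdCone (g : V ≃ₗᵢ[ℝ] V) {A : V →L[ℝ] V} (hA : A ∈ psdCone V) :
    act g A ∈ psdCone V :=
  ⟨act_mem_symEnd g hA.1, fun x => by
    rw [act_apply, inner_isometryEquiv_left]; exact hA.2 _⟩

theorem tr_act (g : V ≃ₗᵢ[ℝ] V) (A : V →L[ℝ] V) : tr (act g A) = tr A := by
  unfold act
  rw [tr_comp_comm]
  congr 1
  ext x
  exact congrArg A (isometryEquiv_inv_apply g x)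

theorem act_mem_of_mem_invGroup {F : Set (V →L[ℝ] V)} {g : V ≃ₗᵢ[ℝ] V} (hg : g ∈ invGroup F)
    {A : V →L[ℝ] V} (hA : A ∈ F) : act g A ∈ F := by
  have : act g '' F = F := hg
  rw [← this]
  exact ⟨A, hA, rfl⟩

theorem mem_invGroup_of_forall {F : Set (V →L[ℝ] V)} {g : V ≃ₗᵢ[ℝ] V}
    (h : ∀ A ∈ F, act g A ∈ F) (h' : ∀ A ∈ F, act g⁻¹ A ∈ F) : g ∈ invGroup F := by
  refine Set.Subset.antisymm ?_ fun A hA => ⟨_, h' A hA, act_act_inv g A⟩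
  rintro _ ⟨A, hA, rfl⟩
  exact h A hA

theorem le_invGroup_of_forall {F : Set (V →L[ℝ] V)} {G : Subgroup (V ≃ₗᵢ[ℝ] V)}
    (h : ∀ g ∈ G, ∀ A ∈ F, act g A ∈ F) : G ≤ invGroup F :=
  fun g hg => mem_invGroup_of_forall (h g hg) (h g⁻¹ (G.inv_mem hg))

theorem mem_invGroup_sup {E E' : Submodule ℝ (V →L[ℝ] V)} {g : V ≃ₗᵢ[ℝ] V}
    (h : g ∈ invGroup (E : Set (V →L[ℝ] V))) (h' : g ∈ invGroup (E' : Set (V →L[ℝ] V))) :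
    g ∈ invGroup ((E ⊔ E' : Submodule ℝ (V →L[ℝ] V)) : Set (V →L[ℝ] V)) := by
  have key : ∀ k, k ∈ invGroup (E : Set (V →L[ℝ] V)) → k ∈ invGroup (E' : Set (V →L[ℝ] V)) →
      ∀ A ∈ E ⊔ E', act k A ∈ E ⊔ E' := by
    intro k hk hk' A hA
    obtain ⟨B, hB, C, hC, rfl⟩ := Submodule.mem_sup.1 hA
    rw [act_add]
    exact Submodule.add_mem_sup (act_mem_of_mem_invGroup hk hB) (act_mem_of_mem_invGroup hk' hC)
  exact mem_invGroup_of_forall (key g h h') (key g⁻¹ (inv_mem h) (inv_mem h'))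

theorem mem_invGroup_iSup {ι : Sort*} {E : ι → Submodule ℝ (V →L[ℝ] V)} {g : V ≃ₗᵢ[ℝ] V}
    (h : ∀ i, g ∈ invGroup (E i : Set (V →L[ℝ] V))) :
    g ∈ invGroup ((⨆ i, E i : Submodule ℝ (V →L[ℝ] V)) : Set (V →L[ℝ] V)) := by
  have key : ∀ k, (∀ i, k ∈ invGroup (E i : Set (V →L[ℝ] V))) →
      ∀ A ∈ ⨆ i, E i, act k A ∈ ⨆ i, E i := by
    intro k hk
    have : (⨆ i, E i) ≤ (⨆ i, E i).comap (actₗ k) :=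
      iSup_le fun i A hA => le_iSup E i (act_mem_of_mem_invGroup (hk i) hA)
    exact this
  exact mem_invGroup_of_forall (key g h) (key g⁻¹ fun i => inv_mem (h i))

theorem invGroup_bot : invGroup ((⊥ : Submodule ℝ (V →L[ℝ] V)) : Set (V →L[ℝ] V)) = ⊤ :=
  top_le_iff.1 <| le_invGroup_of_forall fun g _ A hA => by
    have : A = 0 := hA
    subst this
    exact (actₗ g).map_zero

theorem act_mem_traceless (g : V ≃ₗᵢ[ℝ] V) {A : V →L[ℝ] V} (hA : A ∈ traceless V) :
    act g A ∈ traceless V :=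
  ⟨act_mem_symEnd g hA.1, by
    rw [SetLike.mem_coe, LinearMap.mem_ker, tr_act]
    exact hA.2⟩

theorem invGroup_traceless : invGroup (traceless V : Set (V →L[ℝ] V)) = ⊤ :=
  top_le_iff.1 <| le_invGroup_of_forall fun g _ _ hA => act_mem_traceless g hA

theorem invGroup_psdCone : invGroup (psdCone V) = ⊤ :=
  top_le_iff.1 <| le_invGroup_of_forall fun g _ _ hA => act_mem_psdCone g hA

theorem invGroup_laplacian : invGroup (laplacian V) = ⊤ :=
  top_le_iff.1 <| le_invGroup_of_forall fun g _ A hA =>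
    ⟨act_mem_symEnd g hA.1, by rw [tr_act]; exact hA.2⟩

end Act

/-! ### Minimal subequations: closedness, edge, invariance group -/

section Minimal

variable {V : Type*} [NormedAddCommGroup V] [InnerProductSpace ℝ V]

theorem minimalSubeq_bot : minimalSubeq (⊥ : Submodule ℝ (V →L[ℝ] V)) = psdCone V := by
  simp [minimalSubeq]

theorem isClosed_psdCone : IsClosed (psdCone V) := by
  have h : psdCone V = (⋂ x : V, ⋂ y : V, {A : V →L[ℝ] V | inner ℝ (A x) y = inner ℝ x (A y)}) ∩
      ⋂ x : V, {A : V →L[ℝ] V | 0 ≤ inner ℝ (A x) x} := by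
    ext A
    simp [psdCone, SymEnd]
  rw [h]
  refine IsClosed.inter (isClosed_iInter fun x => isClosed_iInter fun y => ?_)
    (isClosed_iInter fun x => ?_)
  · exact isClosed_eq (by fun_prop) (by fun_prop)
  · exact isClosed_le continuous_const (by fun_prop)

variable [FiniteDimensional ℝ V]

/-- A sum of two closed cones need not be closed. Here E ∩ 𝒫 = {0} bounds the positive summand by
the sum, so along a convergent sequence of sums the positive summands have a convergent subsequence.
-/
theorem isClosed_minimalSubeq {E : Submodule ℝ (V →L[ℝ] V)} (hE : IsBasicEdge E) :
    IsClosed (minimalSubeq E) := by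
  have : ProperSpace (V →L[ℝ] V) := FiniteDimensional.proper ℝ _
  have hEc : IsClosed (E : Set (V →L[ℝ] V)) := E.closed_of_finiteDimensional
  have hb := (isBasicEdge_iff.1 hE).2
  -- `δ` is the least distance to `E` of a positive endomorphism of norm one. It is attained by
  -- compactness and nonzero because `E` is closed. If there is no such endomorphism, every `p` is
  -- zero and `δ = 1` serves.
  obtain ⟨δ, hδ, hδ'⟩ : ∃ δ : ℝ, 0 < δ ∧ ∀ e ∈ E, ∀ p ∈ psdCone V, δ * ‖p‖ ≤ ‖e + p‖ := by
    have hK : IsCompact (psdCone V ∩ Metric.sphere 0 1) :=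
      (isCompact_sphere 0 1).inter_left isClosed_psdCone
    rcases (psdCone V ∩ Metric.sphere (0 : V →L[ℝ] V) 1).eq_empty_or_nonempty with h0 | hne
    · refine ⟨1, one_pos, fun e _ p hp => ?_⟩
      by_cases hp0 : p = 0
      · simp [hp0]
      · exfalso
        have : ‖p‖⁻¹ • p ∈ psdCone V ∩ Metric.sphere (0 : V →L[ℝ] V) 1 :=
          ⟨smul_mem_psdCone (by positivity) hp, by simp [norm_smul, hp0]⟩
        rw [h0] at this
        exact this
    · obtain ⟨q, hq, hmin⟩ := hK.exists_isMinOn hne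
        (Metric.continuous_infDist_pt (E : Set (V →L[ℝ] V))).continuousOn
      have hpos : 0 < Metric.infDist q (E : Set (V →L[ℝ] V)) := by
        rw [← hEc.notMem_iff_infDist_pos ⟨0, E.zero_mem⟩]
        intro hqE
        have := hb q hqE hq.1
        have h1 := hq.2
        simp [this] at h1
      refine ⟨_, hpos, fun e he p hp => ?_⟩
      by_cases hp0 : p = 0
      · simp [hp0]
      · have hm : ‖p‖⁻¹ • p ∈ psdCone V ∩ Metric.sphere (0 : V →L[ℝ] V) 1 :=
          ⟨smul_mem_psdCone (by positivity) hp, by simp [norm_smul, hp0]⟩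
        have h1 : Metric.infDist q (E : Set (V →L[ℝ] V)) ≤
            Metric.infDist (‖p‖⁻¹ • p) (E : Set (V →L[ℝ] V)) := hmin hm
        have h2 : Metric.infDist (‖p‖⁻¹ • p) (E : Set (V →L[ℝ] V)) ≤
            dist (‖p‖⁻¹ • p) (-(‖p‖⁻¹ • e)) :=
          Metric.infDist_le_dist_of_mem (E.neg_mem (E.smul_mem _ he))
        rw [dist_eq_norm, sub_neg_eq_add, ← smul_add, norm_smul, norm_inv, norm_norm] at h2
        have hpn : 0 < ‖p‖ := norm_pos_iff.2 hp0
        have h3 := h1.trans h2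
        rw [inv_mul_eq_div, le_div_iff₀ hpn, add_comm p e] at h3
        exact h3
  refine isClosed_of_closure_subset fun A hA => ?_
  obtain ⟨u, hu, hlim⟩ := mem_closure_iff_seq_limit.1 hA
  choose e he p hp hep using fun n => Set.mem_add.1 (hu n)
  obtain ⟨M, hM⟩ := (Metric.isBounded_range_of_tendsto u hlim).exists_norm_le
  have hpb : ∀ n, p n ∈ Metric.closedBall (0 : V →L[ℝ] V) (M / δ) := fun n => by
    rw [mem_closedBall_zero_iff, le_div_iff₀ hδ, mul_comm]
    refine (hδ' (e n) (he n) (p n) (hp n)).trans ?_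
    rw [hep n]
    exact hM _ ⟨n, rfl⟩
  obtain ⟨P, -, φ, hφ, hPlim⟩ := (isCompact_closedBall (0 : V →L[ℝ] V) (M / δ)).tendsto_subseq hpb
  have hP : P ∈ psdCone V := isClosed_psdCone.mem_of_tendsto hPlim
    (Filter.Eventually.of_forall fun n => hp (φ n))
  have helim : Filter.Tendsto (fun n => e (φ n)) Filter.atTop (nhds (A - P)) := by
    have h1 := (hlim.comp hφ.tendsto_atTop).sub hPlim
    refine h1.congr fun n => ?_
    simp only [Function.comp_apply]
    rw [← hep (φ n), add_sub_cancel_right]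
  have hAP : A - P ∈ E := hEc.mem_of_tendsto helim (Filter.Eventually.of_forall fun n => he (φ n))
  exact ⟨A - P, hAP, P, hP, by simp⟩

omit [FiniteDimensional ℝ V] in
theorem subset_minimalSubeq (E : Submodule ℝ (V →L[ℝ] V)) :
    (E : Set (V →L[ℝ] V)) ⊆ minimalSubeq E :=
  fun A hA => ⟨A, hA, 0, zero_mem_psdCone, add_zero A⟩

omit [FiniteDimensional ℝ V] in
-- If e + p = -(e' + p'), then p + p' lies in E and in 𝒫, hence vanishes; as 𝒫 is pointed, p = 0.
theorem edge_minimalSubeq {E : Submodule ℝ (V →L[ℝ] V)} (hE : IsBasicEdge E) :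
    edge (minimalSubeq E) = E := by
  refine Set.Subset.antisymm ?_ fun A hA => ⟨subset_minimalSubeq E hA, ?_⟩
  · rintro A ⟨⟨e, he, p, hp, rfl⟩, ⟨e', he', p', hp', h⟩⟩
    have h1 : p + p' = -(e + e') := by
      simp only at h
      have : e' + p' = -(e + p) := h
      rw [eq_neg_iff_add_eq_zero] at this ⊢
      rw [← this]
      abel
    have h2 : p + p' = 0 := (isBasicEdge_iff.1 hE).2 _ (h1 ▸ E.neg_mem (E.add_mem he he'))
      (add_mem_psdCone hp hp')
    have h3 : p = 0 := eq_zero_of_psd_of_neg_psd hp (by rwa [← eq_neg_of_add_eq_zero_right h2])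
    simpa [h3] using he
  · exact Set.mem_neg.2 (subset_minimalSubeq E (E.neg_mem hA))

theorem isSubequation_minimalSubeq [Nontrivial V] {E : Submodule ℝ (V →L[ℝ] V)}
    (hE : IsBasicEdge E) : IsSubequation (minimalSubeq E) where
  subset_sym := by
    rintro _ ⟨e, he, p, hp, rfl⟩
    exact add_mem (hE.1 he) hp.1
  nonempty := ⟨0, subset_minimalSubeq E E.zero_mem⟩
  proper := by
    intro h
    -- If the set were everything, Id would lie in its edge `E`, which contains no nonzero positive
    -- element.
    have h1 : -ContinuousLinearMap.id ℝ V ∈ minimalSubeq E := by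
      rw [h]; exact neg_mem id_mem_symEnd
    have h2 : ContinuousLinearMap.id ℝ V ∈ edge (minimalSubeq E) :=
      ⟨by rw [h]; exact id_mem_symEnd, h1⟩
    rw [edge_minimalSubeq hE] at h2
    have h3 := (isBasicEdge_iff.1 hE).2 _ h2 id_mem_psdCone
    obtain ⟨x, hx⟩ := exists_ne (0 : V)
    exact hx (congrArg (fun f : V →L[ℝ] V => f x) h3)
  closed := isClosed_minimalSubeq hE
  add_mem := by
    rintro _ ⟨e, he, p, hp, rfl⟩ _ ⟨e', he', p', hp', rfl⟩
    exact ⟨e + e', E.add_mem he he', p + p', add_mem_psdCone hp hp', by simp only; abel⟩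
  smul_mem := by
    rintro c hc _ ⟨e, he, p, hp, rfl⟩
    exact ⟨c • e, E.smul_mem c he, c • p, smul_mem_psdCone hc hp, by simp⟩
  positivity := fun p hp => ⟨0, E.zero_mem, p, hp, zero_add p⟩

omit [FiniteDimensional ℝ V] in
theorem minimalSubeq_subset {E : Submodule ℝ (V →L[ℝ] V)} {Q : Set (V →L[ℝ] V)}
    (hQ : IsSubequation Q) (h : edge Q = E) : minimalSubeq E ⊆ Q := by
  rintro _ ⟨e, he, p, hp, rfl⟩
  rw [← h] at he
  exact hQ.add_mem e he.1 p (hQ.positivity hp)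

omit [FiniteDimensional ℝ V] in
theorem act_image_edge (g : V ≃ₗᵢ[ℝ] V) (F : Set (V →L[ℝ] V)) (hg : g ∈ invGroup F) :
    g ∈ invGroup (edge F) := by
  have key : ∀ k ∈ invGroup F, ∀ A ∈ edge F, act k A ∈ edge F := fun k hk A hA =>
    ⟨act_mem_of_mem_invGroup hk hA.1, by
      have := act_mem_of_mem_invGroup hk (Set.mem_neg.1 hA.2)
      rw [Set.mem_neg]
      rwa [show act k (-A) = -act k A from (actₗ k).map_neg A] at this⟩
  exact mem_invGroup_of_forall (key g hg) (key g⁻¹ (inv_mem hg))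

omit [FiniteDimensional ℝ V] in
-- The set is built from E and the O(V)-invariant cone 𝒫, and E is recovered from it as the edge.
theorem invGroup_minimalSubeq {E : Submodule ℝ (V →L[ℝ] V)} (hE : IsBasicEdge E) :
    invGroup (minimalSubeq E) = invGroup (E : Set (V →L[ℝ] V)) := by
  refine le_antisymm (fun g hg => ?_) (le_invGroup_of_forall ?_)
  · rw [← edge_minimalSubeq hE]
    exact act_image_edge g _ hg
  · rintro g hg _ ⟨e, he, p, hp, rfl⟩
    exact ⟨act g e, act_mem_of_mem_invGroup hg he, act g p, act_mem_psdCone g hp,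
      (act_add g e p).symm⟩

theorem minimalSubeq_traceless [Nontrivial V] : minimalSubeq (traceless V) = laplacian V := by
  have hd : (0 : ℝ) < Module.finrank ℝ V := by exact_mod_cast Module.finrank_pos
  refine Set.Subset.antisymm ?_ fun A hA => ?_
  · rintro _ ⟨e, he, p, hp, rfl⟩
    refine ⟨add_mem he.1 hp.1, ?_⟩
    have h1 : tr e = 0 := he.2
    simp only [map_add, h1, zero_add]
    exact tr_nonneg hp
  -- The positive summand is the mean eigenvalue of `A` times the identity.
  · refine ⟨A - (tr A / Module.finrank ℝ V) • .id ℝ V,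
      ⟨sub_mem hA.1 (Submodule.smul_mem _ _ id_mem_symEnd), ?_⟩, _,
      smul_mem_psdCone (div_nonneg hA.2 hd.le) id_mem_psdCone, by simp⟩
    rw [SetLike.mem_coe, LinearMap.mem_ker, map_sub, map_smul, tr_id, smul_eq_mul,
      div_mul_cancel₀ _ hd.ne', sub_self]

end Minimal

/-! ### Orthogonal decompositions of Sym²(V) -/

section Decomposition

variable {V : Type*} [NormedAddCommGroup V] [InnerProductSpace ℝ V] [FiniteDimensional ℝ V]

omit [FiniteDimensional ℝ V] in
theorem iSup_le_traceless_of_isSymDecomposition {k : ℕ} {C : Fin k → Submodule ℝ (V →L[ℝ] V)}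
    (hC : IsSymDecomposition C) (i : Fin k) : C i ≤ traceless V := fun A hA =>
  ⟨hC.1 ▸ (le_sup_right.trans' (le_iSup C i)) hA, hC.2.1 i A hA⟩

theorem iSup_eq_traceless [Nontrivial V] {k : ℕ} {C : Fin k → Submodule ℝ (V →L[ℝ] V)}
    (hC : IsSymDecomposition C) : (⨆ i, C i) = traceless V := by
  have hle : (⨆ i, C i) ≤ traceless V := iSup_le (iSup_le_traceless_of_isSymDecomposition hC)
  have hd : (0 : ℝ) < Module.finrank ℝ V := by exact_mod_cast Module.finrank_pos
  refine le_antisymm hle fun A hA => ?_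
  have h1 : A ∈ SymEnd V := hA.1
  rw [← hC.1] at h1
  obtain ⟨t, ht, B, hB, rfl⟩ := Submodule.mem_sup.1 h1
  obtain ⟨c, rfl⟩ := Submodule.mem_span_singleton.1 ht
  have h2 : tr (c • ContinuousLinearMap.id ℝ V + B) = 0 := hA.2
  have h3 : tr B = 0 := (hle hB).2
  rw [map_add, h3, map_smul, tr_id, add_zero, smul_eq_mul] at h2
  have h4 : c = 0 := by
    rcases mul_eq_zero.1 h2 with h | h
    · exact h
    · exact absurd h hd.ne'
  simpa [h4] using hB

/-- Conjugation preserves the trace form, so a transformation preserving C preserves its orthogonal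
complement in the traceless part. Of two complementary edges only the more convenient one has to be
examined. -/
theorem mem_invGroup_of_complement {C D : Submodule ℝ (V →L[ℝ] V)}
    (hCD : traceless V ≤ C ⊔ D) (hC : C ≤ traceless V) (hD : D ≤ traceless V)
    (h : ∀ A ∈ C, ∀ B ∈ D, tr (A ∘L B) = 0) {g : V ≃ₗᵢ[ℝ] V}
    (hg : g ∈ invGroup (C : Set (V →L[ℝ] V))) : g ∈ invGroup (D : Set (V →L[ℝ] V)) := by
  have key : ∀ k ∈ invGroup (C : Set (V →L[ℝ] V)), ∀ A ∈ D, act k A ∈ D := by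
    intro k hk A hA
    obtain ⟨c, hc, d, hd, hcd⟩ := Submodule.mem_sup.1 (hCD (act_mem_traceless k (hD hA)))
    -- The `C`-component `c` of the image is orthogonal to the whole image, since `act k⁻¹ c` is in
    -- `C`; hence it is orthogonal to itself.
    have h1 : tr (c ∘L act k A) = 0 := by
      rw [← tr_act k⁻¹, act_comp, act_inv_act]
      exact h _ (act_mem_of_mem_invGroup (inv_mem hk) hc) _ hA
    rw [← hcd, ContinuousLinearMap.comp_add, map_add, h c hc d hd, add_zero] at h1
    rw [← hcd, eq_zero_of_tr_comp_self (hC hc).1 h1, zero_add]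
    exact hd
  exact mem_invGroup_of_forall (key g hg) (key g⁻¹ (inv_mem hg))

theorem exists_smul_id_add_traceless (A : V →L[ℝ] V) (hA : A ∈ SymEnd V) :
    ∃ t : ℝ, ∃ B ∈ traceless V, A = t • .id ℝ V + B := by
  rcases subsingleton_or_nontrivial V with hV | hV
  · exact ⟨0, 0, zero_mem _, by ext x; exact Subsingleton.elim _ _⟩
  have hd : (Module.finrank ℝ V : ℝ) ≠ 0 := by exact_mod_cast Module.finrank_pos.ne'
  refine ⟨tr A / Module.finrank ℝ V, A - (tr A / Module.finrank ℝ V) • .id ℝ V,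
    ⟨sub_mem hA (Submodule.smul_mem _ _ id_mem_symEnd), ?_⟩, by abel⟩
  rw [SetLike.mem_coe, LinearMap.mem_ker, map_sub, map_smul, tr_id, smul_eq_mul,
    div_mul_cancel₀ _ hd, sub_self]

theorem isSymDecomposition_of {k : ℕ} {C : Fin k → Submodule ℝ (V →L[ℝ] V)}
    (h : (⨆ i, C i) = traceless V)
    (ho : ∀ i j, i < j → ∀ A ∈ C i, ∀ B ∈ C j, tr (A ∘L B) = 0) : IsSymDecomposition C := by
  refine ⟨?_, fun i A hA => ?_, fun i j hij A hA B hB => ?_⟩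
  · rw [h]
    refine le_antisymm (sup_le ?_ inf_le_left) fun A hA => ?_
    · rw [Submodule.span_le, Set.singleton_subset_iff]
      exact id_mem_symEnd
    · obtain ⟨t, B, hB, rfl⟩ := exists_smul_id_add_traceless A hA
      exact Submodule.add_mem_sup (Submodule.smul_mem _ _ (Submodule.mem_span_singleton_self _)) hB
  · have : A ∈ traceless V := h ▸ le_iSup C i hA
    exact this.2
  · rcases lt_or_gt_of_ne hij with h1 | h1
    · exact ho i j h1 A hA B hB
    · rw [tr_comp_comm]
      exact ho j i h1 B hB A hA

end Decomposition

/-! ### The orthogonal projection onto an invariant subspace -/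

section EquivariantProjection

variable {V : Type*} [NormedAddCommGroup V] [InnerProductSpace ℝ V]

/-- `G` moves any vector `y` to any vector `y'` of the same norm by an element that fixes all `z`
for which the vectors `R a z` are orthogonal to `y` and `y'`. -/
def IsTransitiveAlong {ι : Type*} (R : ι → V →L[ℝ] V) (G : Subgroup (V ≃ₗᵢ[ℝ] V)) : Prop :=
  ∀ y y' : V, ‖y‖ = ‖y'‖ → ∃ g ∈ G, g y = y' ∧
    ∀ z, (∀ a, inner ℝ (R a z) y = 0 ∧ inner ℝ (R a z) y' = 0) → g z = z

variable {ι : Type*} [Fintype ι] [DecidableEq ι]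

omit [DecidableEq ι] in
theorem sum_rankOne_mem_symEnd {c : ι → ι → ℝ} (hc : ∀ a b, c a b = c b a) (v : ι → V) :
    (∑ a, ∑ b, c a b • rankOne ℝ (v a) (v b)) ∈ SymEnd V := fun x y => by
  simp only [_root_.sum_apply, _root_.smul_apply, InnerProductSpace.rankOne_apply,
    sum_inner, inner_sum, real_inner_smul_left, real_inner_smul_right]
  rw [Finset.sum_comm]
  refine Finset.sum_congr rfl fun a _ => Finset.sum_congr rfl fun b _ => ?_
  rw [hc b a, real_inner_comm x (v a)]
  ring

/-- Split V into the span of the R a x and its complement N. The stabilizer of x fixes each R a x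
and moves any vector of N to any other of the same norm. Moving y to -y kills the mixed terms of A,
and transitivity makes its quadratic form constant on the unit sphere of N. So A is a scalar d on N,
with no further condition on the span. -/
theorem eq_sum_rankOne_of_fixed {R : ι → V →L[ℝ] V} {G : Subgroup (V ≃ₗᵢ[ℝ] V)}
    (horth : ∀ a b x, inner ℝ (R a x) (R b x) = if a = b then inner ℝ x x else (0 : ℝ))
    (hcomm : ∀ g ∈ G, ∀ a x, g (R a x) = R a (g x)) (htrans : IsTransitiveAlong R G)
    {x : V} (hx : ‖x‖ = 1) {A : V →L[ℝ] V} (hA : A ∈ SymEnd V)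
    (hfix : ∀ g ∈ G, g x = x → act g A = A) :
    ∃ (c : ι → ι → ℝ) (d : ℝ), (∀ a b, c a b = c b a) ∧
      A = (∑ a, ∑ b, c a b • rankOne ℝ (R a x) (R b x)) + d • .id ℝ V := by
  have hv : ∀ a b, inner ℝ (R a x) (R b x) = if a = b then (1 : ℝ) else 0 := by
    intro a b
    rw [horth, real_inner_self_eq_norm_sq, hx, one_pow]
  have hmove : ∀ y y' : V, (∀ a, inner ℝ (R a x) y = 0) → (∀ a, inner ℝ (R a x) y' = 0) →
      ‖y‖ = ‖y'‖ → ∃ g ∈ G, g y = y' ∧ g x = x ∧ ∀ z w, inner ℝ (A (g z)) (g w) =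
        inner ℝ (A z) w := by
    intro y y' hy hy' h
    obtain ⟨g, hg, h1, h2⟩ := htrans y y' h
    have h3 := h2 x fun a => ⟨hy a, hy' a⟩
    refine ⟨g, hg, h1, h3, fun z w => ?_⟩
    conv_lhs => rw [← hfix g hg h3]
    rw [act_apply_apply, g.inner_map_map]
  have hperp : ∀ y, (∀ a, inner ℝ (R a x) y = 0) → ∀ a, inner ℝ (A (R a x)) y = 0 := by
    intro y hy a
    obtain ⟨g, hg, h1, h2, h3⟩ := hmove y (-y) hy (fun a => by rw [inner_neg_right, hy a, neg_zero])
      (norm_neg y).symm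
    have h4 := h3 (R a x) y
    rw [hcomm g hg, h2, h1, inner_neg_right] at h4
    linarith
  obtain ⟨d, hd⟩ : ∃ d : ℝ, ∀ y, (∀ a, inner ℝ (R a x) y = 0) →
      inner ℝ (A y) y = d * inner ℝ y y := by
    by_cases hN : ∃ y0 : V, y0 ≠ 0 ∧ ∀ a, inner ℝ (R a x) y0 = 0
    · obtain ⟨y0, hy0, hy0'⟩ := hN
      have hn : ‖y0‖ ≠ 0 := norm_ne_zero_iff.2 hy0
      refine ⟨inner ℝ (A y0) y0 / inner ℝ y0 y0, fun y hy => ?_⟩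
      obtain ⟨g, hg, h1, -, h3⟩ := hmove y ((‖y‖ / ‖y0‖) • y0) hy
        (fun a => by rw [inner_smul_right, hy0' a, mul_zero])
        (by rw [norm_smul, norm_div, norm_norm, norm_norm, div_mul_cancel₀ _ hn])
      rw [← h3, h1, map_smul, real_inner_smul_left, real_inner_smul_right,
        real_inner_self_eq_norm_sq, real_inner_self_eq_norm_sq]
      field_simp
    -- When the orbit spans `V` there is no complement to constrain `d`, and zero is taken.
    · refine ⟨0, fun y hy => ?_⟩
      have : y = 0 := by
        by_contra h
        exact hN ⟨y, h, hy⟩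
      simp [this]
  have hsym : ∀ a b, (inner ℝ (A (R a x)) (R b x) - if a = b then d else 0 : ℝ) =
      inner ℝ (A (R b x)) (R a x) - if b = a then d else 0 := by
    intro a b
    rw [hA, real_inner_comm]
    simp only [eq_comm]
  -- The diagonal correction by `d` compensates for `d • id`, which acts on the span of the orbit
  -- too.
  refine ⟨fun a b => inner ℝ (A (R a x)) (R b x) - if a = b then d else 0, d, hsym, ?_⟩
  refine symEnd_ext hA (add_mem (sum_rankOne_mem_symEnd hsym _)
    (Submodule.smul_mem _ _ id_mem_symEnd)) fun z => ?_
  set t : ι → ℝ := fun a => inner ℝ (R a x) z with ht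
  set s : V := ∑ a, t a • R a x with hs
  obtain ⟨y, hy⟩ : ∃ y, z = s + y := ⟨z - s, by abel⟩
  have hsa : ∀ a, inner ℝ (R a x) s = t a := by
    intro a
    simp [hs, inner_sum, real_inner_smul_right, hv]
  have hyN : ∀ a, inner ℝ (R a x) y = 0 := by
    intro a
    have h1 : t a = inner ℝ (R a x) z := rfl
    rw [hy, inner_add_right, hsa] at h1
    linarith
  have hsy : inner ℝ s y = (0 : ℝ) := by
    simp [hs, sum_inner, real_inner_smul_left, hyN]
  have hAsy : inner ℝ (A s) y = (0 : ℝ) := by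
    simp [hs, map_sum, sum_inner, real_inner_smul_left, hperp y hyN]
  have hss : inner ℝ s s = ∑ a, t a * t a := by
    conv_lhs => rw [hs, sum_inner]
    exact Finset.sum_congr rfl fun a _ => by rw [real_inner_smul_left, hsa]
  have hAss : inner ℝ (A s) s = ∑ a, ∑ b, t a * (t b * inner ℝ (A (R a x)) (R b x)) := by
    simp only [hs, map_sum, map_smul, sum_inner, inner_sum, real_inner_smul_left,
      real_inner_smul_right]
    refine Finset.sum_congr rfl fun a _ => Finset.sum_congr rfl fun b _ => ?_
    rw [hA, real_inner_comm]
  have hL : inner ℝ (A z) z = inner ℝ (A s) s + d * inner ℝ y y := by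
    rw [hy, map_add, inner_add_left, inner_add_right, inner_add_right, hAsy, hA y s,
      real_inner_comm (A s) y, hAsy, hd y hyN]
    ring
  have hzz : inner ℝ z z = inner ℝ s s + inner ℝ y y := by
    rw [hy, inner_add_left, inner_add_right, inner_add_right, hsy, real_inner_comm s y, hsy]
    ring
  have hR : inner ℝ ((∑ a, ∑ b, (inner ℝ (A (R a x)) (R b x) - if a = b then d else 0) •
      rankOne ℝ (R a x) (R b x)) z) z = inner ℝ (A s) s - d * inner ℝ s s := by
    simp only [_root_.sum_apply, _root_.smul_apply, InnerProductSpace.rankOne_apply,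
      sum_inner, real_inner_smul_left, sub_mul, Finset.sum_sub_distrib]
    rw [hAss, hss, Finset.mul_sum]
    congr 1
    · refine Finset.sum_congr rfl fun a _ => Finset.sum_congr rfl fun b _ => ?_
      simp only [ht]; ring
    · refine Finset.sum_congr rfl fun a _ => ?_
      simp [ht]
  rw [_root_.add_apply, inner_add_left, hR, hL, _root_.smul_apply, real_inner_smul_left,
    ContinuousLinearMap.id_apply, hzz]
  ring

/-- The operator `A ↦ ∑ c a b • R a A R' b + d tr(A) Id`. -/
def sandwich (R R' : ι → V →L[ℝ] V) (c : ι → ι → ℝ) (d : ℝ) :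
    (V →L[ℝ] V) →ₗ[ℝ] (V →L[ℝ] V) where
  toFun A := (∑ a, ∑ b, c a b • (R a ∘L A ∘L R' b)) + (d * tr A) • .id ℝ V
  map_add' A B := by
    ext x
    simp only [map_add, _root_.add_apply, _root_.sum_apply, _root_.smul_apply,
      ContinuousLinearMap.comp_apply, smul_add, Finset.sum_add_distrib, mul_add, add_smul]
    abel
  map_smul' r A := by
    ext x
    simp only [map_smul, _root_.add_apply, _root_.sum_apply, _root_.smul_apply,
      ContinuousLinearMap.comp_apply, smul_add, RingHom.id_apply, Finset.smul_sum, smul_eq_mul,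
      smul_smul]
    congr 1
    · refine Finset.sum_congr rfl fun a _ => Finset.sum_congr rfl fun b _ => ?_
      rw [mul_comm]
    · congr 1
      ring

omit [DecidableEq ι] in
theorem sandwich_apply (R R' : ι → V →L[ℝ] V) (c : ι → ι → ℝ) (d : ℝ) (A : V →L[ℝ] V) :
    sandwich R R' c d A = (∑ a, ∑ b, c a b • (R a ∘L A ∘L R' b)) + (d * tr A) • .id ℝ V := rfl

variable [FiniteDimensional ℝ V]

/-- The trace form need not be definite on all endomorphisms, but it is definite on E, and this
suffices for E and its orthogonal to be complementary. -/
theorem exists_add_orthogonal {E : Submodule ℝ (V →L[ℝ] V)} (hE : E ≤ SymEnd V)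
    (A : V →L[ℝ] V) : ∃ e ∈ E, ∃ f, A = e + f ∧ ∀ B ∈ E, tr (B ∘L f) = 0 := by
  let β : LinearMap.BilinForm ℝ (V →L[ℝ] V) :=
    LinearMap.mk₂ ℝ (fun A B => tr (A ∘L B))
      (fun A B C => by rw [ContinuousLinearMap.add_comp, map_add])
      (fun r A B => by rw [ContinuousLinearMap.smul_comp, map_smul])
      (fun A B C => by rw [ContinuousLinearMap.comp_add, map_add])
      (fun r A B => by rw [ContinuousLinearMap.comp_smul, map_smul])
  have hβ : β.IsRefl := fun A B h => by
    change tr (B ∘L A) = 0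
    rw [tr_comp_comm]
    exact h
  have hc : IsCompl E (β.orthogonal E) := by
    rw [LinearMap.BilinForm.isCompl_orthogonal_iff_disjoint hβ, Submodule.disjoint_def]
    intro B hB hB'
    exact eq_zero_of_tr_comp_self (hE hB) (hB' B hB)
  have hA : A ∈ E ⊔ β.orthogonal E := hc.sup_eq_top ▸ Submodule.mem_top
  obtain ⟨e, he, f, hf, rfl⟩ := Submodule.mem_sup.1 hA
  exact ⟨e, he, f, rfl, fun B hB => hf B hB⟩

/-- Let e be the E-component of x⊗x. It is fixed by the stabilizer of x, so
`eq_sum_rankOne_of_fixed` writes it as the value at x⊗x of a sandwich operator, with R' the adjoints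
of R. Since G commutes with R and is transitive on the unit sphere, the same c and d serve for every
y⊗y, and these span. The operator is thus the orthogonal projection onto E, and invariant subspaces
are described by finitely many real parameters. -/
theorem exists_sandwich_projection [Nontrivial V] {R R' : ι → V →L[ℝ] V}
    {G : Subgroup (V ≃ₗᵢ[ℝ] V)}
    (hadj : ∀ a x y, inner ℝ (R' a x) y = inner ℝ x (R a y))
    (horth : ∀ a b x, inner ℝ (R a x) (R b x) = if a = b then inner ℝ x x else (0 : ℝ))
    (hcomm : ∀ g ∈ G, ∀ a x, g (R a x) = R a (g x)) (htrans : IsTransitiveAlong R G)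
    {E : Submodule ℝ (V →L[ℝ] V)} (hE : E ≤ SymEnd V) (hG : G ≤ invGroup (E : Set (V →L[ℝ] V))) :
    ∃ (c : ι → ι → ℝ) (d : ℝ), (∀ a b, c a b = c b a) ∧
      (∀ A ∈ SymEnd V, sandwich R R' c d A ∈ E) ∧ ∀ A ∈ E, sandwich R R' c d A = A := by
  obtain ⟨x0, hx0⟩ := exists_ne (0 : V)
  obtain ⟨x, hx⟩ : ∃ x : V, ‖x‖ = 1 := ⟨_, norm_smul_inv_norm (𝕜 := ℝ) hx0⟩
  obtain ⟨e, he, f, hef, hf⟩ := exists_add_orthogonal hE (rankOne ℝ x x)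
  have hactf : ∀ g ∈ G, ∀ B ∈ E, tr (B ∘L act g f) = 0 := by
    intro g hg B hB
    rw [← tr_act g⁻¹, act_comp, act_inv_act]
    exact hf _ (act_mem_of_mem_invGroup (inv_mem (hG hg)) hB)
  -- `act g e - e` lies in `E` and equals `f - act g f`, which is orthogonal to `E`; so it is
  -- orthogonal to itself.
  have hfix : ∀ g ∈ G, g x = x → act g e = e := by
    intro g hg hgx
    have h1 : act g e + act g f = e + f := by
      rw [← act_add, ← hef, act_rankOne, hgx]
    have hmem : act g e - e ∈ E := sub_mem (act_mem_of_mem_invGroup (hG hg) he) he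
    have h2 : act g e - e = f - act g f := by
      rw [sub_eq_sub_iff_add_eq_add, h1, add_comm]
    have h3 : tr ((act g e - e) ∘L (act g e - e)) = 0 := by
      nth_rewrite 2 [h2]
      rw [ContinuousLinearMap.comp_sub, map_sub, hf _ hmem, hactf g hg _ hmem, sub_zero]
    exact sub_eq_zero.1 (eq_zero_of_tr_comp_self (hE hmem) h3)
  obtain ⟨c, d, hc, hform⟩ := eq_sum_rankOne_of_fixed horth hcomm htrans hx (hE he) hfix
  have hT : ∀ y : V, ‖y‖ = 1 → sandwich R R' c d (rankOne ℝ y y) =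
      (∑ a, ∑ b, c a b • rankOne ℝ (R a y) (R b y)) + d • .id ℝ V := by
    intro y hy
    rw [sandwich_apply, tr_rankOne, real_inner_self_eq_norm_sq, hy, one_pow, mul_one]
    congr 1
    refine Finset.sum_congr rfl fun a _ => Finset.sum_congr rfl fun b _ => ?_
    congr 1
    ext z
    simp [← hadj, real_inner_comm]
  have hgen : ∀ y : V, ‖y‖ = 1 → sandwich R R' c d (rankOne ℝ y y) ∈ E ∧
      ∀ B ∈ E, tr (B ∘L (rankOne ℝ y y - sandwich R R' c d (rankOne ℝ y y))) = 0 := by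
    intro y hy
    obtain ⟨g, hg, hgy, -⟩ := htrans x y (hx.trans hy.symm)
    have h1 : sandwich R R' c d (rankOne ℝ y y) = act g e := by
      rw [hT y hy, hform]
      change _ = actₗ g _
      simp only [map_add, map_sum, map_smul]
      change _ = (∑ a, ∑ b, c a b • act g (rankOne ℝ (R a x) (R b x))) + d • act g (.id ℝ V)
      simp only [act_rankOne, act_id, hcomm g hg, hgy]
    have h2 : rankOne ℝ y y - sandwich R R' c d (rankOne ℝ y y) = act g f := by
      rw [h1, ← hgy, ← act_rankOne, hef, act_add, add_sub_cancel_left]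
    refine ⟨h1 ▸ act_mem_of_mem_invGroup (hG hg) he, fun B hB => ?_⟩
    rw [h2]
    exact hactf g hg B hB
  have hall : ∀ A ∈ SymEnd V, sandwich R R' c d A ∈ E ∧
      ∀ B ∈ E, tr (B ∘L (A - sandwich R R' c d A)) = 0 := by
    intro A hA
    refine Submodule.span_induction (p := fun A _ => sandwich R R' c d A ∈ E ∧
      ∀ B ∈ E, tr (B ∘L (A - sandwich R R' c d A)) = 0) ?_ ?_ ?_ ?_ (symEnd_le_span hA)
    · rintro _ ⟨y, hy, rfl⟩
      exact hgen y hy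
    · simp
    · intro A B _ _ h1 h2
      refine ⟨by rw [map_add]; exact add_mem h1.1 h2.1, fun C hC => ?_⟩
      rw [map_add, add_sub_add_comm, ContinuousLinearMap.comp_add, map_add, h1.2 C hC, h2.2 C hC,
        add_zero]
    · intro r A _ h1
      refine ⟨by rw [map_smul]; exact E.smul_mem r h1.1, fun C hC => ?_⟩
      rw [map_smul, ← smul_sub, ContinuousLinearMap.comp_smul, map_smul, h1.2 C hC, smul_zero]
  refine ⟨c, d, hc, fun A hA => (hall A hA).1, fun A hA => ?_⟩
  obtain ⟨h1, h2⟩ := hall A (hE hA)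
  have h3 : A - sandwich R R' c d A ∈ E := sub_mem hA h1
  exact (sub_eq_zero.1 (eq_zero_of_tr_comp_self (hE h3) (h2 _ h3))).symm

end EquivariantProjection

/-! ### Complex structures: traces on complex lines and Lagrangian subspaces -/

section ComplexStructure

variable {V : Type*} [NormedAddCommGroup V] [InnerProductSpace ℝ V]

theorem IsComplexStructure.inner_left {J : V →L[ℝ] V} (hJ : IsComplexStructure J) (x y : V) :
    inner ℝ (J x) y = -inner ℝ x (J y) := by
  rw [← hJ.isometry (J x) y, hJ.sq, inner_neg_left]

theorem IsComplexStructure.inner_self {J : V →L[ℝ] V} (hJ : IsComplexStructure J) (x : V) :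
    inner ℝ (J x) x = (0 : ℝ) := by
  have := hJ.inner_left x x
  rw [real_inner_comm (J x) x] at this
  linarith

/-- The product AB anticommutes with J, so conjugation by J changes the sign of its trace. Most
orthogonality relations below are instances of this, with B possibly built from a projection. -/
theorem tr_comp_eq_zero_of_commute_of_anticommute {J : V →L[ℝ] V} (hJ : IsComplexStructure J)
    {A B : V →L[ℝ] V} (hA : ∀ x, A (J x) = J (A x)) (hB : ∀ x, B (J x) = -J (B x)) :
    tr (A ∘L B) = 0 := by
  have h1 : tr (J ∘L (A ∘L B ∘L J)) = tr ((A ∘L B ∘L J) ∘L J) := tr_comp_comm _ _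
  have h2 : J ∘L (A ∘L B ∘L J) = A ∘L B := by
    ext x
    simp [hA, hB, hJ.sq]
  have h3 : (A ∘L B ∘L J) ∘L J = -(A ∘L B) := by
    ext x
    simp [hJ.sq]
  rw [h2, h3, map_neg] at h1
  linarith

theorem tr_eq_zero_of_anticommute {J : V →L[ℝ] V} (hJ : IsComplexStructure J)
    {B : V →L[ℝ] V} (hB : ∀ x, B (J x) = -J (B x)) : tr B = 0 :=
  tr_comp_eq_zero_of_commute_of_anticommute (A := .id ℝ V) hJ (fun _ => rfl) hB

theorem hermSkew_le_traceless {J : V →L[ℝ] V} (hJ : IsComplexStructure J) :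
    hermSkew J ≤ traceless V := fun _ hA => ⟨hA.1, tr_eq_zero_of_anticommute hJ hA.2⟩

theorem comp_comp_mem_symEnd {J : V →L[ℝ] V} (hJ : IsComplexStructure J) {A : V →L[ℝ] V}
    (hA : A ∈ SymEnd V) : J ∘L A ∘L J ∈ SymEnd V := fun x y => by
  simp only [ContinuousLinearMap.comp_apply]
  have h := hJ.inner_left x (A (J y))
  rw [hJ.inner_left, hA, h, neg_neg]

theorem tr_comp_comp {J : V →L[ℝ] V} (hJ : IsComplexStructure J) (A : V →L[ℝ] V) :
    tr (J ∘L A ∘L J) = -tr A := by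
  rw [tr_comp_comm, ← map_neg]
  congr 1
  ext x
  simp [hJ.sq]

/-- The summands are the eigencomponents of the involution A ↦ JAJ⁻¹ = -JAJ. -/
theorem exists_hermSym0_add_hermSkew {J : V →L[ℝ] V} (hJ : IsComplexStructure J)
    {A : V →L[ℝ] V} (hA : A ∈ traceless V) : ∃ B ∈ hermSym0 J, ∃ C ∈ hermSkew J, A = B + C := by
  have hs := comp_comp_mem_symEnd hJ hA.1
  have htr : tr A = 0 := hA.2
  refine ⟨(1 / 2 : ℝ) • (A - J ∘L A ∘L J), ⟨⟨?_, fun x => ?_⟩, ?_, ?_⟩,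
    (1 / 2 : ℝ) • (A + J ∘L A ∘L J), ⟨?_, fun x => ?_⟩, ?_⟩
  · exact Submodule.smul_mem _ _ (sub_mem hA.1 hs)
  · simp [hJ.sq, add_comm]
  · exact Submodule.smul_mem _ _ (sub_mem hA.1 hs)
  · rw [SetLike.mem_coe, LinearMap.mem_ker, map_smul, map_sub, tr_comp_comp hJ, htr]
    simp
  · exact Submodule.smul_mem _ _ (add_mem hA.1 hs)
  · simp [hJ.sq]
  · ext x
    simp only [_root_.add_apply, _root_.smul_apply, _root_.sub_apply]
    module

theorem hermSym0_sup_hermSkew {J : V →L[ℝ] V} (hJ : IsComplexStructure J) :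
    hermSym0 J ⊔ hermSkew J = traceless V := by
  refine le_antisymm (sup_le inf_le_right (hermSkew_le_traceless hJ)) fun A hA => ?_
  obtain ⟨B, hB, C, hC, rfl⟩ := exists_hermSym0_add_hermSkew hJ hA
  exact Submodule.add_mem_sup hB hC

theorem tr_comp_hermSym0_hermSkew {J : V →L[ℝ] V} (hJ : IsComplexStructure J) :
    ∀ A ∈ hermSym0 J, ∀ B ∈ hermSkew J, tr (A ∘L B) = 0 := fun _ hA _ hB =>
  tr_comp_eq_zero_of_commute_of_anticommute hJ hA.1.2 hB.2

variable [FiniteDimensional ℝ V]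

theorem starProjection_comm_of_map_eq {J : V →L[ℝ] V} (hJ : IsComplexStructure J)
    {W : Submodule ℝ V} (hW : ∀ x ∈ W, J x ∈ W) (x : V) :
    W.starProjection (J x) = J (W.starProjection x) := by
  refine Submodule.eq_starProjection_of_mem_orthogonal
    (hW _ (W.starProjection_apply_mem x)) ?_
  rw [← map_sub, Submodule.mem_orthogonal]
  intro w hw
  rw [real_inner_comm, hJ.inner_left, real_inner_comm,
    (Submodule.mem_orthogonal W _).1 (W.sub_starProjection_mem_orthogonal x) _ (hW w hw), neg_zero]

/-- J exchanges W and its complement; equivalently, the reflection 2P - 1 in W anticommutes with J.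
-/
theorem starProjection_of_mem_lagrangians {J : V →L[ℝ] V} (hJ : IsComplexStructure J)
    {W : Submodule ℝ V} (hW : W ∈ lagrangians J) (x : V) :
    W.starProjection (J x) = J (x - W.starProjection x) := by
  have hW' : W.map (J : V →ₗ[ℝ] V) = Wᗮ := hW
  refine Submodule.eq_starProjection_of_mem_orthogonal ?_ ?_
  · have h1 : x - W.starProjection x ∈ W.map (J : V →ₗ[ℝ] V) :=
      hW' ▸ W.sub_starProjection_mem_orthogonal x
    obtain ⟨w, hw, h2⟩ := h1
    rw [← h2]
    simp only [ContinuousLinearMap.coe_coe, hJ.sq]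
    exact W.neg_mem hw
  · rw [← map_sub, sub_sub_cancel, ← hW']
    exact ⟨_, W.starProjection_apply_mem x, rfl⟩

/-- With P idempotent, tr(pP) = tr(PpP), and PpP is positive. -/
theorem tr_comp_starProjection_nonneg {p : V →L[ℝ] V} (hp : p ∈ psdCone V)
    (W : Submodule ℝ V) : 0 ≤ tr (p ∘L W.starProjection) := by
  have h1 : p ∘L W.starProjection = (p ∘L W.starProjection) ∘L W.starProjection := by
    ext x
    simp only [ContinuousLinearMap.comp_apply]
    rw [W.starProjection_eq_self_iff.2 (W.starProjection_apply_mem x)]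
  rw [h1, tr_comp_comm]
  refine tr_nonneg ⟨fun x y => ?_, fun x => ?_⟩
  · simp only [ContinuousLinearMap.comp_apply]
    rw [W.inner_starProjection_left_eq_right, hp.1, W.inner_starProjection_left_eq_right]
  · simp only [ContinuousLinearMap.comp_apply]
    rw [W.inner_starProjection_left_eq_right]
    exact hp.2 _

theorem tr_comp_starProjection_eq_zero {J S : V →L[ℝ] V} (hJ : IsComplexStructure J)
    (hS : ∀ x, S (J x) = -J (S x)) {W : Submodule ℝ V} (hW : ∀ x ∈ W, J x ∈ W) :
    tr (S ∘L W.starProjection) = 0 := by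
  rw [tr_comp_comm]
  exact tr_comp_eq_zero_of_commute_of_anticommute hJ (starProjection_comm_of_map_eq hJ hW) hS

/-- C commutes with J and 2P - 1 anticommutes with it, so C(2P - 1) has trace zero. -/
theorem tr_comp_starProjection_lagrangian {J C : V →L[ℝ] V} (hJ : IsComplexStructure J)
    (hC : ∀ x, C (J x) = J (C x)) {W : Submodule ℝ V} (hW : W ∈ lagrangians J) :
    2 * tr (C ∘L W.starProjection) = tr C := by
  have h := tr_comp_eq_zero_of_commute_of_anticommute (A := C)
    (B := (2 : ℝ) • W.starProjection - .id ℝ V) hJ hC fun x => by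
      simp only [_root_.sub_apply, _root_.smul_apply, ContinuousLinearMap.id_apply,
        starProjection_of_mem_lagrangians hJ hW, map_sub, map_smul]
      module
  rw [ContinuousLinearMap.comp_sub, ContinuousLinearMap.comp_smul, map_sub, map_smul,
    ContinuousLinearMap.comp_id, smul_eq_mul] at h
  linarith

theorem minimalSubeq_subset_geomSubeq {E : Submodule ℝ (V →L[ℝ] V)} (hE : E ≤ SymEnd V)
    {𝒢 : Set (Submodule ℝ V)} (h : ∀ A ∈ E, ∀ W ∈ 𝒢, tr (A ∘L W.starProjection) = 0) :
    minimalSubeq E ⊆ geomSubeq 𝒢 := by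
  rintro _ ⟨e, he, p, hp, rfl⟩
  refine ⟨add_mem (hE he) hp.1, fun W hW => ?_⟩
  simp only
  rw [ContinuousLinearMap.add_comp, map_add, h e he W hW, zero_add]
  exact tr_comp_starProjection_nonneg hp W

section OrbitSpan

variable {ι : Type*} [Fintype ι] [DecidableEq ι] {R : ι → V →L[ℝ] V}

omit [FiniteDimensional ℝ V] in
theorem finrank_span_orbit
    (horth : ∀ a b x, inner ℝ (R a x) (R b x) = if a = b then inner ℝ x x else (0 : ℝ))
    {x : V} (hx : ‖x‖ = 1) :
    Module.finrank ℝ (Submodule.span ℝ (Set.range fun a => R a x)) = Fintype.card ι := by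
  have ho : Orthonormal ℝ fun a => R a x := orthonormal_iff_ite.2 fun a b => by
    rw [horth, real_inner_self_eq_norm_sq, hx, one_pow]
  exact finrank_span_eq_card ho.linearIndependent

theorem tr_comp_starProjection_span_orbit
    (horth : ∀ a b x, inner ℝ (R a x) (R b x) = if a = b then inner ℝ x x else (0 : ℝ))
    {x : V} (hx : ‖x‖ = 1) (A : V →L[ℝ] V) :
    tr (A ∘L (Submodule.span ℝ (Set.range fun a => R a x)).starProjection) =
      ∑ a, inner ℝ (R a x) (A (R a x)) := by
  have h : (Submodule.span ℝ (Set.range fun a => R a x)).starProjection =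
      ∑ a, rankOne ℝ (R a x) (R a x) := by
    ext z
    refine Submodule.eq_starProjection_of_mem_orthogonal ?_ ?_
    · simp only [_root_.sum_apply, InnerProductSpace.rankOne_apply]
      exact Submodule.sum_mem _ fun a _ =>
        Submodule.smul_mem _ _ (Submodule.subset_span ⟨a, rfl⟩)
    · rw [Submodule.mem_orthogonal]
      intro w hw
      induction hw using Submodule.span_induction with
      | mem w hw =>
        obtain ⟨b, rfl⟩ := hw
        simp [inner_sub_right, inner_sum, real_inner_smul_right, horth, hx]
      | zero => simp
      | add u v _ _ hu hv => rw [inner_add_left, hu, hv, add_zero]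
      | smul c u _ hu => rw [real_inner_smul_left, hu, mul_zero]
  rw [h]
  have h2 : A ∘L (∑ a, rankOne ℝ (R a x) (R a x)) = ∑ a, A ∘L rankOne ℝ (R a x) (R a x) := by
    ext z
    simp
  rw [h2, map_sum]
  simp only [tr_comp_rankOne]

end OrbitSpan

/-- The pair `1, J` of isometries attached to a complex structure. -/
def complexOrbit (J : V →L[ℝ] V) : Fin 2 → V →L[ℝ] V := ![.id ℝ V, J]

omit [FiniteDimensional ℝ V] in
theorem complexOrbit_inner {J : V →L[ℝ] V} (hJ : IsComplexStructure J) (a b : Fin 2) (x : V) :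
    inner ℝ (complexOrbit J a x) (complexOrbit J b x) = if a = b then inner ℝ x x else (0 : ℝ) := by
  fin_cases a <;> fin_cases b <;>
    simp [complexOrbit, hJ.inner_self, hJ.isometry, -inner_self_eq_norm_sq_to_K]
  rw [real_inner_comm, hJ.inner_self]

/-- At a unit vector x, the quadratic form of the J-linear part ½(A - JAJ) is ½(⟨Ax, x⟩ + ⟨AJx,
Jx⟩), half the trace of A on the complex line through x. Nonnegative traces on all complex lines
therefore mean that this part is positive. -/
theorem minimalSubeq_hermSkew {J : V →L[ℝ] V} (hJ : IsComplexStructure J) :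
    minimalSubeq (hermSkew J) = geomSubeq (complexLines J) := by
  refine Set.Subset.antisymm (minimalSubeq_subset_geomSubeq
    (fun _ hA => (hermSkew_le_traceless hJ hA).1) ?_) fun A hA => ?_
  · intro A hA W hW
    exact tr_comp_starProjection_eq_zero hJ hA.2 fun x hx => hW.2 ▸ ⟨x, hx, rfl⟩
  · have hs := comp_comp_mem_symEnd hJ hA.1
    refine ⟨(1 / 2 : ℝ) • (A + J ∘L A ∘L J), ⟨?_, fun x => ?_⟩,
      (1 / 2 : ℝ) • (A - J ∘L A ∘L J), ⟨?_, fun x => ?_⟩, ?_⟩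
    · exact Submodule.smul_mem _ _ (add_mem hA.1 hs)
    · simp [hJ.sq]
    · exact Submodule.smul_mem _ _ (sub_mem hA.1 hs)
    · have key : ∀ y : V, ‖y‖ = 1 → 0 ≤ inner ℝ y (A y) + inner ℝ (J y) (A (J y)) := by
        intro y hy
        have h1 := tr_comp_starProjection_span_orbit (complexOrbit_inner hJ) hy A
        rw [Fin.sum_univ_two] at h1
        simp only [complexOrbit, Matrix.cons_val_zero, Matrix.cons_val_one,
          ContinuousLinearMap.id_apply] at h1
        rw [← h1]
        refine hA.2 _ ⟨finrank_span_orbit (complexOrbit_inner hJ) hy, ?_⟩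
        rw [Submodule.map_span, ← Set.range_comp]
        have hr : Set.range (fun a : Fin 2 => (![.id ℝ V, J] a : V →L[ℝ] V) y) = {y, J y} := by
          ext z
          simp [Fin.exists_fin_two, eq_comm]
        have hr' : Set.range ((J : V →ₗ[ℝ] V) ∘ fun a : Fin 2 =>
            (![.id ℝ V, J] a : V →L[ℝ] V) y) = {J y, -y} := by
          ext z
          simp [Fin.exists_fin_two, eq_comm, hJ.sq]
        rw [hr, hr', Submodule.span_insert, Submodule.span_insert, ← Set.neg_singleton,
          Submodule.span_neg, sup_comm]
      by_cases hx : x = 0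
      · simp [hx]
      have hn : ‖x‖ ≠ 0 := norm_ne_zero_iff.2 hx
      have h2 := key ((‖x‖⁻¹ : ℝ) • x) (norm_smul_inv_norm (𝕜 := ℝ) hx)
      simp only [map_smul, real_inner_smul_left, real_inner_smul_right, ← mul_add] at h2
      have h3 : 0 ≤ inner ℝ x (A x) + inner ℝ (J x) (A (J x)) := by
        have : 0 < ‖x‖⁻¹ := by positivity
        exact nonneg_of_mul_nonneg_right (nonneg_of_mul_nonneg_right h2 this) this
      simp only [_root_.smul_apply, _root_.sub_apply, ContinuousLinearMap.comp_apply,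
        real_inner_smul_left, inner_sub_left, hJ.inner_left (A (J x)), sub_neg_eq_add]
      rw [real_inner_comm x, real_inner_comm (J x)]
      positivity
    · ext x
      simp only [_root_.add_apply, _root_.smul_apply, _root_.sub_apply]
      module

section Isotropic

variable {J I S : V →L[ℝ] V}

/-- Take W maximal among the J-isotropic subspaces that are stable under S and I and on which S ≤ 0.
Since J turns an eigenvalue of S into its negative, a nonzero complement of W + JW would contain an
eigenvector y with nonpositive eigenvalue, and y, I y would enlarge W. The operator I is the
identity (ε = ε' = 1) for plain Lagrangian subspaces and a right multiplication R_p (ε = ε' = -1)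
for those that are also R_p-complex. -/
theorem exists_lagrangian_nonpos (hJ : IsComplexStructure J) {ε ε' : ℝ}
    (hI : ∀ x y, inner ℝ (I x) (I y) = inner ℝ x y) (hII : ∀ x, I (I x) = ε • x)
    (hIJ : ∀ x, I (J x) = ε' • J (I x)) (hIJ' : ∀ x, inner ℝ (I x) (J x) = (0 : ℝ))
    (hS : S ∈ SymEnd V) (hSJ : ∀ x, S (J x) = -J (S x)) (hSI : ∀ x, S (I x) = I (S x)) :
    ∃ W : Submodule ℝ V, (∀ x ∈ W, I x ∈ W) ∧ W ∈ lagrangians J ∧ (∀ x ∈ W, S x ∈ W) ∧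
      ∀ x ∈ W, inner ℝ (S x) x ≤ (0 : ℝ) := by
  let P : Set (Submodule ℝ V) := {W | (∀ x ∈ W, I x ∈ W) ∧ (∀ x ∈ W, S x ∈ W) ∧
      (∀ x ∈ W, inner ℝ (S x) x ≤ (0 : ℝ)) ∧ ∀ x ∈ W, ∀ y ∈ W, inner ℝ (J x) y = (0 : ℝ)}
  have hbot : (⊥ : Submodule ℝ V) ∈ P := by
    refine ⟨?_, ?_, ?_, ?_⟩ <;> simp
  obtain ⟨W, ⟨hWI, hWS, hWn, hWJ⟩, hmax⟩ :=
    (wellFounded_gt (α := Submodule ℝ V)).has_min P ⟨_, hbot⟩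
  have hIadj : ∀ x y, inner ℝ (I x) y = ε * inner ℝ x (I y) := fun x y => by
    rw [← hI, hII, real_inner_smul_left]
  refine ⟨W, hWI, ?_, hWS, hWn⟩
  have hU : ∀ y : V, (∀ w ∈ W, inner ℝ y w = (0 : ℝ)) → (∀ w ∈ W, inner ℝ y (J w) = (0 : ℝ)) →
      y = 0 := by
    by_contra hcon
    push Not at hcon
    let U : Submodule ℝ V := (W ⊔ W.map (J : V →ₗ[ℝ] V))ᗮ
    have hmemU : ∀ y, y ∈ U ↔ (∀ w ∈ W, inner ℝ y w = (0 : ℝ)) ∧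
        ∀ w ∈ W, inner ℝ y (J w) = (0 : ℝ) := by
      intro y
      change y ∈ (W ⊔ W.map (J : V →ₗ[ℝ] V))ᗮ ↔ _
      rw [← Submodule.inf_orthogonal]
      simp only [Submodule.mem_inf, Submodule.mem_orthogonal']
      refine and_congr Iff.rfl ⟨fun h w hw => h _ ⟨w, hw, rfl⟩, ?_⟩
      rintro h _ ⟨w, hw, rfl⟩
      exact h w hw
    have hUS : ∀ y ∈ U, S y ∈ U := by
      intro y hy
      rw [hmemU] at hy ⊢
      refine ⟨fun w hw => by rw [hS]; exact hy.1 _ (hWS w hw), fun w hw => ?_⟩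
      rw [hS, hSJ, inner_neg_right, hy.2 _ (hWS w hw), neg_zero]
    have hUJ : ∀ y ∈ U, J y ∈ U := by
      intro y hy
      rw [hmemU] at hy ⊢
      refine ⟨fun w hw => by rw [hJ.inner_left, hy.2 w hw, neg_zero], fun w hw => ?_⟩
      rw [hJ.isometry]
      exact hy.1 w hw
    have hUI : ∀ y ∈ U, I y ∈ U := by
      intro y hy
      rw [hmemU] at hy ⊢
      refine ⟨fun w hw => by rw [hIadj, hy.1 _ (hWI w hw), mul_zero], fun w hw => ?_⟩
      rw [hIadj, hIJ, real_inner_smul_right, hy.2 _ (hWI w hw), mul_zero, mul_zero]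
    obtain ⟨y, hyU, hy0, μ, hμ, hSy⟩ : ∃ y ∈ U, y ≠ 0 ∧ ∃ μ : ℝ, μ ≤ 0 ∧ S y = μ • y := by
      have hsym : ((S : V →ₗ[ℝ] V).restrict hUS).IsSymmetric :=
        (symEnd_isSymmetric hS).restrict_invariant hUS
      have : Nontrivial U := by
        obtain ⟨y, h1, h2, h3⟩ := hcon
        exact ⟨⟨⟨y, (hmemU y).2 ⟨h1, h2⟩⟩, 0, fun h => h3 (congrArg Subtype.val h)⟩⟩
      obtain ⟨⟨x, hx⟩, hx1, hx0⟩ := hsym.hasEigenvalue_iSup_of_finiteDimensional.exists_hasEigenvector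
      obtain ⟨lam, hlam⟩ : ∃ lam : ℝ, S x = lam • x :=
        ⟨_, congrArg Subtype.val (Module.End.mem_eigenspace_iff.1 hx1)⟩
      have hx0' : x ≠ 0 := fun h => hx0 (Subtype.ext h)
      rcases le_total lam 0 with h | h
      · exact ⟨x, hx, hx0', lam, h, hlam⟩
      · refine ⟨J x, hUJ x hx, fun h0 => hx0' ?_, -lam, by linarith, ?_⟩
        · have := hJ.sq x
          rw [h0, map_zero] at this
          exact neg_eq_zero.1 this.symm
        · rw [hSJ, hlam, map_smul, neg_smul]
    -- Including `I y` keeps stability under `I`; it has the same eigenvalue as `y`, and `hIJ'`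
    -- keeps the space isotropic.
    let W' : Submodule ℝ V := W ⊔ Submodule.span ℝ {y, I y}
    have hyW' : y ∈ W' := (le_sup_right : _ ≤ W') (Submodule.subset_span (by simp))
    have hIyW' : I y ∈ W' := (le_sup_right : _ ≤ W') (Submodule.subset_span (by simp))
    have hle : W ≤ W' := le_sup_left
    have hW'mem : ∀ z ∈ W', ∃ w ∈ W, ∃ a b : ℝ, z = w + (a • y + b • I y) := by
      intro z hz
      obtain ⟨w, hw, u, hu, rfl⟩ := Submodule.mem_sup.1 hz
      obtain ⟨a, b, rfl⟩ := Submodule.mem_span_pair.1 hu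
      exact ⟨w, hw, a, b, rfl⟩
    have huU : ∀ a b : ℝ, a • y + b • I y ∈ U := fun a b =>
      add_mem (U.smul_mem a hyU) (U.smul_mem b (hUI y hyU))
    have hSu : ∀ a b : ℝ, S (a • y + b • I y) = μ • (a • y + b • I y) := fun a b => by
      rw [map_add, map_smul, map_smul, hSI, hSy, map_smul]
      module
    refine hmax W' ⟨?_, ?_, ?_, ?_⟩ ?_
    · intro z hz
      obtain ⟨w, hw, a, b, rfl⟩ := hW'mem z hz
      rw [map_add, map_add, map_smul, map_smul, hII]
      exact add_mem (hle (hWI w hw)) (add_mem (W'.smul_mem _ hIyW')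
        (W'.smul_mem _ (W'.smul_mem _ hyW')))
    · intro z hz
      obtain ⟨w, hw, a, b, rfl⟩ := hW'mem z hz
      rw [map_add, hSu]
      exact add_mem (hle (hWS w hw)) (W'.smul_mem _ (add_mem (W'.smul_mem _ hyW')
        (W'.smul_mem _ hIyW')))
    · intro z hz
      obtain ⟨w, hw, a, b, rfl⟩ := hW'mem z hz
      have h1 := ((hmemU _).1 (huU a b)).1
      have h3 := hSu a b
      generalize a • y + b • I y = u at h1 h3 ⊢
      rw [map_add, h3, inner_add_left, inner_add_right, inner_add_right, real_inner_smul_left,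
        real_inner_smul_left, h1 w hw, real_inner_comm u (S w), h1 _ (hWS w hw)]
      have h2 : 0 ≤ inner ℝ u u := real_inner_self_nonneg
      nlinarith [hWn w hw]
    · intro z hz z' hz'
      obtain ⟨w, hw, a, b, rfl⟩ := hW'mem z hz
      obtain ⟨w', hw', a', b', rfl⟩ := hW'mem z' hz'
      have h1 := ((hmemU _).1 (huU a b)).2
      have h1' := ((hmemU _).1 (huU a' b')).2
      have h2 : inner ℝ (J (a • y + b • I y)) (a' • y + b' • I y) = (0 : ℝ) := by
        simp only [map_add, map_smul, inner_add_left, inner_add_right, real_inner_smul_left,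
          real_inner_smul_right, hJ.inner_self]
        rw [hJ.inner_left (I y) y, hIJ', real_inner_comm, hIJ']
        ring
      generalize a • y + b • I y = u at h1 h2 ⊢
      generalize a' • y + b' • I y = u' at h1' h2 ⊢
      rw [map_add, inner_add_left, inner_add_right, inner_add_right, hWJ w hw w' hw',
        real_inner_comm u', h1' w hw, hJ.inner_left u w', h1 w' hw', h2]
      ring
    · refine lt_of_le_of_ne hle fun h => hy0 ?_
      rw [← h] at hyW'
      exact inner_self_eq_zero.1 (((hmemU y).1 hyU).1 y hyW')
  change W.map (J : V →ₗ[ℝ] V) = Wᗮ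
  refine le_antisymm ?_ fun z hz => ?_
  · rintro _ ⟨w, hw, rfl⟩
    rw [Submodule.mem_orthogonal']
    exact fun y hy => hWJ w hw y hy
  -- For `z` orthogonal to `W`, the part of `J z` orthogonal to `W` is also orthogonal to `J W`,
  -- hence zero by `hU`.
  · have h1 : J z - W.starProjection (J z) = 0 := by
      refine hU _ (fun w hw => ?_) fun w hw => ?_
      · exact (Submodule.mem_orthogonal' W _).1 (W.sub_starProjection_mem_orthogonal (J z)) w hw
      · rw [inner_sub_left, hJ.isometry, (Submodule.mem_orthogonal' W _).1 hz w hw,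
          real_inner_comm, hWJ w hw _ (W.starProjection_apply_mem _), sub_zero]
    have h2 : J z ∈ W := by
      rw [sub_eq_zero.1 h1]
      exact W.starProjection_apply_mem _
    refine ⟨-J z, W.neg_mem h2, ?_⟩
    simp [hJ.sq]

/-- B = S(1 - 2P) is the absolute value of S: it equals -S on W, where S ≤ 0, and S on Wᗮ = JW,
where S ≥ 0 because S anticommutes with J. As a product of two operators anticommuting with J, it
commutes with J. Its trace is -2 tr(SP) because tr S = 0. -/
theorem exists_lagrangian_commuting_majorant (hJ : IsComplexStructure J) {ε ε' : ℝ}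
    (hI : ∀ x y, inner ℝ (I x) (I y) = inner ℝ x y) (hII : ∀ x, I (I x) = ε • x)
    (hIJ : ∀ x, I (J x) = ε' • J (I x)) (hIJ' : ∀ x, inner ℝ (I x) (J x) = (0 : ℝ))
    (hS : S ∈ SymEnd V) (hSJ : ∀ x, S (J x) = -J (S x)) (hSI : ∀ x, S (I x) = I (S x)) :
    ∃ W : Submodule ℝ V, (∀ x ∈ W, I x ∈ W) ∧ W ∈ lagrangians J ∧
      ∃ B ∈ SymEnd V, (∀ x, B (J x) = J (B x)) ∧ (∀ x, B (I x) = I (B x)) ∧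
        S + B ∈ psdCone V ∧ tr B = -2 * tr (S ∘L W.starProjection) := by
  obtain ⟨W, hWI, hWJ, hWS, hWn⟩ := exists_lagrangian_nonpos hJ hI hII hIJ hIJ' hS hSJ hSI
  have hIadj : ∀ x y, inner ℝ (I x) y = ε * inner ℝ x (I y) := fun x y => by
    rw [← hI, hII, real_inner_smul_left]
  have hPS : ∀ x, W.starProjection (S x) = S (W.starProjection x) := fun x => by
    refine Submodule.eq_starProjection_of_mem_orthogonal
      (hWS _ (W.starProjection_apply_mem x)) ?_
    rw [← map_sub, Submodule.mem_orthogonal']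
    intro w hw
    rw [hS]
    exact (Submodule.mem_orthogonal' W _).1 (W.sub_starProjection_mem_orthogonal x) _ (hWS w hw)
  have hPI : ∀ x, W.starProjection (I x) = I (W.starProjection x) := fun x => by
    refine Submodule.eq_starProjection_of_mem_orthogonal
      (hWI _ (W.starProjection_apply_mem x)) ?_
    rw [← map_sub, Submodule.mem_orthogonal']
    intro w hw
    rw [hIadj, (Submodule.mem_orthogonal' W _).1
      (W.sub_starProjection_mem_orthogonal x) _ (hWI w hw), mul_zero]
  have hPJ := starProjection_of_mem_lagrangians hJ hWJ
  have hBsym : S - (2 : ℝ) • (S ∘L W.starProjection) ∈ SymEnd V := by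
    refine sub_mem hS (Submodule.smul_mem _ _ fun x y => ?_)
    simp only [ContinuousLinearMap.comp_apply]
    rw [hS, W.inner_starProjection_left_eq_right, hPS]
  refine ⟨W, hWI, hWJ, S - (2 : ℝ) • (S ∘L W.starProjection), hBsym, fun x => ?_, fun x => ?_,
    ⟨add_mem hS hBsym, fun x => ?_⟩, ?_⟩
  · simp only [_root_.sub_apply, _root_.smul_apply, ContinuousLinearMap.comp_apply, hPJ, hSJ,
      map_sub, map_smul]
    module
  · simp only [_root_.sub_apply, _root_.smul_apply, ContinuousLinearMap.comp_apply, hPI, hSI,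
      map_sub, map_smul]
  · set y := x - W.starProjection x with hy
    have h1 : (S + (S - (2 : ℝ) • (S ∘L W.starProjection))) x = (2 : ℝ) • S y := by
      simp only [_root_.add_apply, _root_.sub_apply, _root_.smul_apply,
        ContinuousLinearMap.comp_apply, hy, map_sub]
      module
    have hyW : y ∈ Wᗮ := W.sub_starProjection_mem_orthogonal x
    have hyJ : y ∈ W.map (J : V →ₗ[ℝ] V) := by
      have : W.map (J : V →ₗ[ℝ] V) = Wᗮ := hWJ
      rw [this]; exact hyW
    obtain ⟨w, hw, hwy⟩ := hyJ
    have hwy' : y = J w := hwy.symm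
    have h2 : inner ℝ (S y) x = inner ℝ (S y) y := by
      have h3 : x = y + W.starProjection x := by rw [hy]; abel
      conv_lhs => rw [h3]
      rw [inner_add_right, hS y (W.starProjection x), (Submodule.mem_orthogonal' W _).1 hyW _
        (hWS _ (W.starProjection_apply_mem x)), add_zero]
    rw [h1, real_inner_smul_left, h2, hwy', hSJ, inner_neg_left, hJ.isometry]
    have := hWn w hw
    linarith
  · have htS : tr S = 0 := tr_eq_zero_of_anticommute hJ hSJ
    rw [map_sub, map_smul, htS, smul_eq_mul]
    ring

end Isotropic

end ComplexStructure

/-! ### Edges of complex type: invariance groups and the Lagrangian subequation -/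

section ComplexEdges

variable {V : Type*} [NormedAddCommGroup V] [InnerProductSpace ℝ V] {J : V →L[ℝ] V}

/-- The element x⊗x - Jx⊗Jx anticommutes with J'; applied to x this says that J'x is a multiple of
Jx. Every vector is thus an eigenvector of JJ', which must be a scalar, equal to ±1 by
orthogonality. -/
theorem eq_or_eq_neg_of_hermSkew_le {J' : V →L[ℝ] V} (hJ : IsComplexStructure J)
    (hJ' : IsComplexStructure J') (h : hermSkew J ≤ hermSkew J') : J' = J ∨ J' = -J := by
  rcases subsingleton_or_nontrivial V with hV | hV
  · exact Or.inl (by ext x; exact Subsingleton.elim _ _)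
  have hmem : ∀ x : V, rankOne ℝ x x - rankOne ℝ (J x) (J x) ∈ hermSkew J := fun x => by
    refine ⟨sub_mem (rankOne_self_mem_symEnd x) (rankOne_self_mem_symEnd _), fun y => ?_⟩
    simp only [_root_.sub_apply, InnerProductSpace.rankOne_apply, map_sub, map_smul, hJ.sq,
      hJ.isometry]
    rw [hJ.inner_left x y]
    module
  have hkey : ∀ x : V, inner ℝ x x • J' x = (inner ℝ (J x) (J' x) : ℝ) • J x := fun x => by
    have h1 := (h (hmem x)).2 x
    simp only [_root_.sub_apply, InnerProductSpace.rankOne_apply, hJ.inner_self, zero_smul,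
      sub_zero, map_smul] at h1
    rw [real_inner_comm, hJ'.inner_self, zero_smul, zero_sub, neg_inj] at h1
    exact h1.symm
  obtain ⟨c, hc⟩ := LinearMap.exists_eq_smul_id_of_forall_notLinearIndependent
    (f := ((J ∘L J' : V →L[ℝ] V) : V →ₗ[ℝ] V)) fun x hli => by
      rw [LinearIndependent.pair_iff] at hli
      have h1 := congrArg J (hkey x)
      rw [map_smul, map_smul, hJ.sq] at h1
      have h2 := (hli (inner ℝ (J x) (J' x)) (inner ℝ x x) (by
        simp only [ContinuousLinearMap.coe_coe, ContinuousLinearMap.comp_apply]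
        rw [h1]; simp)).2
      rw [inner_self_eq_zero] at h2
      have h3 := hli 1 0 (by simp [h2])
      exact one_ne_zero h3.1
  have hc' : ∀ x, J' x = -c • J x := fun x => by
    have h1 : J (J' x) = c • x := congrArg (fun f : V →ₗ[ℝ] V => f x) hc
    have h2 := congrArg J h1
    rw [hJ.sq, map_smul] at h2
    rw [neg_smul, ← h2, neg_neg]
  obtain ⟨x, hx⟩ := exists_ne (0 : V)
  have hcc : c * c = 1 := by
    have h1 := hJ'.isometry x x
    rw [hc', real_inner_smul_left, real_inner_smul_right, hJ.isometry] at h1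
    have h2 : inner ℝ x x ≠ (0 : ℝ) := fun h => hx (inner_self_eq_zero.1 h)
    have h3 : (c * c - 1) * inner ℝ x x = 0 := by linarith
    have := (mul_eq_zero.1 h3).resolve_right h2
    linarith
  rcases mul_self_eq_one_iff.1 hcc with rfl | rfl
  · exact Or.inr (by ext y; simp [hc'])
  · exact Or.inl (by ext y; simp [hc'])

theorem isComplexStructure_act (hJ : IsComplexStructure J) (g : V ≃ₗᵢ[ℝ] V) :
    IsComplexStructure (act g J) where
  sq x := by
    rw [act_apply, act_apply, isometryEquiv_inv_apply, hJ.sq, map_neg, isometryEquiv_apply_inv]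
  isometry x y := by
    rw [act_apply, act_apply, g.inner_map_map, hJ.isometry, (g⁻¹).inner_map_map]

theorem act_mem_hermSkew_act (g : V ≃ₗᵢ[ℝ] V) {A : V →L[ℝ] V} (hA : A ∈ hermSkew J) :
    act g A ∈ hermSkew (act g J) :=
  ⟨act_mem_symEnd g hA.1, fun x => by
    simp only [act_apply, isometryEquiv_inv_apply, hA.2, map_neg]⟩

theorem hermSkew_neg : hermSkew (-J) = hermSkew J := by
  ext A
  refine and_congr Iff.rfl (forall_congr' fun x => ?_)
  simp [neg_eq_iff_eq_neg]

theorem act_eq_iff {g : V ≃ₗᵢ[ℝ] V} {A B : V →L[ℝ] V} :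
    act g A = B ↔ ∀ x, g (A x) = B (g x) := by
  constructor
  · rintro rfl x
    rw [act_apply_apply]
  · intro h
    ext x
    rw [act_apply, h, isometryEquiv_apply_inv]

/-- The transported structure gJg⁻¹ has the transported skew part, and the skew part determines the
structure up to sign. -/
theorem mem_invGroup_hermSkew (hJ : IsComplexStructure J) (g : V ≃ₗᵢ[ℝ] V) :
    g ∈ invGroup (hermSkew J : Set (V →L[ℝ] V)) ↔
      (∀ x, g (J x) = J (g x)) ∨ (∀ x, g (J x) = -J (g x)) := by
  have hrw : ((∀ x, g (J x) = J (g x)) ∨ (∀ x, g (J x) = -J (g x))) ↔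
      act g J = J ∨ act g J = -J := by
    rw [act_eq_iff, act_eq_iff]
    rfl
  rw [hrw]
  constructor
  · intro hg
    refine eq_or_eq_neg_of_hermSkew_le hJ (isComplexStructure_act hJ g) fun A hA => ?_
    rw [← act_act_inv g A]
    exact act_mem_hermSkew_act g (act_mem_of_mem_invGroup (inv_mem hg) hA)
  · intro hg
    have key : ∀ k : V ≃ₗᵢ[ℝ] V, (act k J = J ∨ act k J = -J) →
        ∀ A ∈ (hermSkew J : Set (V →L[ℝ] V)), act k A ∈ (hermSkew J : Set (V →L[ℝ] V)) := by
      intro k hk A hA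
      have := act_mem_hermSkew_act k hA
      rcases hk with hk | hk <;> rw [hk] at this
      · exact this
      · rwa [hermSkew_neg] at this
    refine mem_invGroup_of_forall (key g hg) (key g⁻¹ ?_)
    refine hg.imp (fun h => ?_) fun h => ?_
    · conv_lhs => rw [← h]
      rw [act_inv_act]
    · have h2 : act g (-J) = J := by
        rw [show act g (-J) = -act g J from (actₗ g).map_neg J, h, neg_neg]
      conv_lhs => rw [← h2]
      rw [act_inv_act]

variable [FiniteDimensional ℝ V]

theorem invGroup_hermSym0 (hJ : IsComplexStructure J) :
    invGroup (hermSym0 J : Set (V →L[ℝ] V)) = invGroup (hermSkew J : Set (V →L[ℝ] V)) := by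
  have h := hermSym0_sup_hermSkew hJ
  have ho := tr_comp_hermSym0_hermSkew hJ
  ext g
  constructor
  · exact mem_invGroup_of_complement h.ge inf_le_right (hermSkew_le_traceless hJ) ho
  · exact mem_invGroup_of_complement (sup_comm (hermSym0 J) _ ▸ h.ge)
      (hermSkew_le_traceless hJ) inf_le_right
      fun A hA B hB => by rw [tr_comp_comm]; exact ho B hB A hA

/-- If `tr (A|_W) ≥ 0` for the Lagrangian subspace `W` adapted to the component `S` of
`A = C + S`, then `A` differs from a positive endomorphism by a traceless one that commutes with
`J` and `I`. -/
theorem exists_traceless_add_psd_of_lagrangian {I S C : V →L[ℝ] V} (hJ : IsComplexStructure J)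
    {ε ε' : ℝ} (hI : ∀ x y, inner ℝ (I x) (I y) = inner ℝ x y) (hII : ∀ x, I (I x) = ε • x)
    (hIJ : ∀ x, I (J x) = ε' • J (I x)) (hIJ' : ∀ x, inner ℝ (I x) (J x) = (0 : ℝ))
    (hS : S ∈ SymEnd V) (hSJ : ∀ x, S (J x) = -J (S x)) (hSI : ∀ x, S (I x) = I (S x))
    (hC : C ∈ SymEnd V) (hCJ : ∀ x, C (J x) = J (C x)) (hCI : ∀ x, C (I x) = I (C x))
    (h : ∀ W ∈ lagrangians J, (∀ x ∈ W, I x ∈ W) → 0 ≤ tr ((C + S) ∘L W.starProjection)) :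
    ∃ e ∈ traceless V, (∀ x, e (J x) = J (e x)) ∧ (∀ x, e (I x) = I (e x)) ∧
      ∃ p ∈ psdCone V, C + S = e + p := by
  obtain ⟨W, hWI, hWJ, B, hB, hBJ, hBI, hSB, htr⟩ :=
    exists_lagrangian_commuting_majorant hJ hI hII hIJ hIJ' hS hSJ hSI
  have hpos := h W hWJ hWI
  have h1 := tr_comp_starProjection_lagrangian hJ hCJ hWJ
  rw [ContinuousLinearMap.add_comp, map_add] at hpos
  -- The trace of `C + S` on `W` is ½ tr C + tr(SP) = ½ tr(C - B), so `C - B` has nonnegative trace.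
  -- Its mean eigenvalue `s` is moved to the positive summand.
  obtain ⟨s, hs, htr'⟩ : ∃ s : ℝ, 0 ≤ s ∧ tr (C - B) = s * tr (.id ℝ V : V →L[ℝ] V) := by
    rcases subsingleton_or_nontrivial V with hV | hV
    · refine ⟨0, le_rfl, ?_⟩
      rw [show C - B = 0 by ext x; exact Subsingleton.elim _ _, map_zero, zero_mul]
    · have hd : (0 : ℝ) < Module.finrank ℝ V := by exact_mod_cast Module.finrank_pos
      refine ⟨tr (C - B) / Module.finrank ℝ V, div_nonneg ?_ hd.le, ?_⟩
      · rw [map_sub, htr]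
        linarith
      · rw [tr_id, div_mul_cancel₀ _ hd.ne']
  refine ⟨C - B - s • .id ℝ V, ⟨sub_mem (sub_mem hC hB)
    (Submodule.smul_mem _ _ id_mem_symEnd), ?_⟩, fun x => ?_, fun x => ?_,
    (S + B) + s • .id ℝ V, add_mem_psdCone hSB (smul_mem_psdCone hs id_mem_psdCone), by abel⟩
  · rw [SetLike.mem_coe, LinearMap.mem_ker, map_sub, htr', map_smul, smul_eq_mul, sub_self]
  · simp only [_root_.sub_apply, _root_.smul_apply, ContinuousLinearMap.id_apply, hCJ, hBJ,
      map_sub, map_smul]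
  · simp only [_root_.sub_apply, _root_.smul_apply, ContinuousLinearMap.id_apply, hCI, hBI,
      map_sub, map_smul]

omit [FiniteDimensional ℝ V] in
theorem hermSym0_le_traceless (J : V →L[ℝ] V) : hermSym0 J ≤ traceless V := inf_le_right

theorem minimalSubeq_hermSym0 (hJ : IsComplexStructure J) :
    minimalSubeq (hermSym0 J) = geomSubeq (lagrangians J) := by
  refine Set.Subset.antisymm (minimalSubeq_subset_geomSubeq
    (fun _ hA => (hermSym0_le_traceless J hA).1) ?_) fun A hA => ?_
  · intro A hA W hW
    have h := tr_comp_starProjection_lagrangian hJ hA.1.2 hW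
    have h2 : tr A = 0 := hA.2.2
    linarith
  · obtain ⟨t, A', hA', rfl⟩ := exists_smul_id_add_traceless A hA.1
    obtain ⟨B, hB, S, hS, rfl⟩ := exists_hermSym0_add_hermSkew hJ hA'
    obtain ⟨e, he, heJ, -, p, hp, hep⟩ := exists_traceless_add_psd_of_lagrangian
      (I := .id ℝ V) (S := S) (C := t • .id ℝ V + B) (ε := 1) (ε' := 1) hJ
      (fun _ _ => rfl) (fun _ => (one_smul _ _).symm) (fun _ => (one_smul _ _).symm)
      (fun x => by rw [real_inner_comm]; exact hJ.inner_self x) hS.1 hS.2 (fun _ => rfl)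
      (add_mem (Submodule.smul_mem _ _ id_mem_symEnd) hB.1.1)
      (fun x => by simp [hB.1.2]) (fun _ => rfl)
      (fun W hW _ => by rw [add_assoc]; exact hA.2 W hW)
    refine ⟨e, ⟨⟨he.1, heJ⟩, he⟩, p, hp, ?_⟩
    simp only
    rw [← add_assoc, hep]

theorem invGroup_geomSubeq_complexLines (hJ : IsComplexStructure J) :
    invGroup (geomSubeq (complexLines J)) = invGroup (hermSkew J : Set (V →L[ℝ] V)) := by
  rw [← minimalSubeq_hermSkew hJ,
    invGroup_minimalSubeq (isBasicEdge_of_le_traceless (hermSkew_le_traceless hJ))]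

theorem invGroup_geomSubeq_lagrangians (hJ : IsComplexStructure J) :
    invGroup (geomSubeq (lagrangians J)) = invGroup (hermSkew J : Set (V →L[ℝ] V)) := by
  rw [← minimalSubeq_hermSym0 hJ,
    invGroup_minimalSubeq (isBasicEdge_of_le_traceless (hermSym0_le_traceless J)), invGroup_hermSym0 hJ]

end ComplexEdges

/-! ### Invariant basic edges for O_n and U_n -/

section InvariantEdges

variable {V : Type*} [NormedAddCommGroup V] [InnerProductSpace ℝ V] [FiniteDimensional ℝ V]

theorem eq_bot_of_le_of_orthogonal {C D : Submodule ℝ (V →L[ℝ] V)} (hC : C ≤ SymEnd V)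
    (h : ∀ A ∈ C, ∀ B ∈ D, tr (A ∘L B) = 0) (hCD : C ≤ D) : C = ⊥ :=
  (Submodule.eq_bot_iff _).2 fun A hA => eq_zero_of_tr_comp_self (hC hA) (h A hA A (hCD hA))

omit [FiniteDimensional ℝ V] in
-- Id is positive. The explicit projections onto invariant edges send Id to a multiple of itself,
-- hence to zero.
theorem smul_id_mem_basicEdge [Nontrivial V] {E : Submodule ℝ (V →L[ℝ] V)} (hE : IsBasicEdge E)
    {k : ℝ} (h : k • ContinuousLinearMap.id ℝ V ∈ E) : k = 0 := by
  by_contra hk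
  have h1 : ContinuousLinearMap.id ℝ V ∈ E := by
    have := E.smul_mem k⁻¹ h
    rwa [smul_smul, inv_mul_cancel₀ hk, one_smul] at this
  have h2 := (isBasicEdge_iff.1 hE).2 _ h1 id_mem_psdCone
  obtain ⟨x, hx⟩ := exists_ne (0 : V)
  exact hx (congrArg (fun f : V →L[ℝ] V => f x) h2)

section Orbit

variable {ι : Type*} [Fintype ι] [DecidableEq ι] {R : ι → V →L[ℝ] V}

/-- There is a traceless combination of the projections onto two orthogonal orbits. -/
theorem exists_orbit_difference_ne_zero
    (horth : ∀ a b x, inner ℝ (R a x) (R b x) = if a = b then inner ℝ x x else (0 : ℝ))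
    (hdim : Fintype.card ι < Module.finrank ℝ V) (a0 : ι) (ha0 : R a0 = .id ℝ V) :
    ∃ x y : V, (∑ a, (rankOne ℝ (R a x) (R a x) - rankOne ℝ (R a y) (R a y))) ∈ traceless V ∧
      (∑ a, (rankOne ℝ (R a x) (R a x) - rankOne ℝ (R a y) (R a y))) ≠ 0 := by
  have : Nontrivial V := Module.nontrivial_of_finrank_pos (Nat.zero_lt_of_lt hdim)
  obtain ⟨y0, hy0⟩ := exists_ne (0 : V)
  obtain ⟨y, hy⟩ : ∃ y : V, ‖y‖ = 1 := ⟨_, norm_smul_inv_norm (𝕜 := ℝ) hy0⟩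
  -- The dimension hypothesis leaves room for a vector `x` orthogonal to the orbit of `y`.
  have hlt : (Submodule.span ℝ (Set.range fun a => R a y))ᗮ ≠ ⊥ := by
    intro h
    rw [Submodule.orthogonal_eq_bot_iff] at h
    have := finrank_span_orbit horth hy
    rw [h, finrank_top] at this
    omega
  obtain ⟨x0, hx0, hne⟩ := Submodule.exists_mem_ne_zero_of_ne_bot hlt
  obtain ⟨x, hx, hx1⟩ : ∃ x ∈ (Submodule.span ℝ (Set.range fun a => R a y))ᗮ, ‖x‖ = 1 :=
    ⟨_, Submodule.smul_mem _ _ hx0, norm_smul_inv_norm (𝕜 := ℝ) hne⟩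
  have hxy : ∀ a, inner ℝ (R a y) x = (0 : ℝ) := fun a =>
    (Submodule.mem_orthogonal _ _).1 hx _ (Submodule.subset_span ⟨a, rfl⟩)
  refine ⟨x, y, ⟨sum_mem fun a _ => sub_mem (rankOne_self_mem_symEnd _)
    (rankOne_self_mem_symEnd _), ?_⟩, fun h => ?_⟩
  · rw [SetLike.mem_coe, LinearMap.mem_ker, map_sum]
    refine Finset.sum_eq_zero fun a _ => ?_
    rw [map_sub, tr_rankOne, tr_rankOne, horth, horth]
    simp [hx1, hy]
  -- Evaluated at `x` and paired with `x`, only a sum of squares remains, and its `a0` term is 1.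
  · have h1 := congrArg (fun f : V →L[ℝ] V => f x) h
    simp only [_root_.sum_apply, _root_.sub_apply, InnerProductSpace.rankOne_apply, hxy, zero_smul,
      sub_zero, _root_.zero_apply] at h1
    have h2 := congrArg (fun v => inner ℝ x v) h1
    simp only [inner_sum, real_inner_smul_right, inner_zero_right] at h2
    have h3 : ∀ a, 0 ≤ inner ℝ (R a x) x * inner ℝ x (R a x) := fun a => by
      rw [real_inner_comm]; exact mul_self_nonneg _
    rw [Finset.sum_eq_zero_iff_of_nonneg fun a _ => h3 a] at h2
    have h4 := h2 a0 (Finset.mem_univ _)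
    rw [ha0] at h4
    simp [hx1] at h4

end Orbit

section OrthogonalGroup

omit [FiniteDimensional ℝ V] in
-- The reflection in the hyperplane orthogonal to y - y' exchanges the two vectors and fixes
-- whatever is orthogonal to both.
theorem isTransitiveAlong_top :
    IsTransitiveAlong (fun _ : Fin 1 => ContinuousLinearMap.id ℝ V) ⊤ := by
  intro y y' h
  refine ⟨(Submodule.span ℝ {y - y'})ᗮ.reflection, Subgroup.mem_top _,
    Submodule.reflection_sub h, fun z hz => ?_⟩
  refine Submodule.reflection_mem_subspace_eq_self ?_
  rw [Submodule.mem_orthogonal_singleton_iff_inner_left, inner_sub_right]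
  have := hz 0
  simp only [ContinuousLinearMap.id_apply] at this
  rw [this.1, this.2, sub_zero]

/-- The projection onto E has the form A ↦ cA + d tr(A) Id and kills Id, so its image is c times the
traceless part. -/
theorem eq_bot_or_traceless_of_invariant [Nontrivial V] {E : Submodule ℝ (V →L[ℝ] V)}
    (hE : IsBasicEdge E) (hG : ⊤ ≤ invGroup (E : Set (V →L[ℝ] V))) :
    E = ⊥ ∨ E = traceless V := by
  obtain ⟨c, d, -, hT, hT'⟩ := exists_sandwich_projection
    (R := fun _ : Fin 1 => ContinuousLinearMap.id ℝ V) (R' := fun _ => .id ℝ V)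
    (fun _ _ _ => rfl) (fun a b x => by rw [Subsingleton.elim a b]; simp)
    (fun _ _ _ _ => rfl) isTransitiveAlong_top hE.1 hG
  have hTA : ∀ A, sandwich (fun _ : Fin 1 => ContinuousLinearMap.id ℝ V) (fun _ => .id ℝ V) c d A =
      c 0 0 • A + (d * tr A) • .id ℝ V := fun A => by
    rw [sandwich_apply]
    simp
  simp only [hTA] at hT hT'
  have hid : c 0 0 + d * Module.finrank ℝ V = 0 := by
    have := hT _ id_mem_symEnd
    rw [tr_id, ← add_smul] at this
    exact smul_id_mem_basicEdge hE this
  have hle : ∀ A ∈ E, ∃ B ∈ traceless V, A = c 0 0 • B := by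
    intro A hA
    obtain ⟨t, B, hB, hAB⟩ := exists_smul_id_add_traceless A (hE.1 hA)
    refine ⟨B, hB, ?_⟩
    have h1 := hT' A hA
    have h2 : tr B = 0 := hB.2
    have h3 : t * (c 0 0 + d * Module.finrank ℝ V) = 0 := by rw [hid, mul_zero]
    rw [hAB, map_add, map_smul, tr_id, h2, add_zero, smul_add, add_right_comm] at h1
    rw [hAB, ← h1, smul_smul, ← add_smul, smul_eq_mul,
      show c 0 0 * t + d * (t * (Module.finrank ℝ V : ℝ)) = 0 by linarith, zero_smul, zero_add]
  by_cases hc : c 0 0 = 0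
  · refine Or.inl ((Submodule.eq_bot_iff _).2 fun A hA => ?_)
    obtain ⟨B, -, rfl⟩ := hle A hA
    rw [hc, zero_smul]
  · refine Or.inr (le_antisymm (fun A hA => ?_) fun A hA => ?_)
    · obtain ⟨B, hB, rfl⟩ := hle A hA
      exact Submodule.smul_mem _ _ hB
    · have h1 := hT A hA.1
      have h2 : tr A = 0 := hA.2
      rw [h2, mul_zero, zero_smul, add_zero] at h1
      have := E.smul_mem (c 0 0)⁻¹ h1
      rwa [smul_smul, inv_mul_cancel₀ hc, one_smul] at this

theorem isIrreducibleUnder_top_traceless (h : 2 ≤ Module.finrank ℝ V) :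
    IsIrreducibleUnder ⊤ (traceless V) := by
  have : Nontrivial V := Module.nontrivial_of_finrank_pos (R := ℝ) (by omega)
  refine ⟨invGroup_traceless.ge, fun h0 => ?_, fun E hE hG =>
    eq_bot_or_traceless_of_invariant (isBasicEdge_of_le_traceless hE) hG⟩
  obtain ⟨x, y, hmem, hne⟩ := exists_orbit_difference_ne_zero
    (R := fun _ : Fin 1 => ContinuousLinearMap.id ℝ V)
    (fun a b x => by rw [Subsingleton.elim a b]; simp) (by rw [Fintype.card_fin]; omega) 0 rfl
  rw [h0] at hmem
  exact hne hmem

end OrthogonalGroup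

section UnitaryGroup

variable {J : V →L[ℝ] V}

omit [FiniteDimensional ℝ V] in
theorem comp_mem_hermSkew (hJ : IsComplexStructure J) {A : V →L[ℝ] V} (hA : A ∈ hermSkew J) :
    J ∘L A ∈ hermSkew J := by
  refine ⟨fun x y => ?_, fun x => ?_⟩
  · simp only [ContinuousLinearMap.comp_apply]
    rw [hJ.inner_left, hA.1, hA.2, inner_neg_right, neg_neg]
  · simp [hA.2]

omit [FiniteDimensional ℝ V] in
theorem hermSkew_ne_bot [Nontrivial V] (hJ : IsComplexStructure J) : hermSkew J ≠ ⊥ := by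
  intro h
  obtain ⟨x, hx⟩ := exists_ne (0 : V)
  have hmem : rankOne ℝ x x - rankOne ℝ (J x) (J x) ∈ hermSkew J := by
    refine ⟨sub_mem (rankOne_self_mem_symEnd x) (rankOne_self_mem_symEnd _), fun y => ?_⟩
    simp only [_root_.sub_apply, InnerProductSpace.rankOne_apply, map_sub, map_smul, hJ.sq,
      hJ.isometry]
    rw [hJ.inner_left x y]
    module
  rw [h, Submodule.mem_bot] at hmem
  have := congrArg (fun f : V →L[ℝ] V => f x) hmem
  simp only [_root_.sub_apply, InnerProductSpace.rankOne_apply, hJ.inner_self, zero_smul,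
    sub_zero, _root_.zero_apply, smul_eq_zero, inner_self_eq_zero, or_self] at this
  exact hx this

/-- The witness is the difference of the projections onto two orthogonal complex lines. -/
theorem hermSym0_ne_bot (hJ : IsComplexStructure J) (h : 2 < Module.finrank ℝ V) :
    hermSym0 J ≠ ⊥ := by
  intro h0
  obtain ⟨x, y, hmem, hne⟩ := exists_orbit_difference_ne_zero (complexOrbit_inner hJ)
    (by simpa using h) 0 rfl
  refine hne ((Submodule.eq_bot_iff _).1 h0 _ ⟨⟨hmem.1, fun z => ?_⟩, hmem⟩)
  rw [Fin.sum_univ_two]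
  simp only [complexOrbit, Matrix.cons_val_zero, Matrix.cons_val_one,
    ContinuousLinearMap.id_apply, _root_.add_apply, _root_.sub_apply,
    InnerProductSpace.rankOne_apply, map_add, map_sub, map_smul, hJ.sq, hJ.isometry]
  rw [← neg_eq_iff_eq_neg.2 (hJ.inner_left x z), ← neg_eq_iff_eq_neg.2 (hJ.inner_left y z)]
  module

/-- The projection onto E kills Id, is the real scalar c₀₀ + c₁₁ on the traceless J-linear part, and
is left composition with β + γJ on the skew part, where β = c₀₀ - c₁₁ and γ = 2c₀₁. A complex number
is zero or invertible, so each component is either contained in E or contributes nothing. -/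
theorem eq_of_invariant_of_isTransitiveAlong_complexOrbit [Nontrivial V]
    (hJ : IsComplexStructure J) {G : Subgroup (V ≃ₗᵢ[ℝ] V)}
    (hcomm : ∀ g ∈ G, ∀ x, g (J x) = J (g x)) (htrans : IsTransitiveAlong (complexOrbit J) G)
    {E : Submodule ℝ (V →L[ℝ] V)}
    (hE : IsBasicEdge E) (hG : G ≤ invGroup (E : Set (V →L[ℝ] V))) :
    E = ⊥ ∨ E = hermSym0 J ∨ E = hermSkew J ∨ E = traceless V := by
  obtain ⟨c, d, hc, hT, hT'⟩ := exists_sandwich_projection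
    (R := complexOrbit J) (R' := ![.id ℝ V, -J]) (fun a x y => by
      fin_cases a
      · rfl
      · simp [complexOrbit, hJ.inner_left])
    (complexOrbit_inner hJ) (fun g hg a x => by
      fin_cases a
      · rfl
      · exact hcomm g hg x) htrans hE.1 hG
  set T := sandwich (complexOrbit J) ![.id ℝ V, -J] c d
  have hTsym : ∀ A ∈ hermSym0 J, T A = (c 0 0 + c 1 1) • A := by
    intro A hA
    have htr : tr A = 0 := hA.2.2
    ext x
    simp only [T, sandwich_apply, Fin.sum_univ_two, complexOrbit, Matrix.cons_val_zero,
      Matrix.cons_val_one, htr, hc 1 0, _root_.add_apply, _root_.smul_apply,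
      ContinuousLinearMap.comp_apply, ContinuousLinearMap.id_apply, _root_.neg_apply, map_neg,
      hA.1.2, hJ.sq]
    module
  have hTskew : ∀ A ∈ hermSkew J, T A = (c 0 0 - c 1 1) • A + (2 * c 0 1) • (J ∘L A) := by
    intro A hA
    have htr : tr A = 0 := (hermSkew_le_traceless hJ hA).2
    ext x
    simp only [T, sandwich_apply, Fin.sum_univ_two, complexOrbit, Matrix.cons_val_zero,
      Matrix.cons_val_one, htr, hc 1 0, _root_.add_apply, _root_.smul_apply,
      ContinuousLinearMap.comp_apply, ContinuousLinearMap.id_apply, _root_.neg_apply, map_neg,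
      hA.2, hJ.sq]
    module
  have hTid : T (.id ℝ V) = 0 := by
    have h1 : T (.id ℝ V) = (c 0 0 + c 1 1 + d * Module.finrank ℝ V) • .id ℝ V := by
      ext x
      simp only [T, sandwich_apply, Fin.sum_univ_two, complexOrbit, Matrix.cons_val_zero,
        Matrix.cons_val_one, tr_id, hc 1 0, _root_.add_apply, _root_.smul_apply,
        ContinuousLinearMap.comp_apply, ContinuousLinearMap.id_apply, _root_.neg_apply, map_neg,
        hJ.sq]
      module
    have h2 := hT _ id_mem_symEnd
    rw [h1] at h2 ⊢
    rw [smul_id_mem_basicEdge hE h2, zero_smul]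
  set α := c 0 0 + c 1 1
  set β := c 0 0 - c 1 1
  set γ := 2 * c 0 1
  have hdec : ∀ A ∈ E, ∃ B ∈ hermSym0 J, ∃ C ∈ hermSkew J, A = α • B + T C := by
    intro A hA
    obtain ⟨t, A', hA', hAt⟩ := exists_smul_id_add_traceless A (hE.1 hA)
    obtain ⟨B, hB, C, hC, rfl⟩ := exists_hermSym0_add_hermSkew hJ hA'
    refine ⟨B, hB, C, hC, ?_⟩
    conv_lhs => rw [← hT' A hA, hAt]
    rw [map_add, map_smul, hTid, smul_zero, zero_add, map_add, hTsym B hB]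
  have hTC : ∀ C ∈ hermSkew J, T C ∈ hermSkew J := fun C hC => by
    rw [hTskew C hC]
    exact add_mem (Submodule.smul_mem _ _ hC) (Submodule.smul_mem _ _ (comp_mem_hermSkew hJ hC))
  have hα : α ≠ 0 → hermSym0 J ≤ E := fun h A hA => by
    have := E.smul_mem α⁻¹ (hTsym A hA ▸ hT A hA.1.1)
    rwa [smul_smul, inv_mul_cancel₀ h, one_smul] at this
  have hβ : β ^ 2 + γ ^ 2 ≠ 0 → hermSkew J ≤ E := fun h A hA => by
    -- The preimage of `A` is obtained from the inverse (β - γJ)/(β² + γ²) of β + γJ.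
    have hmem : (β ^ 2 + γ ^ 2)⁻¹ • (β • A - γ • (J ∘L A)) ∈ hermSkew J :=
      Submodule.smul_mem _ _ (sub_mem (Submodule.smul_mem _ _ hA)
        (Submodule.smul_mem _ _ (comp_mem_hermSkew hJ hA)))
    have h1 := hTskew _ hmem ▸ hT _ hmem.1
    have h2 : β • (β ^ 2 + γ ^ 2)⁻¹ • (β • A - γ • (J ∘L A)) +
        γ • (J ∘L ((β ^ 2 + γ ^ 2)⁻¹ • (β • A - γ • (J ∘L A)))) =
        ((β ^ 2 + γ ^ 2)⁻¹ * (β ^ 2 + γ ^ 2)) • A := by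
      ext x
      simp only [_root_.add_apply, _root_.sub_apply, _root_.smul_apply,
        ContinuousLinearMap.comp_apply, map_smul, map_sub, hJ.sq]
      module
    rwa [h2, inv_mul_cancel₀ h, one_smul] at h1
  have hβ0 : β ^ 2 + γ ^ 2 = 0 → ∀ C ∈ hermSkew J, T C = 0 := fun h C hC => by
    have h1 : β = 0 := by nlinarith [sq_nonneg β, sq_nonneg γ]
    have h2 : γ = 0 := by nlinarith [sq_nonneg β, sq_nonneg γ]
    rw [hTskew C hC, h1, h2, zero_smul, zero_smul, zero_add]
  by_cases h1 : α = 0 <;> by_cases h2 : β ^ 2 + γ ^ 2 = 0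
  · refine Or.inl ((Submodule.eq_bot_iff _).2 fun A hA => ?_)
    obtain ⟨B, -, C, hC, rfl⟩ := hdec A hA
    rw [h1, zero_smul, hβ0 h2 C hC, zero_add]
  · refine Or.inr (Or.inr (Or.inl (le_antisymm (fun A hA => ?_) (hβ h2))))
    obtain ⟨B, -, C, hC, rfl⟩ := hdec A hA
    rw [h1, zero_smul, zero_add]
    exact hTC C hC
  · refine Or.inr (Or.inl (le_antisymm (fun A hA => ?_) (hα h1)))
    obtain ⟨B, hB, C, hC, rfl⟩ := hdec A hA
    rw [hβ0 h2 C hC, add_zero]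
    exact Submodule.smul_mem _ _ hB
  · refine Or.inr (Or.inr (Or.inr (le_antisymm (fun A hA => ?_) ?_)))
    · obtain ⟨B, hB, C, hC, rfl⟩ := hdec A hA
      exact add_mem (Submodule.smul_mem _ _ hB.2) (hermSkew_le_traceless hJ (hTC C hC))
    · rw [← hermSym0_sup_hermSkew hJ]
      exact sup_le (hα h1) (hβ h2)

end UnitaryGroup

end InvariantEdges

/-! ### Transitivity of the unitary group -/

section ComplexSpace

theorem real_inner_eq_re_complex_inner {n : ℕ} (x y : EuclideanSpace ℂ (Fin n)) :
    inner ℝ x y = (inner ℂ x y).re := by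
  simp [PiLp.inner_apply, Complex.inner, mul_comm]

theorem isComplexStructure_mulI (n : ℕ) : IsComplexStructure (mulI n) where
  sq x := by
    change Complex.I • Complex.I • x = -x
    rw [smul_smul, Complex.I_mul_I, neg_one_smul]
  isometry x y := by
    change inner ℝ (Complex.I • x) (Complex.I • y) = inner ℝ x y
    rw [real_inner_eq_re_complex_inner, real_inner_eq_re_complex_inner, inner_smul_left,
      inner_smul_right, ← mul_assoc]
    simp

/-- The unitary quasi-reflection `z ↦ z - ⟨u, z⟩ ⟨u, y⟩⁻¹ u` with `u = y - y'`. -/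
theorem isTransitiveAlong_unitaryGrp (n : ℕ) :
    IsTransitiveAlong (complexOrbit (mulI n)) (unitaryGrp n) := by
  intro y y' h
  by_cases hyy : y = y'
  · exact ⟨1, one_mem _, hyy, fun _ _ => rfl⟩
  set u := y - y' with hu
  have hu0 : u ≠ 0 := sub_ne_zero.2 hyy
  set w : ℂ := inner ℂ u y with hw
  -- This is where `‖y‖ = ‖y'‖` enters; it makes `w` nonzero and the quasi-reflection isometric.
  have hnorm : (2 * w.re : ℝ) = ‖u‖ ^ 2 := by
    have h1 : w.re = inner ℝ u y := (real_inner_eq_re_complex_inner u y).symm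
    have h2 : ‖u‖ ^ 2 = ‖y‖ ^ 2 - 2 * inner ℝ y y' + ‖y'‖ ^ 2 := norm_sub_sq_real y y'
    rw [h1, h2, hu, inner_sub_left, real_inner_self_eq_norm_sq, real_inner_comm, h]
    ring
  have hw0 : w ≠ 0 := by
    intro h0
    rw [h0] at hnorm
    have : 0 < ‖u‖ ^ 2 := by positivity
    rw [← hnorm, Complex.zero_re, mul_zero] at this
    exact lt_irrefl _ this
  let f : EuclideanSpace ℂ (Fin n) →ₗ[ℂ] EuclideanSpace ℂ (Fin n) :=
    LinearMap.id - w⁻¹ • ((innerSL ℂ u : EuclideanSpace ℂ (Fin n) →ₗ[ℂ] ℂ).smulRight u)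
  have hf : ∀ z, f z = z - (w⁻¹ * inner ℂ u z) • u := fun z => by
    simp [f, smul_smul]
  have hfn : ∀ z, ‖f z‖ = ‖z‖ := by
    intro z
    rw [← sq_eq_sq₀ (norm_nonneg _) (norm_nonneg _), hf, norm_sub_sq (𝕜 := ℂ), inner_smul_right,
      norm_smul, mul_pow, ← hnorm]
    have h1 : inner ℂ z u = (starRingEnd ℂ) (inner ℂ u z) := (inner_conj_symm z u).symm
    rw [h1, mul_assoc, Complex.mul_conj, norm_mul, mul_pow, norm_inv, ← Complex.normSq_eq_norm_sq,
      inv_pow, ← Complex.normSq_eq_norm_sq]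
    have h2 : Complex.normSq w ≠ 0 := by simpa using hw0
    have h3 : RCLike.re (w⁻¹ * (Complex.normSq (inner ℂ u z) : ℂ)) =
        w.re / Complex.normSq w * Complex.normSq (inner ℂ u z) := by
      simp
    rw [h3]
    field_simp
    ring
  let L : EuclideanSpace ℂ (Fin n) →ₗᵢ[ℝ] EuclideanSpace ℂ (Fin n) :=
    ⟨f.restrictScalars ℝ, hfn⟩
  refine ⟨L.toLinearIsometryEquiv rfl, fun c x => ?_, ?_, fun z hz => ?_⟩
  · exact f.map_smul c x
  · change f y = y'
    rw [hf, ← hw, inv_mul_cancel₀ hw0, one_smul, hu, sub_sub_cancel]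
  · change f z = z
    have h1 := hz 0
    have h2 := hz 1
    simp only [complexOrbit, Matrix.cons_val_zero, Matrix.cons_val_one,
      ContinuousLinearMap.id_apply] at h1 h2
    have h3 : inner ℝ z u = (0 : ℝ) := by rw [hu, inner_sub_right, h1.1, h1.2, sub_zero]
    have h4 : inner ℝ (mulI n z) u = (0 : ℝ) := by rw [hu, inner_sub_right, h2.1, h2.2, sub_zero]
    -- Real orthogonality of both `z` and `i z` to `u` is complex orthogonality.
    have h5 : inner ℂ z u = 0 := by
      change inner ℝ (Complex.I • z) u = (0 : ℝ) at h4
      rw [real_inner_eq_re_complex_inner] at h3 h4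
      rw [inner_smul_left] at h4
      refine Complex.ext h3 ?_
      simpa using h4
    rw [hf, inner_eq_zero_symm.1 h5, mul_zero, zero_smul, sub_zero]

end ComplexSpace

/-! ### Orthonormal imaginary quaternions -/

section QuaternionPairs

open Quaternion

theorem quaternion_star_of_re {p : ℍ[ℝ]} (hp : p.re = 0) : star p = -p :=
  Quaternion.star_eq_neg.2 hp

theorem quaternion_mul_self {p : ℍ[ℝ]} (hp : p.re = 0) (h1 : ‖p‖ = 1) : p * p = -1 := by
  have h := Quaternion.self_mul_star p
  rw [quaternion_star_of_re hp, Quaternion.normSq_eq_norm_mul_self, h1] at h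
  rw [mul_neg, neg_eq_iff_eq_neg] at h
  simpa using h

/-- Two orthogonal imaginary unit quaternions. -/
structure IsImPair (p q : ℍ[ℝ]) : Prop where
  re_left : p.re = 0
  re_right : q.re = 0
  norm_left : ‖p‖ = 1
  norm_right : ‖q‖ = 1
  inner_eq_zero : inner ℝ p q = (0 : ℝ)

namespace IsImPair

variable {p q : ℍ[ℝ]}

theorem symm (h : IsImPair p q) : IsImPair q p :=
  ⟨h.re_right, h.re_left, h.norm_right, h.norm_left, by rw [real_inner_comm]; exact h.inner_eq_zero⟩

theorem sq_left (h : IsImPair p q) : p * p = -1 := quaternion_mul_self h.re_left h.norm_left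

theorem sq_right (h : IsImPair p q) : q * q = -1 := quaternion_mul_self h.re_right h.norm_right

/-- From p q̄ + q p̄ = 2⟨p, q⟩ = 0, conjugation being negation on imaginary quaternions. -/
theorem anticomm (h : IsImPair p q) : q * p = -(p * q) := by
  have h1 := Quaternion.self_add_star (p * star q)
  rw [← Quaternion.inner_def, h.inner_eq_zero, star_mul, star_star, quaternion_star_of_re h.re_left,
    quaternion_star_of_re h.re_right] at h1
  simp only [mul_neg, coe_zero, mul_zero] at h1
  rw [← neg_add, neg_eq_zero, add_comm] at h1
  exact eq_neg_of_add_eq_zero_left h1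

theorem re_mul (h : IsImPair p q) : (p * q).re = 0 := by
  have h1 := h.inner_eq_zero
  rw [Quaternion.inner_def, quaternion_star_of_re h.re_right, mul_neg, Quaternion.re_neg] at h1
  linarith

theorem mul_right (h : IsImPair p q) : IsImPair p (p * q) where
  re_left := h.re_left
  re_right := h.re_mul
  norm_left := h.norm_left
  norm_right := by rw [norm_mul, h.norm_left, h.norm_right, one_mul]
  inner_eq_zero := by
    rw [Quaternion.inner_def, quaternion_star_of_re h.re_mul, mul_neg, ← mul_assoc, h.sq_left]
    simp [h.re_right]

theorem mul_left (h : IsImPair p q) : IsImPair q (p * q) where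
  re_left := h.re_right
  re_right := h.re_mul
  norm_left := h.norm_right
  norm_right := by rw [norm_mul, h.norm_left, h.norm_right, one_mul]
  inner_eq_zero := by
    rw [Quaternion.inner_def, quaternion_star_of_re h.re_mul, mul_neg, ← mul_assoc, h.anticomm,
      neg_mul, mul_assoc, h.sq_right]
    simp [h.re_left]

/-- The orthonormal family `1, p, q, pq`. -/
def family (p q : ℍ[ℝ]) : Fin 4 → ℍ[ℝ] := ![1, p, q, p * q]

theorem orthonormal_family (h : IsImPair p q) : Orthonormal ℝ (family p q) := by
  have h1 : ∀ r : ℍ[ℝ], r.re = 0 → inner ℝ 1 r = (0 : ℝ) := fun r hr => by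
    rw [Quaternion.inner_def, one_mul, Quaternion.re_star, hr]
  have hpq := h.mul_right
  have hqp := h.mul_left
  refine ⟨fun i => ?_, fun i j hij => ?_⟩
  · fin_cases i
    · exact norm_one
    · exact h.norm_left
    · exact h.norm_right
    · exact hpq.norm_right
  · fin_cases i <;> fin_cases j <;>
      first
      | exact absurd rfl hij
      | exact h1 _ h.re_left
      | exact h1 _ h.re_right
      | exact h1 _ h.re_mul
      | exact (real_inner_comm _ _).trans (h1 _ h.re_left)
      | exact (real_inner_comm _ _).trans (h1 _ h.re_right)
      | exact (real_inner_comm _ _).trans (h1 _ h.re_mul)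
      | exact h.inner_eq_zero
      | exact h.symm.inner_eq_zero
      | exact hpq.inner_eq_zero
      | exact hpq.symm.inner_eq_zero
      | exact hqp.inner_eq_zero
      | exact hqp.symm.inner_eq_zero

/-- The orthonormal basis `1, p, q, pq` of the quaternions. -/
def basis (h : IsImPair p q) : OrthonormalBasis (Fin 4) ℝ ℍ[ℝ] :=
  OrthonormalBasis.mk h.orthonormal_family
    (h.orthonormal_family.linearIndependent.span_eq_top_of_card_eq_finrank
      (by rw [Fintype.card_fin, Quaternion.finrank_eq_four])).ge

theorem coe_basis (h : IsImPair p q) : ⇑h.basis = family p q := OrthonormalBasis.coe_mk _ _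

theorem eq_sum (h : IsImPair p q) (x : ℍ[ℝ]) : ∃ a b c d : ℝ,
    x = a • 1 + b • p + c • q + d • (p * q) := by
  have h1 := h.basis.sum_repr x
  rw [Fin.sum_univ_four, h.coe_basis] at h1
  exact ⟨_, _, _, _, h1.symm⟩

theorem eq_sum_of_re (h : IsImPair p q) {x : ℍ[ℝ]} (hx : x.re = 0) : ∃ b c d : ℝ,
    x = b • p + c • q + d • (p * q) := by
  obtain ⟨a, b, c, d, rfl⟩ := h.eq_sum x
  have ha : a = 0 := by simpa [h.re_left, h.re_right, h.re_mul] using hx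
  exact ⟨b, c, d, by rw [ha, zero_smul, zero_add]⟩

theorem isImFrame (h : IsImPair p q) : IsImFrame ![p, q, p * q] := by
  constructor
  · have h1 := h.orthonormal_family.comp Fin.succ (Fin.succ_injective 3)
    exact h1
  · intro m
    fin_cases m
    · exact h.re_left
    · exact h.re_right
    · exact h.re_mul

end IsImPair

namespace IsImFrame

variable {b : Fin 3 → ℍ[ℝ]}

theorem pair (hb : IsImFrame b) {i j : Fin 3} (hij : i ≠ j) : IsImPair (b i) (b j) :=
  ⟨hb.2 i, hb.2 j, hb.1.1 i, hb.1.1 j, hb.1.2 hij⟩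

theorem comp_perm (hb : IsImFrame b) (π : Equiv.Perm (Fin 3)) : IsImFrame (b ∘ π) :=
  ⟨hb.1.comp π π.injective, fun m => hb.2 (π m)⟩

/-- The third vector is orthogonal to the first two in Im ℍ, so it is their product up to sign. The
sign stays free because frames are not assumed oriented. -/
theorem exists_third (hb : IsImFrame b) : ∃ σ : ℝ, σ * σ = 1 ∧ b 2 = σ • (b 0 * b 1) := by
  have h01 := hb.pair (i := 0) (j := 1) (by decide)
  have h0 := (hb.pair (i := 0) (j := 2) (by decide)).inner_eq_zero
  have h1 := (hb.pair (i := 1) (j := 2) (by decide)).inner_eq_zero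
  obtain ⟨x, y, z, h⟩ := h01.eq_sum_of_re (hb.2 2)
  have e0 : inner ℝ (b 0) (b 0) = (1 : ℝ) := by
    rw [real_inner_self_eq_norm_sq, h01.norm_left, one_pow]
  have e1 : inner ℝ (b 1) (b 1) = (1 : ℝ) := by
    rw [real_inner_self_eq_norm_sq, h01.norm_right, one_pow]
  have hx : x = 0 := by
    rw [h, inner_add_right, inner_add_right, real_inner_smul_right, real_inner_smul_right,
      real_inner_smul_right, e0, h01.inner_eq_zero, h01.mul_right.inner_eq_zero] at h0
    linarith
  have hy : y = 0 := by
    rw [h, inner_add_right, inner_add_right, real_inner_smul_right, real_inner_smul_right,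
      real_inner_smul_right, e1, h01.symm.inner_eq_zero, h01.mul_left.inner_eq_zero] at h1
    linarith
  rw [hx, hy, zero_smul, zero_smul, zero_add, zero_add] at h
  refine ⟨z, ?_, h⟩
  have h2 := hb.1.1 2
  rw [h, norm_smul, h01.mul_right.norm_right, mul_one, Real.norm_eq_abs] at h2
  rw [← abs_mul_abs_self, h2, one_mul]

theorem eq_sum_of_re (hb : IsImFrame b) {x : ℍ[ℝ]} (hx : x.re = 0) : ∃ y : Fin 3 → ℝ,
    x = y 0 • b 0 + y 1 • b 1 + y 2 • b 2 := by
  obtain ⟨σ, hσ, h2⟩ := hb.exists_third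
  obtain ⟨u, v, w, rfl⟩ := (hb.pair (i := 0) (j := 1) (by decide)).eq_sum_of_re hx
  refine ⟨![u, v, w * σ], ?_⟩
  rw [h2]
  simp [smul_smul, mul_assoc, hσ]

end IsImFrame

end QuaternionPairs

/-! ### Right multiplications and the components E_p -/

section RightMultiplication

variable {n : ℕ}

theorem rmul_add (p q : ℍ[ℝ]) (x : QSpace n) : rmul n (p + q) x = rmul n p x + rmul n q x :=
  QSpace.ext_coord fun l => by simp [rmul_coord, QSpace.coord_add, mul_add]

theorem rmul_smul (c : ℝ) (q : ℍ[ℝ]) (x : QSpace n) : rmul n (c • q) x = c • rmul n q x :=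
  QSpace.ext_coord fun l => by simp [rmul_coord, QSpace.coord_smul]

/-- Right multiplication as a linear map in the quaternion. -/
def rmulₗ (x : QSpace n) : ℍ[ℝ] →ₗ[ℝ] QSpace n where
  toFun q := rmul n q x
  map_add' p q := rmul_add p q x
  map_smul' c q := rmul_smul c q x

theorem rmul_neg (q : ℍ[ℝ]) (x : QSpace n) : rmul n (-q) x = -rmul n q x := (rmulₗ x).map_neg q

theorem rmul_zero (x : QSpace n) : rmul n 0 x = 0 := (rmulₗ x).map_zero

theorem inner_rmul_left (q : ℍ[ℝ]) (x y : QSpace n) :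
    inner ℝ (rmul n q x) y = inner ℝ x (rmul n (star q) y) := by
  rw [QSpace.inner_eq, QSpace.inner_eq]
  refine Finset.sum_congr rfl fun l _ => ?_
  rw [rmul_coord, rmul_coord, Quaternion.inner_def, Quaternion.inner_def, star_mul, star_star,
    mul_assoc]

theorem inner_rmul_self (q : ℍ[ℝ]) (x : QSpace n) :
    inner ℝ (rmul n q x) x = q.re * inner ℝ x x := by
  rw [QSpace.inner_eq, QSpace.inner_eq, Finset.mul_sum]
  refine Finset.sum_congr rfl fun l _ => ?_
  rw [rmul_coord, Quaternion.inner_def, Quaternion.inner_def]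
  simp only [Quaternion.re_mul, Quaternion.re_star, Quaternion.imI_star, Quaternion.imJ_star,
    Quaternion.imK_star, Quaternion.imI_mul, Quaternion.imJ_mul, Quaternion.imK_mul]
  ring

theorem inner_rmul_rmul (p q : ℍ[ℝ]) (x : QSpace n) :
    inner ℝ (rmul n p x) (rmul n q x) = inner ℝ p q * inner ℝ x x := by
  have h := inner_rmul_left (star q) (rmul n p x) x
  rw [star_star] at h
  rw [← h, rmul_rmul, inner_rmul_self, Quaternion.inner_def]

theorem isComplexStructure_rmul {p : ℍ[ℝ]} (hp : p.re = 0) (h1 : ‖p‖ = 1) :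
    IsComplexStructure (rmul n p) where
  sq x := by rw [rmul_rmul, quaternion_mul_self hp h1, rmul_neg, rmul_one]
  isometry x y := by
    rw [inner_rmul_left, rmul_rmul, quaternion_star_of_re hp, mul_neg, quaternion_mul_self hp h1,
      neg_neg, rmul_one]

theorem inner_rmul_left_of_re {p : ℍ[ℝ]} (hp : p.re = 0) (x y : QSpace n) :
    inner ℝ (rmul n p x) y = -inner ℝ x (rmul n p y) := by
  rw [inner_rmul_left, quaternion_star_of_re hp, rmul_neg, inner_neg_right]

namespace IsImPair

variable {p q : ℍ[ℝ]}

theorem cs_left (h : IsImPair p q) : IsComplexStructure (rmul n p) :=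
  isComplexStructure_rmul h.re_left h.norm_left

theorem rmul_anticomm (h : IsImPair p q) (x : QSpace n) :
    rmul n p (rmul n q x) = -rmul n q (rmul n p x) := by
  rw [rmul_rmul, rmul_rmul, h.anticomm, rmul_neg]

theorem commute_rmul (h : IsImPair p q) {A : QSpace n →L[ℝ] QSpace n}
    (hp : ∀ x, A (rmul n p x) = rmul n p (A x)) (hq : ∀ x, A (rmul n q x) = rmul n q (A x))
    (c : ℍ[ℝ]) (x : QSpace n) : A (rmul n c x) = rmul n c (A x) := by
  obtain ⟨r, s, t, u, rfl⟩ := h.eq_sum c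
  have hpq : ∀ x, A (rmul n (p * q) x) = rmul n (p * q) (A x) := fun x => by
    rw [← rmul_rmul, ← rmul_rmul, hq, hp]
  simp only [rmul_add, rmul_smul, rmul_one, map_add, map_smul, hp, hq, hpq]

theorem mem_qHermSym (h : IsImPair p q) {A : QSpace n →L[ℝ] QSpace n} (hA : A ∈ SymEnd (QSpace n))
    (hp : ∀ x, A (rmul n p x) = rmul n p (A x)) (hq : ∀ x, A (rmul n q x) = rmul n q (A x)) :
    A ∈ qHermSym n := ⟨hA, h.commute_rmul hp hq⟩

/-- The skew factor is -R_p A. It commutes with R_q because both R_p and A anticommute with R_q. -/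
theorem mem_qEdge (h : IsImPair p q) {A : QSpace n →L[ℝ] QSpace n} (hA : A ∈ SymEnd (QSpace n))
    (hp : ∀ x, A (rmul n p x) = rmul n p (A x)) (hq : ∀ x, A (rmul n q x) = -rmul n q (A x)) :
    A ∈ qEdge n p := by
  have hJ : IsComplexStructure (rmul n p) := h.cs_left
  refine ⟨-(rmul n p ∘L A), ⟨fun x y => ?_, h.commute_rmul (fun x => ?_) fun x => ?_⟩, ?_⟩
  · simp only [_root_.neg_apply, ContinuousLinearMap.comp_apply, inner_neg_left, inner_neg_right]
    rw [hJ.inner_left, hA, hp]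
  · simp [hp]
  · simp [hq, h.rmul_anticomm]
  · ext1 x
    simp [hJ.sq]

end IsImPair

theorem qEdge_mem_symEnd {v : ℍ[ℝ]} (hv : v.re = 0) {A : QSpace n →L[ℝ] QSpace n}
    (hA : A ∈ qEdge n v) : A ∈ SymEnd (QSpace n) := by
  obtain ⟨B, hB, rfl⟩ := hA
  intro x y
  simp only [ContinuousLinearMap.comp_apply]
  rw [inner_rmul_left_of_re hv, hB.1, neg_neg, hB.2]

theorem qEdge_commute {v : ℍ[ℝ]} {A : QSpace n →L[ℝ] QSpace n} (hA : A ∈ qEdge n v)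
    (x : QSpace n) : A (rmul n v x) = rmul n v (A x) := by
  obtain ⟨B, hB, rfl⟩ := hA
  simp only [ContinuousLinearMap.comp_apply, hB.2]

theorem qEdge_anticommute {p q : ℍ[ℝ]} (h : IsImPair p q) {A : QSpace n →L[ℝ] QSpace n}
    (hA : A ∈ qEdge n p) (x : QSpace n) : A (rmul n q x) = -rmul n q (A x) := by
  obtain ⟨B, hB, rfl⟩ := hA
  simp only [ContinuousLinearMap.comp_apply, hB.2, h.rmul_anticomm]

theorem qEdge_le_traceless {p q : ℍ[ℝ]} (h : IsImPair p q) : qEdge n p ≤ traceless (QSpace n) :=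
  fun _ hA => ⟨qEdge_mem_symEnd h.re_left hA,
    tr_eq_zero_of_anticommute h.symm.cs_left (qEdge_anticommute h hA)⟩

end RightMultiplication

/-! ### Decomposition of Sym²(ℍⁿ) and quaternionic geometric subequations -/

section QuaternionicDecomposition

variable {n : ℕ} {p q : ℍ[ℝ]}

theorem quaternion_mul_star {c : ℍ[ℝ]} (hc : ‖c‖ = 1) : c * star c = 1 := by
  rw [Quaternion.self_mul_star, Quaternion.normSq_eq_norm_mul_self, hc, mul_one]
  rfl

theorem qHermSym0_le_traceless (n : ℕ) : qHermSym0 n ≤ traceless (QSpace n) := inf_le_right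

namespace IsImPair

/-- Conjugation by R_q is an involution of the left-hand side. What commutes with R_p and R_q is
ℍ-linear; what commutes with R_p and anticommutes with R_q is in E_p. -/
theorem hermSym0_eq (h : IsImPair p q) :
    hermSym0 (rmul n p) = qHermSym0 n ⊔ qEdge n p := by
  refine le_antisymm (fun A hA => ?_) (sup_le ?_ ?_)
  · have hq := h.symm.cs_left (n := n)
    have hs := comp_comp_mem_symEnd hq hA.1.1
    have htr : tr A = 0 := hA.2.2
    have hAp := hA.1.2
    have h1 : (1 / 2 : ℝ) • (A - rmul n q ∘L A ∘L rmul n q) ∈ qHermSym0 n := by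
      refine ⟨h.mem_qHermSym (Submodule.smul_mem _ _ (sub_mem hA.1.1 hs)) (fun x => ?_)
        fun x => ?_, Submodule.smul_mem _ _ (sub_mem hA.1.1 hs), ?_⟩
      · simp [hAp, h.symm.rmul_anticomm]
      · simp [hq.sq, add_comm]
      · rw [SetLike.mem_coe, LinearMap.mem_ker, map_smul, map_sub, tr_comp_comp hq, htr]
        simp
    have h2 : (1 / 2 : ℝ) • (A + rmul n q ∘L A ∘L rmul n q) ∈ qEdge n p := by
      refine h.mem_qEdge (Submodule.smul_mem _ _ (add_mem hA.1.1 hs)) (fun x => ?_) fun x => ?_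
      · simp [hAp, h.symm.rmul_anticomm]
      · simp [hq.sq]
    have h3 := Submodule.add_mem_sup h1 h2
    rwa [show (1 / 2 : ℝ) • (A - rmul n q ∘L A ∘L rmul n q) +
      (1 / 2 : ℝ) • (A + rmul n q ∘L A ∘L rmul n q) = A by module] at h3
  · exact fun A hA => ⟨⟨hA.1.1, hA.1.2 p⟩, hA.2⟩
  · exact fun A hA => ⟨⟨qEdge_mem_symEnd h.re_left hA, qEdge_commute hA⟩, qEdge_le_traceless h hA⟩

/-- The same involution is used. The part anticommuting with both R_p and R_q commutes with R_pq,
which places it in E_pq. -/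
theorem hermSkew_eq (h : IsImPair p q) :
    hermSkew (rmul n p) = qEdge n q ⊔ qEdge n (p * q) := by
  refine le_antisymm (fun A hA => ?_) (sup_le ?_ ?_)
  · have hq := h.symm.cs_left (n := n)
    have hs := comp_comp_mem_symEnd hq hA.1
    have hAp := hA.2
    have h1 : (1 / 2 : ℝ) • (A - rmul n q ∘L A ∘L rmul n q) ∈ qEdge n q := by
      refine h.symm.mem_qEdge (Submodule.smul_mem _ _ (sub_mem hA.1 hs)) (fun x => ?_) fun x => ?_
      · simp [hq.sq, add_comm]
      · simp only [_root_.smul_apply, _root_.sub_apply, ContinuousLinearMap.comp_apply, hAp,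
          h.symm.rmul_anticomm, map_neg, map_smul, map_sub]
        module
    have h2 : (1 / 2 : ℝ) • (A + rmul n q ∘L A ∘L rmul n q) ∈ qEdge n (p * q) := by
      have hA' : ∀ x, ((1 / 2 : ℝ) • (A + rmul n q ∘L A ∘L rmul n q)) (rmul n p x) =
          -rmul n p (((1 / 2 : ℝ) • (A + rmul n q ∘L A ∘L rmul n q)) x) := fun x => by
        simp [hAp, h.symm.rmul_anticomm, add_comm]
      have hA'' : ∀ x, ((1 / 2 : ℝ) • (A + rmul n q ∘L A ∘L rmul n q)) (rmul n q x) =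
          -rmul n q (((1 / 2 : ℝ) • (A + rmul n q ∘L A ∘L rmul n q)) x) := fun x => by
        simp [hq.sq]
      refine h.mul_right.symm.mem_qEdge (Submodule.smul_mem _ _ (add_mem hA.1 hs)) (fun x => ?_)
        hA'
      rw [← rmul_rmul, hA'', hA', map_neg, neg_neg, rmul_rmul]
    have h3 := Submodule.add_mem_sup h1 h2
    rwa [show (1 / 2 : ℝ) • (A - rmul n q ∘L A ∘L rmul n q) +
      (1 / 2 : ℝ) • (A + rmul n q ∘L A ∘L rmul n q) = A by module] at h3
  · exact fun A hA => ⟨qEdge_mem_symEnd h.re_right hA, qEdge_anticommute h.symm hA⟩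
  · exact fun A hA => ⟨qEdge_mem_symEnd h.re_mul hA, qEdge_anticommute h.mul_right.symm hA⟩

end IsImPair

theorem qEdge_smul_le (c : ℝ) (v : ℍ[ℝ]) : qEdge n (c • v) ≤ qEdge n v := by
  rintro _ ⟨B, hB, rfl⟩
  refine ⟨c • B, Submodule.smul_mem _ c hB, ?_⟩
  ext1 x
  simp [rmul_smul]

theorem qEdge_smul {c : ℝ} (hc : c ≠ 0) (v : ℍ[ℝ]) : qEdge n (c • v) = qEdge n v := by
  refine le_antisymm (qEdge_smul_le c v) ?_
  have := qEdge_smul_le (n := n) c⁻¹ (c • v)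
  rwa [smul_smul, inv_mul_cancel₀ hc, one_smul] at this

theorem qEdge_add_le (v w : ℍ[ℝ]) : qEdge n (v + w) ≤ qEdge n v ⊔ qEdge n w := by
  rintro _ ⟨B, hB, rfl⟩
  have h := Submodule.add_mem_sup (S := qEdge n v) (T := qEdge n w) ⟨B, hB, rfl⟩ ⟨B, hB, rfl⟩
  rwa [show rmul n v ∘L B + rmul n w ∘L B = rmul n (v + w) ∘L B by
    ext1 x; simp [rmul_add]] at h

theorem qEdge_zero : qEdge n 0 = ⊥ := by
  rw [Submodule.eq_bot_iff]
  rintro _ ⟨B, -, rfl⟩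
  ext1 x
  simp [rmul_zero]

namespace IsImFrame

variable {b : Fin 3 → ℍ[ℝ]}

theorem pair01 (hb : IsImFrame b) : IsImPair (b 0) (b 1) := hb.pair (by decide)

theorem qEdge_two (hb : IsImFrame b) : qEdge n (b 2) = qEdge n (b 0 * b 1) := by
  obtain ⟨σ, hσ, h2⟩ := hb.exists_third
  rw [h2, qEdge_smul]
  rintro rfl
  simp at hσ

theorem hermSym0_eq (hb : IsImFrame b) :
    hermSym0 (rmul n (b 0)) = qHermSym0 n ⊔ qEdge n (b 0) := hb.pair01.hermSym0_eq

theorem hermSkew_eq (hb : IsImFrame b) :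
    hermSkew (rmul n (b 0)) = qEdge n (b 1) ⊔ qEdge n (b 2) := by
  rw [hb.qEdge_two]
  exact hb.pair01.hermSkew_eq

theorem imHermSkew_eq (hb : IsImFrame b) :
    imHermSkew n = qEdge n (b 0) ⊔ qEdge n (b 1) ⊔ qEdge n (b 2) := by
  refine le_antisymm (iSup₂_le fun v hv => ?_) (sup_le (sup_le ?_ ?_) ?_)
  · obtain ⟨y, rfl⟩ := hb.eq_sum_of_re hv
    exact (qEdge_add_le _ _).trans (sup_le_sup ((qEdge_add_le _ _).trans
      (sup_le_sup (qEdge_smul_le _ _) (qEdge_smul_le _ _))) (qEdge_smul_le _ _))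
  · exact le_iSup₂_of_le (b 0) (hb.2 0) le_rfl
  · exact le_iSup₂_of_le (b 1) (hb.2 1) le_rfl
  · exact le_iSup₂_of_le (b 2) (hb.2 2) le_rfl

theorem qEdge_le_traceless (hb : IsImFrame b) (m : Fin 3) :
    qEdge n (b m) ≤ traceless (QSpace n) := by
  obtain ⟨m', hm⟩ := exists_ne m
  exact _root_.qEdge_le_traceless (hb.pair hm.symm)

theorem imHermSkew_le_traceless (hb : IsImFrame b) : imHermSkew n ≤ traceless (QSpace n) := by
  rw [hb.imHermSkew_eq]
  exact sup_le (sup_le (hb.qEdge_le_traceless 0) (hb.qEdge_le_traceless 1))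
    (hb.qEdge_le_traceless 2)

theorem traceless_eq (hb : IsImFrame b) :
    traceless (QSpace n) = qHermSym0 n ⊔ (qEdge n (b 0) ⊔ (qEdge n (b 1) ⊔ qEdge n (b 2))) := by
  rw [← hermSym0_sup_hermSkew hb.pair01.cs_left, hb.hermSym0_eq, hb.hermSkew_eq, sup_assoc]

theorem traceless_eq_imHermSkew (hb : IsImFrame b) :
    traceless (QSpace n) = qHermSym0 n ⊔ imHermSkew n := by
  rw [hb.traceless_eq, hb.imHermSkew_eq, sup_assoc]

theorem tr_comp_qEdge (hb : IsImFrame b) {i j : Fin 3} (hij : i ≠ j) :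
    ∀ A ∈ qEdge n (b i), ∀ B ∈ qEdge n (b j), tr (A ∘L B) = 0 := fun _ hA _ hB =>
  tr_comp_eq_zero_of_commute_of_anticommute (hb.pair hij).cs_left (qEdge_commute hA)
    (qEdge_anticommute (hb.pair hij.symm) hB)

theorem tr_comp_qHermSym_qEdge (hb : IsImFrame b) (m : Fin 3) :
    ∀ A ∈ qHermSym n, ∀ B ∈ qEdge n (b m), tr (A ∘L B) = 0 := fun _ hA _ hB => by
  obtain ⟨m', hm⟩ := exists_ne m
  exact tr_comp_eq_zero_of_commute_of_anticommute (hb.pair hm).cs_left (hA.2 _)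
    (qEdge_anticommute (hb.pair hm.symm) hB)

end IsImFrame

theorem tr_comp_sup_right {V : Type*} [NormedAddCommGroup V] [InnerProductSpace ℝ V]
    {C D D' : Submodule ℝ (V →L[ℝ] V)} (h : ∀ A ∈ C, ∀ B ∈ D, tr (A ∘L B) = 0)
    (h' : ∀ A ∈ C, ∀ B ∈ D', tr (A ∘L B) = 0) : ∀ A ∈ C, ∀ B ∈ D ⊔ D', tr (A ∘L B) = 0 := by
  intro A hA B hB
  obtain ⟨B1, h1, B2, h2, rfl⟩ := Submodule.mem_sup.1 hB
  rw [ContinuousLinearMap.comp_add, map_add, h A hA B1 h1, h' A hA B2 h2, add_zero]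

theorem tr_comp_symm {V : Type*} [NormedAddCommGroup V] [InnerProductSpace ℝ V]
    {C D : Submodule ℝ (V →L[ℝ] V)} (h : ∀ A ∈ C, ∀ B ∈ D, tr (A ∘L B) = 0) :
    ∀ A ∈ D, ∀ B ∈ C, tr (A ∘L B) = 0 := fun A hA B hB => by
  rw [tr_comp_comm]
  exact h B hB A hA

namespace IsImFrame

variable {b : Fin 3 → ℍ[ℝ]}

theorem tr_comp_qHermSym0_imHermSkew (hb : IsImFrame b) :
    ∀ A ∈ qHermSym0 n, ∀ B ∈ imHermSkew n, tr (A ∘L B) = 0 := by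
  rw [hb.imHermSkew_eq]
  have h : ∀ m, ∀ A ∈ qHermSym0 n, ∀ B ∈ qEdge n (b m), tr (A ∘L B) = 0 :=
    fun m A hA => hb.tr_comp_qHermSym_qEdge m A hA.1
  exact tr_comp_sup_right (tr_comp_sup_right (h 0) (h 1)) (h 2)

end IsImFrame

/-- The right multiplications by the elements of a family of quaternions. -/
def rmulFamily (n : ℕ) (p q : ℍ[ℝ]) : Fin 4 → QSpace n →L[ℝ] QSpace n :=
  fun a => rmul n (IsImPair.family p q a)

theorem rmulFamily_inner (h : IsImPair p q) (a c : Fin 4) (x : QSpace n) :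
    inner ℝ (rmulFamily n p q a x) (rmulFamily n p q c x) =
      if a = c then inner ℝ x x else (0 : ℝ) := by
  rw [rmulFamily, rmulFamily, inner_rmul_rmul, orthonormal_iff_ite.1 h.orthonormal_family]
  split_ifs <;> simp

theorem span_rmulFamily_mem_quaternionicLines (h : IsImPair p q) {x : QSpace n} (hx : ‖x‖ = 1) :
    Submodule.span ℝ (Set.range fun a => rmulFamily n p q a x) ∈ quaternionicLines n := by
  have hmem : ∀ c, rmul n c x ∈ Submodule.span ℝ (Set.range fun a => rmulFamily n p q a x) := by
    intro c
    have h1 := h.basis.sum_repr c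
    rw [← h1]
    change rmulₗ x _ ∈ _
    rw [map_sum]
    refine Submodule.sum_mem _ fun a _ => ?_
    rw [map_smul]
    refine Submodule.smul_mem _ _ (Submodule.subset_span ⟨a, ?_⟩)
    rw [h.coe_basis]
    rfl
  refine ⟨by rw [finrank_span_orbit (rmulFamily_inner h) hx, Fintype.card_fin], fun c y hy => ?_⟩
  induction hy using Submodule.span_induction with
  | mem y hy =>
    obtain ⟨a, rfl⟩ := hy
    simp only [rmulFamily, rmul_rmul]
    exact hmem _
  | zero => simp
  | add y z _ _ hy hz => rw [map_add]; exact add_mem hy hz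
  | smul r y _ hy => rw [map_smul]; exact Submodule.smul_mem _ _ hy

theorem IsImFrame.tr_comp_starProjection_eq_zero {b : Fin 3 → ℍ[ℝ]} (hb : IsImFrame b)
    {A : QSpace n →L[ℝ] QSpace n} (hA : A ∈ imHermSkew n) {W : Submodule ℝ (QSpace n)}
    (hW : ∀ c, ∀ x ∈ W, rmul n c x ∈ W) : tr (A ∘L W.starProjection) = 0 := by
  have key : ∀ i j, i ≠ j → ∀ B ∈ qEdge n (b i), tr (B ∘L W.starProjection) = 0 :=
    fun i j hij B hB => _root_.tr_comp_starProjection_eq_zero (hb.pair hij.symm).cs_left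
      (qEdge_anticommute (hb.pair hij) hB) (hW (b j))
  rw [hb.imHermSkew_eq] at hA
  obtain ⟨B, hB, A2, h2, rfl⟩ := Submodule.mem_sup.1 hA
  obtain ⟨A0, h0, A1, h1, rfl⟩ := Submodule.mem_sup.1 hB
  rw [ContinuousLinearMap.add_comp, ContinuousLinearMap.add_comp, map_add, map_add,
    key 0 1 (by decide) A0 h0, key 1 0 (by decide) A1 h1, key 2 0 (by decide) A2 h2]
  simp

/-- Each E_{b i} has trace zero on a quaternionic line, which is stable under some R_{b j} with j ≠
i. The remaining ℍ-linear part C has trace 4⟨Cx, x⟩ on the line through a unit vector x, so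
nonnegativity on all lines is positivity of C. -/
theorem minimalSubeq_imHermSkew {b : Fin 3 → ℍ[ℝ]} (hb : IsImFrame b) :
    minimalSubeq (imHermSkew n) = geomSubeq (quaternionicLines n) := by
  refine Set.Subset.antisymm (minimalSubeq_subset_geomSubeq
    (fun _ hA => (hb.imHermSkew_le_traceless hA).1) ?_) fun A hA => ?_
  · exact fun A hA W hW => hb.tr_comp_starProjection_eq_zero hA hW.2
  · obtain ⟨t, A', hA', rfl⟩ := exists_smul_id_add_traceless A hA.1
    rw [hb.traceless_eq_imHermSkew] at hA'
    obtain ⟨A0, h0, e, he, rfl⟩ := Submodule.mem_sup.1 hA'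
    have hC : t • ContinuousLinearMap.id ℝ (QSpace n) + A0 ∈ SymEnd (QSpace n) :=
      add_mem (Submodule.smul_mem _ _ id_mem_symEnd) h0.1.1
    refine ⟨e, he, t • ContinuousLinearMap.id ℝ (QSpace n) + A0, ⟨hC, fun x => ?_⟩, ?_⟩
    · have hpair := hb.pair01
      have key : ∀ y : QSpace n, ‖y‖ = 1 →
          0 ≤ inner ℝ ((t • ContinuousLinearMap.id ℝ (QSpace n) + A0) y) y := by
        intro y hy
        have hW := span_rmulFamily_mem_quaternionicLines hpair hy
        have h1 := hA.2 _ hW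
        rw [← add_assoc, ContinuousLinearMap.add_comp, map_add,
          hb.tr_comp_starProjection_eq_zero he hW.2, add_zero,
          tr_comp_starProjection_span_orbit (rmulFamily_inner hpair) hy] at h1
        have hcomm : ∀ c, (t • ContinuousLinearMap.id ℝ (QSpace n) + A0) (rmul n c y) =
            rmul n c ((t • ContinuousLinearMap.id ℝ (QSpace n) + A0) y) := fun c => by
          simp [h0.1.2]
        have hterm : ∀ a, inner ℝ (rmulFamily n (b 0) (b 1) a y)
            ((t • ContinuousLinearMap.id ℝ (QSpace n) + A0) (rmulFamily n (b 0) (b 1) a y)) =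
            inner ℝ ((t • ContinuousLinearMap.id ℝ (QSpace n) + A0) y) y := fun a => by
          rw [rmulFamily, hcomm, inner_rmul_left, rmul_rmul,
            quaternion_mul_star (hpair.orthonormal_family.1 a), rmul_one, real_inner_comm]
        rw [Finset.sum_congr rfl fun a _ => hterm a] at h1
        simp only [Finset.sum_const, Finset.card_univ, Fintype.card_fin, nsmul_eq_mul,
          Nat.cast_ofNat] at h1
        linarith
      by_cases hx : x = 0
      · simp [hx]
      have h2 := key ((‖x‖⁻¹ : ℝ) • x) (norm_smul_inv_norm (𝕜 := ℝ) hx)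
      rw [map_smul, real_inner_smul_left, real_inner_smul_right] at h2
      have : 0 < ‖x‖⁻¹ := by have := norm_pos_iff.2 hx; positivity
      exact nonneg_of_mul_nonneg_right (nonneg_of_mul_nonneg_right h2 this) this
    · simp only
      abel

/-- The summand E_{b 1} + E_{b 2} is the skew part of R_{b 0}, with trace zero on R_{b 0}-stable
subspaces. What is left of A is an ℍ-linear part plus some S in E_{b 0}, which anticommutes with J =
R_{b 1} and commutes with I = R_{b 0}: the situation of `exists_traceless_add_psd_of_lagrangian`. -/
theorem minimalSubeq_complexLagrangians {b : Fin 3 → ℍ[ℝ]} (hb : IsImFrame b) :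
    minimalSubeq (qHermSym0 n ⊔ qEdge n (b 1) ⊔ qEdge n (b 2)) =
      geomSubeq (complexLagrangians (rmul n (b 0)) (rmul n (b 1)) (rmul n (b 2))) := by
  have h01 := hb.pair01
  have hE : qHermSym0 n ⊔ qEdge n (b 1) ⊔ qEdge n (b 2) =
      qHermSym0 n ⊔ hermSkew (rmul n (b 0)) := by
    rw [hb.hermSkew_eq, sup_assoc]
  have hle : qHermSym0 n ⊔ hermSkew (rmul n (b 0)) ≤ SymEnd (QSpace n) :=
    sup_le (fun A hA => hA.1.1) fun A hA => hA.1
  rw [hE]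
  have hI := h01.cs_left (n := n)
  have hJ := h01.symm.cs_left (n := n)
  have hskew : ∀ A ∈ hermSkew (rmul n (b 0)), ∀ W : Submodule ℝ (QSpace n),
      (∀ x ∈ W, rmul n (b 0) x ∈ W) → tr (A ∘L W.starProjection) = 0 :=
    fun A hA W hW => _root_.tr_comp_starProjection_eq_zero hI hA.2 hW
  refine Set.Subset.antisymm (minimalSubeq_subset_geomSubeq hle ?_) fun A hA => ?_
  · rintro A hA W ⟨hW0, hW1, -⟩
    obtain ⟨A0, h0, S, hS, rfl⟩ := Submodule.mem_sup.1 hA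
    have h1 := tr_comp_starProjection_lagrangian hJ (h0.1.2 _) hW1
    have h2 : tr A0 = 0 := h0.2.2
    rw [ContinuousLinearMap.add_comp, map_add, hskew S hS W fun x hx => hW0 ▸ ⟨x, hx, rfl⟩]
    linarith
  · obtain ⟨t, A', hA', rfl⟩ := exists_smul_id_add_traceless A hA.1
    rw [← hermSym0_sup_hermSkew hI, hb.hermSym0_eq] at hA'
    obtain ⟨B, hB, N, hN, rfl⟩ := Submodule.mem_sup.1 hA'
    obtain ⟨A0, h0, S, hS, rfl⟩ := Submodule.mem_sup.1 hB
    obtain ⟨σ, hσ, hb2⟩ := hb.exists_third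
    have hanti := h01.rmul_anticomm (n := n)
    obtain ⟨e, he, heJ, heI, pp, hp, hep⟩ := exists_traceless_add_psd_of_lagrangian
      (I := rmul n (b 0)) (S := S) (C := t • .id ℝ (QSpace n) + A0) (ε := -1) (ε' := -1) hJ
      hI.isometry (fun x => by rw [hI.sq, neg_one_smul]) (fun x => by rw [hanti, neg_one_smul])
      (fun x => by rw [inner_rmul_rmul, h01.inner_eq_zero, zero_mul])
      (qEdge_mem_symEnd h01.re_left hS) (qEdge_anticommute h01 hS) (qEdge_commute hS)
      (add_mem (Submodule.smul_mem _ _ id_mem_symEnd) h0.1.1) (fun x => by simp [h0.1.2])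
      (fun x => by simp [h0.1.2]) (fun W hW1 hW0 => by
        have hW0' : W.map (rmul n (b 0) : QSpace n →ₗ[ℝ] QSpace n) = W := by
          refine le_antisymm ?_ fun x hx => ⟨-rmul n (b 0) x, W.neg_mem (hW0 x hx), ?_⟩
          · rintro _ ⟨x, hx, rfl⟩
            exact hW0 x hx
          · simp [hI.sq]
        -- Since `b 2 = ±b 0 * b 1`, an R_{b 0}-stable R_{b 1}-Lagrangian subspace is automatically
        -- R_{b 2}-Lagrangian.
        have hW2 : W ∈ lagrangians (rmul n (b 2)) := by
          have h1 : W.map (rmul n (b 1) : QSpace n →ₗ[ℝ] QSpace n) = Wᗮ := hW1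
          change W.map (rmul n (b 2) : QSpace n →ₗ[ℝ] QSpace n) = Wᗮ
          rw [← h1]
          have hR2 : ∀ x, rmul n (b 2) x = rmul n (b 1) (σ • rmul n (b 0) x) := fun x => by
            rw [hb2, rmul_smul, ← rmul_rmul, map_smul]
          refine le_antisymm ?_ ?_
          · rintro _ ⟨x, hx, rfl⟩
            exact ⟨_, W.smul_mem σ (hW0 x hx), (hR2 x).symm⟩
          · rintro _ ⟨x, hx, rfl⟩
            refine ⟨-(σ • rmul n (b 0) x), W.neg_mem (W.smul_mem σ (hW0 x hx)), ?_⟩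
            simp only [ContinuousLinearMap.coe_coe, hR2, map_neg, map_smul, hI.sq, smul_neg,
              neg_neg, smul_smul, hσ, one_smul]
        have h1 := hA.2 W ⟨hW0', hW1, hW2⟩
        rw [← add_assoc, ContinuousLinearMap.add_comp, map_add, hskew N hN W hW0, add_zero,
          ← add_assoc] at h1
        exact h1)
    refine ⟨e + N, Submodule.add_mem_sup ⟨h01.mem_qHermSym he.1 heI heJ, he⟩ hN, pp, hp, ?_⟩
    simp only
    rw [← add_assoc, ← add_assoc, hep]
    abel

end QuaternionicDecomposition

/-! ### The quaternionic hermitian form and transitivity of Sp_n -/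

section QuaternionicForm

variable {n : ℕ}

theorem qForm_add_right (x y z : QSpace n) : qForm n x (y + z) = qForm n x y + qForm n x z := by
  simp [qForm, QSpace.coord_add, mul_add, Finset.sum_add_distrib]

theorem qForm_smul_right (c : ℝ) (x y : QSpace n) : qForm n x (c • y) = c • qForm n x y := by
  simp [qForm, QSpace.coord_smul, Finset.smul_sum]

theorem qForm_rmul_right (c : ℍ[ℝ]) (x y : QSpace n) :
    qForm n x (rmul n c y) = qForm n x y * c := by
  simp [qForm, rmul_coord, mul_assoc, Finset.sum_mul]

theorem star_qForm (x y : QSpace n) : star (qForm n x y) = qForm n y x := by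
  simp [qForm]

theorem inner_eq_re_qForm (x y : QSpace n) : inner ℝ x y = (qForm n x y).re := by
  rw [QSpace.inner_eq, qForm]
  have : ∀ f : Fin n → ℍ[ℝ], (∑ l, f l).re = ∑ l, (f l).re := fun f =>
    map_sum (⟨⟨fun a : ℍ[ℝ] => a.re, rfl⟩, fun _ _ => rfl⟩ : ℍ[ℝ] →+ ℝ) f _
  rw [this]
  refine Finset.sum_congr rfl fun l _ => ?_
  rw [Quaternion.inner_def]
  simp only [Quaternion.re_mul, Quaternion.re_star, Quaternion.imI_star, Quaternion.imJ_star,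
    Quaternion.imK_star]
  ring

theorem qForm_neg_right (x y : QSpace n) : qForm n x (-y) = -qForm n x y := by
  rw [← neg_one_smul ℝ y, qForm_smul_right, neg_one_smul]

theorem qForm_sub_right (x y z : QSpace n) : qForm n x (y - z) = qForm n x y - qForm n x z := by
  rw [sub_eq_add_neg, qForm_add_right, qForm_neg_right, sub_eq_add_neg]

theorem qForm_sub_left (x y z : QSpace n) : qForm n (x - y) z = qForm n x z - qForm n y z := by
  rw [← star_qForm, qForm_sub_right, star_sub, star_qForm, star_qForm]

theorem qForm_rmul_left (c : ℍ[ℝ]) (x y : QSpace n) :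
    qForm n (rmul n c x) y = star c * qForm n x y := by
  rw [← star_qForm, qForm_rmul_right, star_mul, star_qForm]

theorem qForm_self (x : QSpace n) : qForm n x x = ((‖x‖ ^ 2 : ℝ) : ℍ[ℝ]) := by
  rw [Quaternion.star_eq_self.1 (star_qForm x x), ← inner_eq_re_qForm, real_inner_self_eq_norm_sq]

/-- The coordinates of ε(z, y) in the basis 1, p, q, pq are the real inner products of zf with y,
for f in that basis. -/
theorem qForm_eq_zero_of_orthogonal {p q : ℍ[ℝ]} (h : IsImPair p q) {y z : QSpace n}
    (hz : ∀ a, inner ℝ (rmulFamily n p q a z) y = (0 : ℝ)) : qForm n z y = 0 := by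
  have h1 : ∀ a, inner ℝ (h.basis a) (qForm n z y) = (0 : ℝ) := fun a => by
    have h2 := hz a
    rw [rmulFamily, inner_eq_re_qForm, qForm_rmul_left] at h2
    rw [h.coe_basis, Quaternion.inner_def]
    refine Eq.trans ?_ h2
    simp only [Quaternion.re_mul, Quaternion.re_star, Quaternion.imI_star, Quaternion.imJ_star,
      Quaternion.imK_star]
    ring
  have h3 := h.basis.sum_repr' (qForm n z y)
  rw [← h3]
  exact Finset.sum_eq_zero fun a _ => by rw [h1 a, zero_smul]

/-- The quaternionic quasi-reflection `z ↦ z - u ε(u, y)⁻¹ ε(u, z)` with `u = y - y'`. -/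
theorem isTransitiveAlong_spGrp {p q : ℍ[ℝ]} (h : IsImPair p q) :
    IsTransitiveAlong (rmulFamily n p q) (spGrp n) := by
  intro y y' hy
  by_cases hyy : y = y'
  · exact ⟨1, one_mem _, hyy, fun _ _ => rfl⟩
  set u := y - y' with hu
  have hu0 : u ≠ 0 := sub_ne_zero.2 hyy
  set w := qForm n u y with hw
  have hnorm : (2 * w.re : ℝ) = ‖u‖ ^ 2 := by
    have h1 : w.re = inner ℝ u y := (inner_eq_re_qForm u y).symm
    have h2 : ‖u‖ ^ 2 = ‖y‖ ^ 2 - 2 * inner ℝ y y' + ‖y'‖ ^ 2 := norm_sub_sq_real y y'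
    rw [h1, h2, hu, inner_sub_left, real_inner_self_eq_norm_sq, real_inner_comm, hy]
    ring
  have hw0 : w ≠ 0 := by
    intro h0
    have : 0 < ‖u‖ ^ 2 := by positivity
    rw [← hnorm, h0, Quaternion.re_zero, mul_zero] at this
    exact lt_irrefl _ this
  -- This is ε(u, u) = 2 Re w = w + w̄ multiplied by w̄⁻¹ and w⁻¹ on the two sides. It is exactly
  -- the identity needed for the quasi-reflection to preserve ε.
  have hww : w⁻¹ + star w⁻¹ = star w⁻¹ * qForm n u u * w⁻¹ := by
    rw [qForm_self, ← hnorm, ← Quaternion.self_add_star', mul_add, add_mul, mul_assoc,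
      mul_inv_cancel₀ hw0, mul_one, ← star_mul, mul_inv_cancel₀ hw0, star_one, one_mul, add_comm]
  let f : QSpace n →ₗ[ℝ] QSpace n :=
    { toFun := fun z => z - rmul n (w⁻¹ * qForm n u z) u
      map_add' := fun x z => by
        rw [qForm_add_right, mul_add, rmul_add]
        abel
      map_smul' := fun c z => by
        rw [qForm_smul_right, mul_smul_comm, rmul_smul, RingHom.id_apply, smul_sub] }
  have hf : ∀ z, f z = z - rmul n (w⁻¹ * qForm n u z) u := fun z => rfl
  have hform : ∀ z z', qForm n (f z) (f z') = qForm n z z' := by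
    intro z z'
    have key : star (qForm n u z) * (w⁻¹ + star w⁻¹) * qForm n u z' =
        star (qForm n u z) * (star w⁻¹ * qForm n u u * w⁻¹) * qForm n u z' := by rw [hww]
    rw [hf, hf, qForm_sub_left, qForm_sub_right, qForm_sub_right, qForm_rmul_right,
      qForm_rmul_left, qForm_rmul_left, qForm_rmul_right, star_mul, ← star_qForm u z]
    simp only [mul_add, add_mul, mul_assoc] at key ⊢
    rw [← key]
    abel
  have hfn : ∀ z, ‖f z‖ = ‖z‖ := by
    intro z
    rw [← sq_eq_sq₀ (norm_nonneg _) (norm_nonneg _), ← real_inner_self_eq_norm_sq,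
      ← real_inner_self_eq_norm_sq, inner_eq_re_qForm, hform, inner_eq_re_qForm]
  let L : QSpace n →ₗᵢ[ℝ] QSpace n := ⟨f, hfn⟩
  refine ⟨L.toLinearIsometryEquiv rfl, ⟨fun c x => ?_, hform⟩, ?_, fun z hz => ?_⟩
  · change f (rmul n c x) = rmul n c (f x)
    rw [hf, hf, qForm_rmul_right, (rmul n c).map_sub, rmul_rmul, mul_assoc]
  · change f y = y'
    rw [hf, ← hw, inv_mul_cancel₀ hw0, rmul_one, hu, sub_sub_cancel]
  · change f z = z
    have h1 := qForm_eq_zero_of_orthogonal h fun a => (hz a).1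
    have h2 := qForm_eq_zero_of_orthogonal h fun a => (hz a).2
    have h3 : qForm n u z = 0 := by
      rw [← star_qForm, hu, qForm_sub_right, h1, h2, sub_zero, star_zero]
    rw [hf, h3, mul_zero, rmul_zero, sub_zero]

end QuaternionicForm

/-! ### Sp_n-invariant basic edges -/

section SymplecticInvariants

variable {n : ℕ}

/-- The imaginary quaternions `v` with `R_v Herm^{ℍ-skew} ⊆ E`. -/
def imSupport (E : Submodule ℝ (QSpace n →L[ℝ] QSpace n)) : Submodule ℝ ℍ[ℝ] where
  carrier := {v | v.re = 0 ∧ qEdge n v ≤ E}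
  add_mem' := fun hv hw => ⟨by rw [Quaternion.re_add, hv.1, hw.1, add_zero],
    (qEdge_add_le _ _).trans (sup_le hv.2 hw.2)⟩
  zero_mem' := ⟨rfl, by rw [qEdge_zero]; exact bot_le⟩
  smul_mem' := fun c v hv => ⟨by rw [Quaternion.re_smul, hv.1, smul_zero],
    (qEdge_smul_le c v).trans hv.2⟩

theorem QSpace.nontrivial (hn : 1 ≤ n) : Nontrivial (QSpace n) := by
  refine ⟨⟨QSpace.mk fun _ => 1, 0, fun h => ?_⟩⟩
  have := congrArg (fun x => QSpace.coord x ⟨0, hn⟩) h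
  exact one_ne_zero this

/-- The projection T onto E is a scalar α on E_0 and sends R_v B to R_{φ(v)} B, with φ independent
of the skew map B. As T(R_v B) is in E for every B, each φ(v) lies in the imaginary support of E.
Hence E, being the image of T, is the sum of the E_v it contains, together with E_0 exactly when α ≠
0 is forced. -/
theorem eq_of_invariant_spGrp (hn : 1 ≤ n) {b : Fin 3 → ℍ[ℝ]} (hb : IsImFrame b)
    {E : Submodule ℝ (QSpace n →L[ℝ] QSpace n)} (hE : IsBasicEdge E)
    (hG : spGrp n ≤ invGroup (E : Set (QSpace n →L[ℝ] QSpace n))) :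
    E = ⨆ v ∈ imSupport E, qEdge n v ∨ E = qHermSym0 n ⊔ ⨆ v ∈ imSupport E, qEdge n v := by
  have := QSpace.nontrivial hn
  have h01 := hb.pair01
  have hcomm : ∀ g ∈ spGrp n, ∀ a x,
      g (rmulFamily n (b 0) (b 1) a x) = rmulFamily n (b 0) (b 1) a (g x) := fun g hg a x => hg.1 _ x
  obtain ⟨c, d, hc, hT, hT'⟩ := exists_sandwich_projection
    (R := rmulFamily n (b 0) (b 1)) (R' := fun a => rmul n (star (IsImPair.family (b 0) (b 1) a)))
    (fun a x y => by rw [inner_rmul_left, star_star]; rfl)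
    (rmulFamily_inner h01) hcomm (isTransitiveAlong_spGrp h01) hE.1 hG
  set T := sandwich (rmulFamily n (b 0) (b 1))
    (fun a => rmul n (star (IsImPair.family (b 0) (b 1) a))) c d with hTdef
  set f := IsImPair.family (b 0) (b 1)
  -- Right multiplications compose in reverse order and commute with `B`, so a sandwich of R_v B
  -- amounts to replacing `v` by this sum.
  let φ : ℍ[ℝ] → ℍ[ℝ] := fun v => ∑ a, ∑ e, c a e • (star (f e) * (v * f a))
  -- The symmetry of `c` makes `φ` commute with conjugation, so it preserves real and imaginary
  -- quaternions separately.
  have hφstar : ∀ v, star (φ v) = φ (star v) := by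
    intro v
    simp only [φ, star_sum]
    rw [Finset.sum_comm]
    refine Finset.sum_congr rfl fun a _ => Finset.sum_congr rfl fun e _ => ?_
    rw [Quaternion.star_smul, star_mul, star_mul, star_star, hc, mul_assoc]
  have hφneg : ∀ v, φ (-v) = -φ v := fun v => by
    simp [φ]
  have hφ0 : ∀ v : ℍ[ℝ], v.re = 0 → (φ v).re = 0 := fun v hv => by
    rw [← Quaternion.star_eq_neg, hφstar, quaternion_star_of_re hv, hφneg]
  have hTB : ∀ v : ℍ[ℝ], ∀ B : QSpace n →L[ℝ] QSpace n,
      (∀ q x, B (rmul n q x) = rmul n q (B x)) → T (rmul n v ∘L B) =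
        rmul n (φ v) ∘L B + (d * tr (rmul n v ∘L B)) • .id ℝ (QSpace n) := by
    intro v B hB
    rw [hTdef, sandwich_apply]
    congr 1
    ext1 x
    simp only [_root_.sum_apply, _root_.smul_apply, ContinuousLinearMap.comp_apply, rmulFamily, hB,
      rmul_rmul, mul_assoc]
    change _ = rmulₗ (B x) (φ v)
    simp only [φ, map_sum, map_smul]
    rfl
  set α := (φ 1).re
  have hφ1 : φ 1 = (α : ℍ[ℝ]) := Quaternion.star_eq_self.1 (by rw [hφstar, star_one])
  have hφ1' : ∀ x : QSpace n, rmul n (φ 1) x = α • x := fun x => by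
    rw [hφ1, ← mul_one (α : ℍ[ℝ]), Quaternion.coe_mul_eq_smul, rmul_smul, rmul_one]
  have hone : ∀ B : QSpace n →L[ℝ] QSpace n, rmul n 1 ∘L B = B := fun B => by
    ext1 x; simp [rmul_one]
  have hT0 : ∀ B ∈ qHermSym0 n, T B = α • B := by
    intro B hB
    have h1 := hTB 1 B hB.1.2
    have htr : tr B = 0 := hB.2.2
    rw [hone, htr, mul_zero, zero_smul, add_zero] at h1
    rw [h1]
    ext1 x
    simp [hφ1']
  have hTid : T (.id ℝ _) = 0 := by
    have h1 := hTB 1 (.id ℝ _) fun _ _ => rfl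
    rw [hone] at h1
    have h2 : T (.id ℝ _) = (α + d * tr (.id ℝ (QSpace n))) • .id ℝ (QSpace n) := by
      rw [h1]
      ext1 x
      simp [hφ1', add_smul]
    have h3 := hT _ id_mem_symEnd
    rw [h2] at h3 ⊢
    rw [smul_id_mem_basicEdge hE h3, zero_smul]
  have htrv : ∀ v : ℍ[ℝ], v.re = 0 → ∀ B ∈ qHermSkew n, tr (rmul n v ∘L B) = 0 := fun v hv B hB =>
    (hb.imHermSkew_le_traceless (le_iSup₂_of_le (f := fun (v : ℍ[ℝ]) _ => qEdge n v) v hv le_rfl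
      ⟨B, hB, rfl⟩)).2
  have hTv : ∀ v : ℍ[ℝ], v.re = 0 → ∀ B ∈ qHermSkew n,
      T (rmul n v ∘L B) = rmul n (φ v) ∘L B := fun v hv B hB => by
    rw [hTB v B hB.2, htrv v hv B hB, mul_zero, zero_smul, add_zero]
  have hφU : ∀ v : ℍ[ℝ], v.re = 0 → φ v ∈ imSupport E := by
    refine fun v hv => ⟨hφ0 v hv, ?_⟩
    rintro _ ⟨B, hB, rfl⟩
    rw [← hTv v hv B hB]
    exact hT _ (qEdge_mem_symEnd hv ⟨B, hB, rfl⟩)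
  have hUE : (⨆ v ∈ imSupport E, qEdge n v) ≤ E := iSup₂_le fun v hv => hv.2
  have hTU : ∀ m, ∀ A ∈ qEdge n (b m), T A ∈ ⨆ v ∈ imSupport E, qEdge n v := by
    rintro m _ ⟨B, hB, rfl⟩
    rw [hTv _ (hb.2 m) B hB]
    exact le_iSup₂_of_le (f := fun v (_ : v ∈ imSupport E) => qEdge n v) _ (hφU _ (hb.2 m)) le_rfl
      ⟨B, hB, rfl⟩
  have hdec : ∀ A ∈ E, ∃ B ∈ qHermSym0 n, ∃ C ∈ ⨆ v ∈ imSupport E, qEdge n v, A = α • B + C := by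
    intro A hA
    obtain ⟨t, A', hA', hAt⟩ := exists_smul_id_add_traceless A (hE.1 hA)
    rw [hb.traceless_eq] at hA'
    obtain ⟨B, hB, N, hN, rfl⟩ := Submodule.mem_sup.1 hA'
    obtain ⟨A0, h0, N', hN', rfl⟩ := Submodule.mem_sup.1 hN
    obtain ⟨A1, h1, A2, h2, rfl⟩ := Submodule.mem_sup.1 hN'
    refine ⟨B, hB, T A0 + (T A1 + T A2), add_mem (hTU 0 A0 h0) (add_mem (hTU 1 A1 h1)
      (hTU 2 A2 h2)), ?_⟩
    conv_lhs => rw [← hT' A hA, hAt]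
    rw [map_add, map_smul, hTid, smul_zero, zero_add, map_add, hT0 B hB, map_add, map_add]
  by_cases hα : α = 0
  · refine Or.inl (le_antisymm (fun A hA => ?_) hUE)
    obtain ⟨B, -, C, hC, rfl⟩ := hdec A hA
    rwa [hα, zero_smul, zero_add]
  · refine Or.inr (le_antisymm (fun A hA => ?_) (sup_le (fun A hA => ?_) hUE))
    · obtain ⟨B, hB, C, hC, rfl⟩ := hdec A hA
      exact Submodule.add_mem_sup (Submodule.smul_mem _ _ hB) hC
    · have h1 := E.smul_mem α⁻¹ (hT0 A hA ▸ hT A hA.1.1)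
      rwa [smul_smul, inv_mul_cancel₀ hα, one_smul] at h1

end SymplecticInvariants

/-! ### Orthonormal bases of Im ℍ adapted to a subspace -/

section Frames

theorem norm_smul_inv_norm_quaternion {v : ℍ[ℝ]} (hv : v ≠ 0) : ‖(‖v‖⁻¹ : ℝ) • v‖ = 1 :=
  norm_smul_inv_norm (𝕜 := ℝ) hv

theorem isImPair_of_orthogonal {p w : ℍ[ℝ]} (hp : p.re = 0) (h1 : ‖p‖ = 1) (hw : w.re = 0)
    (hw0 : w ≠ 0) (hpw : inner ℝ p w = (0 : ℝ)) : IsImPair p ((‖w‖⁻¹ : ℝ) • w) :=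
  ⟨hp, by rw [Quaternion.re_smul, hw, smul_zero], h1, norm_smul_inv_norm_quaternion hw0, by
    rw [inner_smul_right, hpw, mul_zero]⟩

theorem exists_isImPair_left {p : ℍ[ℝ]} (hp : p.re = 0) (h1 : ‖p‖ = 1) : ∃ q, IsImPair p q := by
  have hlt : (Submodule.span ℝ (Set.range ![(1 : ℍ[ℝ]), p]))ᗮ ≠ ⊥ := by
    intro h
    rw [Submodule.orthogonal_eq_bot_iff] at h
    have h2 := finrank_range_le_card (R := ℝ) ![(1 : ℍ[ℝ]), p]
    rw [Set.finrank, h, finrank_top, Quaternion.finrank_eq_four, Fintype.card_fin] at h2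
    omega
  obtain ⟨w, hw, hw0⟩ := Submodule.exists_mem_ne_zero_of_ne_bot hlt
  have hw1 : inner ℝ (1 : ℍ[ℝ]) w = (0 : ℝ) := hw _ (Submodule.subset_span ⟨0, rfl⟩)
  have hw2 : inner ℝ p w = (0 : ℝ) := hw _ (Submodule.subset_span ⟨1, rfl⟩)
  rw [Quaternion.inner_def, one_mul, Quaternion.re_star] at hw1
  exact ⟨_, isImPair_of_orthogonal hp h1 hw1 hw0 hw2⟩

theorem exists_isImPair : ∃ p q : ℍ[ℝ], IsImPair p q := by
  obtain ⟨v, hv0, hv⟩ : ∃ v : ℍ[ℝ], v ≠ 0 ∧ v.re = 0 := by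
    refine ⟨⟨0, 1, 0, 0⟩, fun h => ?_, rfl⟩
    have := congrArg (fun v : ℍ[ℝ] => v.imI) h
    simp at this
  exact ⟨_, exists_isImPair_left (p := (‖v‖⁻¹ : ℝ) • v) (by rw [Quaternion.re_smul, hv, smul_zero])
    (norm_smul_inv_norm_quaternion hv0)⟩

theorem exists_isImFrame : ∃ b, IsImFrame b := by
  obtain ⟨p, q, h⟩ := exists_isImPair
  exact ⟨_, h.isImFrame⟩

theorem IsImPair.isImFrame_rotate {p q : ℍ[ℝ]} (h : IsImPair p q) : IsImFrame ![p * q, p, q] := by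
  have h1 := h.isImFrame.comp_perm (finRotate 3).symm
  convert h1 using 1
  ext m : 1
  fin_cases m <;> rfl

theorem IsImFrame.mem_of_mem {b : Fin 3 → ℍ[ℝ]} (hb : IsImFrame b) {U : Submodule ℝ ℍ[ℝ]}
    (h0 : b 0 ∈ U) (h1 : b 1 ∈ U) (h2 : b 2 ∈ U) {v : ℍ[ℝ]} (hv : v.re = 0) : v ∈ U := by
  obtain ⟨y, rfl⟩ := hb.eq_sum_of_re hv
  exact add_mem (add_mem (U.smul_mem _ h0) (U.smul_mem _ h1)) (U.smul_mem _ h2)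

/-- A subspace of `Im ℍ` is spanned by part of an orthonormal basis. -/
theorem exists_isImFrame_adapted {U : Submodule ℝ ℍ[ℝ]} (hU : ∀ v ∈ U, v.re = 0) :
    ∃ b, IsImFrame b ∧ (U = ⊥ ∨ U = Submodule.span ℝ {b 0} ∨ U = Submodule.span ℝ {b 1, b 2} ∨
      ∀ v : ℍ[ℝ], v.re = 0 → v ∈ U) := by
  by_cases h0 : U = ⊥
  · obtain ⟨b, hb⟩ := exists_isImFrame
    exact ⟨b, hb, Or.inl h0⟩
  obtain ⟨p0, hp0, hne⟩ := Submodule.exists_mem_ne_zero_of_ne_bot h0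
  set p := (‖p0‖⁻¹ : ℝ) • p0 with hpdef
  have hp : p ∈ U := U.smul_mem _ hp0
  have hp1 : ‖p‖ = 1 := norm_smul_inv_norm_quaternion hne
  by_cases h1 : U ≤ Submodule.span ℝ {p}
  · obtain ⟨q, hq⟩ := exists_isImPair_left (hU p hp) hp1
    refine ⟨_, hq.isImFrame, Or.inr (Or.inl (le_antisymm h1 ?_))⟩
    rwa [Submodule.span_singleton_le_iff_mem]
  obtain ⟨w, hw, hwp⟩ := SetLike.not_le_iff_exists.1 h1
  set w' := w - (inner ℝ p w : ℝ) • p with hw'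
  have hw'U : w' ∈ U := sub_mem hw (U.smul_mem _ hp)
  have hw'0 : w' ≠ 0 := fun h => hwp (by
    rw [sub_eq_zero.1 h]
    exact Submodule.smul_mem _ _ (Submodule.mem_span_singleton_self p))
  have hpair := isImPair_of_orthogonal (hU p hp) hp1 (hU _ hw'U) hw'0 (by
    rw [hw', inner_sub_right, inner_smul_right, real_inner_self_eq_norm_sq, hp1]
    ring)
  set q := (‖w'‖⁻¹ : ℝ) • w'
  have hq : q ∈ U := U.smul_mem _ hw'U
  by_cases h2 : p * q ∈ U
  · exact ⟨_, hpair.isImFrame, Or.inr (Or.inr (Or.inr fun v hv =>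
      hpair.isImFrame.mem_of_mem hp hq h2 hv))⟩
  -- A plane occupies the positions 1 and 2 and its unit normal `p * q` the position 0, so that `b
  -- 0` is always the distinguished axis.
  · refine ⟨_, hpair.isImFrame_rotate, Or.inr (Or.inr (Or.inl (le_antisymm (fun v hv => ?_) ?_)))⟩
    · obtain ⟨x, y, z, rfl⟩ := hpair.eq_sum_of_re (hU v hv)
      have hz : z = 0 := by
        by_contra hz
        have h3 := sub_mem hv (add_mem (U.smul_mem x hp) (U.smul_mem y hq))
        rw [add_sub_cancel_left] at h3
        exact h2 ((U.smul_mem_iff hz).1 h3)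
      rw [hz, zero_smul, add_zero]
      exact Submodule.mem_span_pair.2 ⟨x, y, rfl⟩
    · rw [Submodule.span_le]
      rintro v (rfl | rfl)
      exacts [hp, hq]

variable {n : ℕ}

theorem iSup_span_singleton_qEdge (p : ℍ[ℝ]) :
    (⨆ v ∈ Submodule.span ℝ {p}, qEdge n v) = qEdge n p := by
  refine le_antisymm (iSup₂_le fun v hv => ?_)
    (le_iSup₂_of_le (f := fun v _ => qEdge n v) p (Submodule.mem_span_singleton_self p) le_rfl)
  obtain ⟨c, rfl⟩ := Submodule.mem_span_singleton.1 hv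
  exact qEdge_smul_le c p

theorem iSup_span_pair_qEdge (p q : ℍ[ℝ]) :
    (⨆ v ∈ Submodule.span ℝ {p, q}, qEdge n v) = qEdge n p ⊔ qEdge n q := by
  refine le_antisymm (iSup₂_le fun v hv => ?_) (sup_le ?_ ?_)
  · obtain ⟨c, d, rfl⟩ := Submodule.mem_span_pair.1 hv
    exact (qEdge_add_le _ _).trans (sup_le_sup (qEdge_smul_le c p) (qEdge_smul_le d q))
  · exact le_iSup₂_of_le (f := fun v _ => qEdge n v) p (Submodule.subset_span (by simp)) le_rfl
  · exact le_iSup₂_of_le (f := fun v _ => qEdge n v) q (Submodule.subset_span (by simp)) le_rfl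

theorem iSup_qEdge_of_forall {U : Submodule ℝ ℍ[ℝ]} (hU : ∀ v : ℍ[ℝ], v ∈ U ↔ v.re = 0) :
    (⨆ v ∈ U, qEdge n v) = imHermSkew n := by
  simp only [hU, imHermSkew, Set.mem_ofPred_eq]

theorem iSup_bot_qEdge : (⨆ v ∈ (⊥ : Submodule ℝ ℍ[ℝ]), qEdge n v) = ⊥ := by
  simp [qEdge_zero]

end Frames

/-! ### Action of right multiplications on the components E_v -/

section RightScalars

variable {n : ℕ}

/-- The right multiplication by a unit quaternion as an orthogonal transformation. -/
def rmulIsometry (n : ℕ) (u : ℍ[ℝ]) (hu : ‖u‖ = 1) : QSpace n ≃ₗᵢ[ℝ] QSpace n :=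
  LinearIsometry.toLinearIsometryEquiv ⟨(rmul n u : QSpace n →ₗ[ℝ] QSpace n), fun x => by
    rw [← sq_eq_sq₀ (norm_nonneg _) (norm_nonneg _), ← real_inner_self_eq_norm_sq,
      ← real_inner_self_eq_norm_sq]
    exact (inner_rmul_rmul u u x).trans (by rw [real_inner_self_eq_norm_sq, hu, one_pow, one_mul])⟩
    rfl

theorem rmulIsometry_apply (u : ℍ[ℝ]) (hu : ‖u‖ = 1) (x : QSpace n) :
    rmulIsometry n u hu x = rmul n u x := rfl

theorem quaternion_mem_unitary {u : ℍ[ℝ]} (hu : ‖u‖ = 1) : u ∈ unitary ℍ[ℝ] := by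
  refine Unitary.mem_iff.2 ⟨?_, quaternion_mul_star hu⟩
  have h := quaternion_mul_star (c := star u) (by rw [norm_star, hu])
  rwa [star_star] at h

theorem norm_of_mem_unitary (u : unitary ℍ[ℝ]) : ‖(u : ℍ[ℝ])‖ = 1 := by
  have h : (u : ℍ[ℝ]) * star (u : ℍ[ℝ]) = 1 := Unitary.coe_mul_star_self u
  have h2 := congrArg norm h
  rw [norm_mul, norm_star, norm_one] at h2
  nlinarith [norm_nonneg (u : ℍ[ℝ])]

theorem rmulIsometry_mem_rightScalars {T : Subgroup (unitary ℍ[ℝ])} {u : ℍ[ℝ]} (hu : ‖u‖ = 1)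
    (hT : (⟨u, quaternion_mem_unitary hu⟩ : unitary ℍ[ℝ]) ∈ T) :
    rmulIsometry n u hu ∈ rightScalars n T := ⟨_, hT, fun _ => rfl⟩

theorem act_rmul_comp_of_rmul {g : QSpace n ≃ₗᵢ[ℝ] QSpace n} {u : ℍ[ℝ]} (hu : ‖u‖ = 1)
    (hg : ∀ x, g x = rmul n u x) {v : ℍ[ℝ]} {B : QSpace n →L[ℝ] QSpace n} (hB : B ∈ qHermSkew n) :
    act g (rmul n v ∘L B) = rmul n (star u * v * u) ∘L B := by
  rw [act_eq_iff]
  intro x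
  have h1 : u * star u = 1 := quaternion_mul_star hu
  simp only [ContinuousLinearMap.comp_apply, hg, hB.2, rmul_rmul]
  rw [← mul_assoc, ← mul_assoc, h1, one_mul]

theorem quaternion_re_conj {v : ℍ[ℝ]} (hv : v.re = 0) (u : ℍ[ℝ]) : (star u * v * u).re = 0 := by
  rw [← Quaternion.star_eq_neg, star_mul, star_mul, star_star, quaternion_star_of_re hv]
  simp [mul_assoc]

/-- Conjugation by R_u carries R_v B to R_{ū v u} B, so unit quaternions act on the imaginary
support by rotations of Im ℍ. -/
theorem mem_imSupport_conj {E : Submodule ℝ (QSpace n →L[ℝ] QSpace n)}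
    {g : QSpace n ≃ₗᵢ[ℝ] QSpace n} {u : ℍ[ℝ]} (hu : ‖u‖ = 1) (hg : ∀ x, g x = rmul n u x)
    (hE : g ∈ invGroup (E : Set (QSpace n →L[ℝ] QSpace n))) {v : ℍ[ℝ]} (hv : v ∈ imSupport E) :
    star u * v * u ∈ imSupport E := by
  refine ⟨quaternion_re_conj hv.1 u, ?_⟩
  rintro _ ⟨B, hB, rfl⟩
  rw [← act_rmul_comp_of_rmul hu hg hB]
  exact act_mem_of_mem_invGroup hE (hv.2 ⟨B, hB, rfl⟩)

end RightScalars

/-! ### Quaternionic matrices and commutants -/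

section LeftMatrices

variable {n : ℕ}

/-- The left multiplication of `ℍⁿ` by a quaternionic matrix. -/
def lmat (M : Matrix (Fin n) (Fin n) ℍ[ℝ]) : QSpace n →L[ℝ] QSpace n :=
  LinearMap.toContinuousLinearMap
    { toFun := fun x => QSpace.mk fun l => ∑ m, M l m * x.coord m
      map_add' := fun x y => QSpace.ext_coord fun l => by
        simp [QSpace.coord_mk, QSpace.coord_add, mul_add, Finset.sum_add_distrib]
      map_smul' := fun c x => QSpace.ext_coord fun l => by
        simp [QSpace.coord_mk, QSpace.coord_smul, Finset.smul_sum] }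

theorem lmat_coord (M : Matrix (Fin n) (Fin n) ℍ[ℝ]) (x : QSpace n) (l : Fin n) :
    (lmat M x).coord l = ∑ m, M l m * x.coord m := rfl

theorem lmat_rmul (M : Matrix (Fin n) (Fin n) ℍ[ℝ]) (q : ℍ[ℝ]) (x : QSpace n) :
    lmat M (rmul n q x) = rmul n q (lmat M x) :=
  QSpace.ext_coord fun l => by simp [lmat_coord, rmul_coord, Finset.sum_mul, mul_assoc]

theorem lmat_mul (M N : Matrix (Fin n) (Fin n) ℍ[ℝ]) (x : QSpace n) :
    lmat (M * N) x = lmat M (lmat N x) :=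
  QSpace.ext_coord fun l => by
    simp only [lmat_coord, Matrix.mul_apply, Finset.sum_mul, Finset.mul_sum, mul_assoc]
    exact Finset.sum_comm

theorem lmat_add (M N : Matrix (Fin n) (Fin n) ℍ[ℝ]) (x : QSpace n) :
    lmat (M + N) x = lmat M x + lmat N x :=
  QSpace.ext_coord fun l => by
    simp [lmat_coord, QSpace.coord_add, add_mul, Finset.sum_add_distrib]

theorem lmat_smul (c : ℝ) (M : Matrix (Fin n) (Fin n) ℍ[ℝ]) (x : QSpace n) :
    lmat (c • M) x = c • lmat M x :=
  QSpace.ext_coord fun l => by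
    simp [lmat_coord, QSpace.coord_smul, Finset.smul_sum]

theorem lmat_neg (M : Matrix (Fin n) (Fin n) ℍ[ℝ]) (x : QSpace n) : lmat (-M) x = -lmat M x := by
  rw [← neg_one_smul ℝ M, lmat_smul, neg_one_smul]

theorem inner_lmat (M : Matrix (Fin n) (Fin n) ℍ[ℝ]) (x y : QSpace n) :
    inner ℝ (lmat M x) y = inner ℝ x (lmat M.conjTranspose y) := by
  rw [inner_eq_re_qForm, inner_eq_re_qForm]
  congr 1
  simp only [qForm, lmat_coord, star_sum, star_mul, Finset.sum_mul, Finset.mul_sum,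
    Matrix.conjTranspose_apply, mul_assoc]
  exact Finset.sum_comm

theorem lmat_mem_qHermSym {M : Matrix (Fin n) (Fin n) ℍ[ℝ]} (hM : M.conjTranspose = M) :
    lmat M ∈ qHermSym n :=
  ⟨fun x y => by rw [inner_lmat, hM], lmat_rmul M⟩

theorem lmat_mem_qHermSkew {M : Matrix (Fin n) (Fin n) ℍ[ℝ]} (hM : M.conjTranspose = -M) :
    lmat M ∈ qHermSkew n :=
  ⟨fun x y => by rw [inner_lmat, hM, lmat_neg, inner_neg_right], lmat_rmul M⟩

theorem lmat_single_coord (l m k : Fin n) (c : ℍ[ℝ]) (x : QSpace n) :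
    (lmat (Matrix.single l m c) x).coord k = if l = k then c * x.coord m else 0 := by
  rw [lmat_coord, Finset.sum_eq_single m]
  · by_cases h : l = k <;> simp [h]
  · intro b _ hb
    simp [hb.symm]
  · simp

theorem eq_sum_lmat_single (z : Fin n) (x : QSpace n) :
    x = ∑ l, lmat (Matrix.single l z (x.coord l)) (QSpace.mk fun _ => 1) := by
  refine QSpace.ext_coord fun k => ?_
  have : ∀ f : Fin n → QSpace n, (∑ l, f l).coord k = ∑ l, (f l).coord k := fun f =>
    map_sum (⟨⟨fun y : QSpace n => y.coord k, rfl⟩, fun _ _ => rfl⟩ : QSpace n →+ ℍ[ℝ]) f _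
  rw [this]
  simp [lmat_single_coord, QSpace.coord_mk]

/-- The commutant of the matrices supported in one column consists of right multiplications. -/
theorem exists_eq_rmul_of_commute (z : Fin n) {D : QSpace n →L[ℝ] QSpace n}
    (hD : ∀ l c x, D (lmat (Matrix.single l z c) x) = lmat (Matrix.single l z c) (D x)) :
    ∃ q, ∀ x, D x = rmul n q x := by
  refine ⟨(D (QSpace.mk fun _ => 1)).coord z, fun x => ?_⟩
  conv_lhs => rw [eq_sum_lmat_single z x, map_sum]
  simp only [hD]
  refine QSpace.ext_coord fun k => ?_
  have : ∀ f : Fin n → QSpace n, (∑ l, f l).coord k = ∑ l, (f l).coord k := fun f =>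
    map_sum (⟨⟨fun y : QSpace n => y.coord k, rfl⟩, fun _ _ => rfl⟩ : QSpace n →+ ℍ[ℝ]) f _
  rw [this]
  simp [lmat_single_coord, rmul_coord]

/-- Write e_lm(c) for the matrix with the single entry c. The maps e_lm(c) + e_ml(c̄) and e_mm(1)
are symmetric, and their product is e_lm(c) for l ≠ m. Diagonal entries come from e_zz(c) = e_zk(c)
e_kz(1), for which a second index is needed. -/
theorem exists_eq_rmul_of_commute_qHermSym (hn : 2 ≤ n) {D : QSpace n →L[ℝ] QSpace n}
    (hD : ∀ A ∈ qHermSym n, ∀ x, D (A x) = A (D x)) : ∃ q, ∀ x, D x = rmul n q x := by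
  let z : Fin n := ⟨0, by omega⟩
  let k : Fin n := ⟨1, hn⟩
  have hkz : k ≠ z := by simp [k, z]
  have hdiag : ∀ l x, D (lmat (Matrix.single l l 1) x) = lmat (Matrix.single l l 1) (D x) :=
    fun l => hD _ (lmat_mem_qHermSym (by rw [Matrix.conjTranspose_single, star_one]))
  have hoff : ∀ l m, l ≠ m → ∀ c x, D (lmat (Matrix.single l m c) x) =
      lmat (Matrix.single l m c) (D x) := by
    intro l m hlm c x
    have h1 := hD (lmat (Matrix.single l m c + Matrix.single m l (star c)))
      (lmat_mem_qHermSym (by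
        rw [Matrix.conjTranspose_add, Matrix.conjTranspose_single, Matrix.conjTranspose_single,
          star_star, add_comm])) (lmat (Matrix.single m m 1) x)
    rw [hdiag, ← lmat_mul, ← lmat_mul, add_mul, Matrix.single_mul_single_same,
      Matrix.single_mul_single_of_ne _ _ _ _ hlm, add_zero, mul_one] at h1
    exact h1
  refine exists_eq_rmul_of_commute z fun l c x => ?_
  by_cases hl : l = z
  · have h1 : Matrix.single l z c = Matrix.single l k c * Matrix.single k z 1 := by
      rw [Matrix.single_mul_single_same, mul_one]
    rw [h1, lmat_mul, hoff l k (hl ▸ hkz.symm), hoff k z hkz, lmat_mul]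
  · exact hoff l z hl c x

/-- Products of two imaginary quaternions span ℍ, which yields all diagonal entries at z even for n
= 1. Only products of two skew maps are assumed to commute with D, because these are what an
isometry preserving E_p is seen to permute. -/
theorem exists_eq_rmul_of_commute_qHermSkew (hn : 1 ≤ n) {D : QSpace n →L[ℝ] QSpace n}
    (hD : ∀ A ∈ qHermSkew n, ∀ B ∈ qHermSkew n, ∀ x, D (A (B x)) = A (B (D x))) :
    ∃ q, ∀ x, D x = rmul n q x := by
  obtain ⟨p, q, h⟩ := exists_isImPair
  let z : Fin n := ⟨0, hn⟩
  have hskew : ∀ v : ℍ[ℝ], v.re = 0 → lmat (Matrix.single z z v) ∈ qHermSkew n := fun v hv =>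
    lmat_mem_qHermSkew (by
      rw [Matrix.conjTranspose_single, quaternion_star_of_re hv, Matrix.single_neg])
  have hmul : ∀ v w : ℍ[ℝ], v.re = 0 → w.re = 0 → ∀ x,
      D (lmat (Matrix.single z z (v * w)) x) = lmat (Matrix.single z z (v * w)) (D x) := by
    intro v w hv hw x
    have h1 := hD _ (hskew v hv) _ (hskew w hw) x
    rwa [← lmat_mul, ← lmat_mul, Matrix.single_mul_single_same] at h1
  have hdiag : ∀ c x, D (lmat (Matrix.single z z c) x) = lmat (Matrix.single z z c) (D x) := by
    intro c x
    obtain ⟨r, s, t, u, rfl⟩ := h.eq_sum c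
    have e1 : (1 : ℍ[ℝ]) = p * -p := by rw [mul_neg, h.sq_left, neg_neg]
    have ep : p = q * (p * q) := by
      rw [← mul_assoc, h.anticomm, neg_mul, mul_assoc, h.sq_right, mul_neg_one, neg_neg]
    have eq : q = p * -(p * q) := by
      rw [mul_neg, ← mul_assoc, h.sq_left, neg_one_mul, neg_neg]
    have h1 := hmul p (-p) h.re_left (by rw [Quaternion.re_neg, h.re_left, neg_zero]) x
    have hp := hmul q (p * q) h.re_right h.re_mul x
    have hq := hmul p (-(p * q)) h.re_left (by rw [Quaternion.re_neg, h.re_mul, neg_zero]) x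
    have hpq := hmul p q h.re_left h.re_right x
    rw [← e1] at h1
    rw [← ep] at hp
    rw [← eq] at hq
    simp only [Matrix.single_add, ← Matrix.smul_single, lmat_add, lmat_smul, map_add, map_smul,
      h1, hp, hq, hpq]
  refine exists_eq_rmul_of_commute z fun l c x => ?_
  by_cases hl : l = z
  · rw [hl]
    exact hdiag c x
  -- Multiplication on the right by the diagonal entry `p` at `z` kills the second term and turns
  -- the first into `c`, as -c p p = c.
  · have h1 := hD (lmat (Matrix.single l z (-(c * p)) - Matrix.single z l (star (-(c * p)))))
      (lmat_mem_qHermSkew (by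
        rw [Matrix.conjTranspose_sub, Matrix.conjTranspose_single, Matrix.conjTranspose_single,
          star_star, neg_sub])) _ (hskew p h.re_left) x
    rw [← lmat_mul, ← lmat_mul, sub_mul, Matrix.single_mul_single_same,
      Matrix.single_mul_single_of_ne _ _ _ _ hl, sub_zero, neg_mul, mul_assoc, h.sq_left,
      mul_neg_one, neg_neg] at h1
    exact h1

theorem rmul_injective (hn : 1 ≤ n) {p q : ℍ[ℝ]} (h : ∀ x, rmul n p x = rmul n q x) : p = q := by
  have h1 := congrArg (fun x => QSpace.coord x ⟨0, hn⟩) (h (QSpace.mk fun _ => 1))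
  simpa [rmul_coord, QSpace.coord_mk] using h1

theorem qEdge_ne_bot (hn : 1 ≤ n) {v : ℍ[ℝ]} (hv : v ≠ 0) : qEdge n v ≠ ⊥ := by
  intro h0
  obtain ⟨p, q, h⟩ := exists_isImPair
  let z : Fin n := ⟨0, hn⟩
  have hmem : lmat (Matrix.single z z p) ∈ qHermSkew n := lmat_mem_qHermSkew (by
    rw [Matrix.conjTranspose_single, quaternion_star_of_re h.re_left, Matrix.single_neg])
  have h1 := (Submodule.eq_bot_iff _).1 h0 _ ⟨_, hmem, rfl⟩
  have h2 := congrArg (fun A : QSpace n →L[ℝ] QSpace n => (A (QSpace.mk fun _ => 1)).coord z) h1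
  have hp0 : p ≠ 0 := fun hp => by simpa [hp] using h.norm_left
  have h3 : p * v = 0 := by
    refine Eq.trans ?_ h2
    simp [rmul_coord, lmat_single_coord, QSpace.coord_mk]
  exact (mul_ne_zero hp0 hv) h3

theorem qHermSym0_ne_bot (hn : 2 ≤ n) : qHermSym0 n ≠ ⊥ := by
  intro h0
  have := QSpace.nontrivial (n := n) (by omega)
  let z : Fin n := ⟨0, by omega⟩
  let k : Fin n := ⟨1, hn⟩
  have hkz : k ≠ z := by simp [k, z]
  have hA : lmat (Matrix.single z z 1) ∈ qHermSym n :=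
    lmat_mem_qHermSym (by rw [Matrix.conjTranspose_single, star_one])
  obtain ⟨t, A', hA', h1⟩ := exists_smul_id_add_traceless _ hA.1
  have hid : ContinuousLinearMap.id ℝ (QSpace n) ∈ qHermSym n := ⟨id_mem_symEnd, fun _ _ => rfl⟩
  have hA0 : A' ∈ qHermSym0 n := ⟨by
    rw [← add_sub_cancel_left (t • ContinuousLinearMap.id ℝ (QSpace n)) A', ← h1]
    exact sub_mem hA (Submodule.smul_mem _ _ hid), hA'⟩
  rw [(Submodule.eq_bot_iff _).1 h0 _ hA0, add_zero] at h1
  have h2 := congrArg (fun A : QSpace n →L[ℝ] QSpace n => (A (QSpace.mk fun _ => 1)).coord z) h1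
  have h3 := congrArg (fun A : QSpace n →L[ℝ] QSpace n => (A (QSpace.mk fun _ => 1)).coord k) h1
  simp [lmat_single_coord, QSpace.coord_mk, QSpace.coord_smul, hkz.symm] at h2 h3
  have h4 := h2.trans h3.symm
  exact one_ne_zero h4

end LeftMatrices

/-! ### The groups Sp_n · T and the components they preserve -/

section Groups

variable {n : ℕ}

/-- Elements of Sp_n commute with right multiplications, so the products already form a subgroup. -/
theorem mem_spGrp_sup_rightScalars {T : Subgroup (unitary ℍ[ℝ])} {g : QSpace n ≃ₗᵢ[ℝ] QSpace n} :
    g ∈ spGrp n ⊔ rightScalars n T ↔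
      ∃ h ∈ spGrp n, ∃ u ∈ T, ∀ x, g x = rmul n (u : ℍ[ℝ]) (h x) := by
  constructor
  · intro hg
    have hcomm : ∀ h ∈ spGrp n, ∀ k ∈ rightScalars n T, k * h = h * k := by
      rintro h hh k ⟨u, -, hk⟩
      ext1 x
      rw [isometryEquiv_mul_apply, isometryEquiv_mul_apply, hk, hk, hh.1]
    let S : Subgroup (QSpace n ≃ₗᵢ[ℝ] QSpace n) :=
      { carrier := {g | ∃ h ∈ spGrp n, ∃ k ∈ rightScalars n T, g = k * h}
        one_mem' := ⟨1, one_mem _, 1, one_mem _, (mul_one _).symm⟩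
        mul_mem' := by
          rintro _ _ ⟨h, hh, k, hk, rfl⟩ ⟨h', hh', k', hk', rfl⟩
          refine ⟨h * h', mul_mem hh hh', k * k', mul_mem hk hk', ?_⟩
          rw [mul_assoc, mul_assoc, ← mul_assoc h, ← hcomm h hh k' hk', mul_assoc]
        inv_mem' := by
          rintro _ ⟨h, hh, k, hk, rfl⟩
          refine ⟨h⁻¹, inv_mem hh, k⁻¹, inv_mem hk, ?_⟩
          rw [mul_inv_rev, hcomm _ (inv_mem hh) _ (inv_mem hk)] }
    have hle : spGrp n ⊔ rightScalars n T ≤ S :=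
      sup_le (fun h hh => ⟨h, hh, 1, one_mem _, (one_mul _).symm⟩)
        fun k hk => ⟨1, one_mem _, k, hk, (mul_one _).symm⟩
    obtain ⟨h, hh, k, ⟨u, hu, hk⟩, rfl⟩ := hle hg
    exact ⟨h, hh, u, hu, fun x => hk (h x)⟩
  · rintro ⟨h, hh, u, hu, hg⟩
    have : g = rmulIsometry n u (norm_of_mem_unitary u) * h := by
      ext1 x
      exact hg x
    rw [this]
    exact mul_mem (Subgroup.mem_sup_right ⟨u, hu, fun _ => rfl⟩) (Subgroup.mem_sup_left hh)

theorem act_qHermSkew_mem {g : QSpace n ≃ₗᵢ[ℝ] QSpace n} (hg : g ∈ spGrp n)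
    {B : QSpace n →L[ℝ] QSpace n} (hB : B ∈ qHermSkew n) : act g B ∈ qHermSkew n := by
  refine ⟨fun x y => ?_, fun q x => ?_⟩
  · rw [act_apply, act_apply, inner_isometryEquiv_left, hB.1, ← g.inner_map_map,
      isometryEquiv_apply_inv]
  · rw [act_apply, act_apply, ((spGrp n).inv_mem hg).1, hB.2, hg.1]

theorem act_comp_rmul {g : QSpace n ≃ₗᵢ[ℝ] QSpace n} (hg : g ∈ spGrp n) (v : ℍ[ℝ])
    (B : QSpace n →L[ℝ] QSpace n) : act g (rmul n v ∘L B) = rmul n v ∘L act g B := by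
  ext1 x
  rw [act_apply, ContinuousLinearMap.comp_apply, ContinuousLinearMap.comp_apply, hg.1, act_apply]

theorem spGrp_le_invGroup_qEdge (n : ℕ) (v : ℍ[ℝ]) :
    spGrp n ≤ invGroup (qEdge n v : Set (QSpace n →L[ℝ] QSpace n)) :=
  le_invGroup_of_forall (by
    rintro g hg _ ⟨B, hB, rfl⟩
    exact ⟨_, act_qHermSkew_mem hg hB, act_comp_rmul hg v B⟩)

theorem spSp1Grp_le_invGroup_qHermSym0 (n : ℕ) :
    spSp1Grp n ≤ invGroup (qHermSym0 n : Set (QSpace n →L[ℝ] QSpace n)) := by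
  refine sup_le (le_invGroup_of_forall fun g hg A hA =>
      ⟨⟨act_mem_symEnd g hA.1.1, fun q x => ?_⟩, act_mem_traceless g hA.2⟩)
    (le_invGroup_of_forall ?_)
  · rw [act_apply, act_apply, ((spGrp n).inv_mem hg).1, hA.1.2, hg.1]
  · rintro g ⟨u, -, hg⟩ A hA
    have : act g A = A := by
      rw [act_eq_iff]
      intro x
      rw [hg, hg, hA.1.2]
    rwa [this]

theorem spSp1Grp_le_invGroup_imHermSkew (n : ℕ) :
    spSp1Grp n ≤ invGroup (imHermSkew n : Set (QSpace n →L[ℝ] QSpace n)) := by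
  refine sup_le (fun g hg => mem_invGroup_iSup fun v => mem_invGroup_iSup fun _ =>
    spGrp_le_invGroup_qEdge n v hg) (le_invGroup_of_forall ?_)
  rintro g ⟨u, -, hg⟩ A hA
  have hle : imHermSkew n ≤ (imHermSkew n).comap (actₗ g) := by
    refine iSup₂_le fun v hv => ?_
    rintro _ ⟨B, hB, rfl⟩
    have h1 := act_rmul_comp_of_rmul (norm_of_mem_unitary u) hg (v := v) hB
    refine Submodule.mem_comap.2 ?_
    change act g _ ∈ _
    rw [h1]
    refine le_iSup₂_of_le (f := fun (v : ℍ[ℝ]) (_ : v ∈ {p : ℍ[ℝ] | p.re = 0}) => qEdge n v)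
      (star (u : ℍ[ℝ]) * v * u) ?_ le_rfl ⟨B, hB, rfl⟩
    exact quaternion_re_conj hv _
  exact hle hA

theorem spPinGrp_le_invGroup_qEdge (n : ℕ) (p : ℍ[ℝ]) :
    spPinGrp n p ≤ invGroup (qEdge n p : Set (QSpace n →L[ℝ] QSpace n)) := by
  refine sup_le (spGrp_le_invGroup_qEdge n p) (le_invGroup_of_forall ?_)
  rintro g ⟨u, hu, hg⟩ _ ⟨B, hB, rfl⟩
  rw [act_rmul_comp_of_rmul (norm_of_mem_unitary u) hg hB]
  have h1 : star (u : ℍ[ℝ]) * p * u = p ∨ star (u : ℍ[ℝ]) * p * u = -p := by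
    have h2 := (circleNormalizer p).inv_mem hu
    rw [← Unitary.star_eq_inv] at h2
    simpa [circleNormalizer] using h2
  rcases h1 with h1 | h1 <;> rw [h1]
  · exact ⟨B, hB, rfl⟩
  · refine ⟨-B, neg_mem hB, ?_⟩
    ext1 x
    simp [rmul_neg]

theorem circleGrp_le_circleNormalizer (p : ℍ[ℝ]) : circleGrp p ≤ circleNormalizer p :=
  fun _ hu => Or.inl hu

theorem rightScalars_mono {T T' : Subgroup (unitary ℍ[ℝ])} (h : T ≤ T') :
    rightScalars n T ≤ rightScalars n T' := fun _ ⟨u, hu, hg⟩ => ⟨u, h hu, hg⟩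

theorem spS1Grp_le_spPinGrp (n : ℕ) (p : ℍ[ℝ]) : spS1Grp n p ≤ spPinGrp n p :=
  sup_le_sup_left (rightScalars_mono (circleGrp_le_circleNormalizer p)) _

theorem spPinGrp_le_spSp1Grp (n : ℕ) (p : ℍ[ℝ]) : spPinGrp n p ≤ spSp1Grp n :=
  sup_le_sup_left (rightScalars_mono le_top) _

/-- This space is the complement of E_0 + E_{b 0} in the traceless part, and both of those are
preserved. -/
theorem IsImFrame.spPinGrp_le_invGroup {b : Fin 3 → ℍ[ℝ]} (hb : IsImFrame b) :
    spPinGrp n (b 0) ≤ invGroup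
      ((qEdge n (b 1) ⊔ qEdge n (b 2) : Submodule ℝ (QSpace n →L[ℝ] QSpace n)) :
        Set (QSpace n →L[ℝ] QSpace n)) := by
  intro g hg
  have h0 := mem_invGroup_sup
    (spSp1Grp_le_invGroup_qHermSym0 n (spPinGrp_le_spSp1Grp n _ hg))
    (spPinGrp_le_invGroup_qEdge n _ hg)
  refine mem_invGroup_of_complement ?_ ?_ ?_ ?_ h0
  · rw [hb.traceless_eq, sup_assoc]
  · exact sup_le (qHermSym0_le_traceless n) (hb.qEdge_le_traceless 0)
  · exact sup_le (hb.qEdge_le_traceless 1) (hb.qEdge_le_traceless 2)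
  · rw [← hb.hermSym0_eq, ← hb.hermSkew_eq]
    exact tr_comp_hermSym0_hermSkew hb.pair01.cs_left

end Groups

/-! ### Invariant edges and irreducibility for Sp_n, Sp_n · S¹ and Sp_n · Sp_1 -/

section Classification

variable {n : ℕ} {b : Fin 3 → ℍ[ℝ]} {E : Submodule ℝ (QSpace n →L[ℝ] QSpace n)}

theorem IsImFrame.ne_zero (hb : IsImFrame b) (m : Fin 3) : b m ≠ 0 := fun h => by
  have := hb.1.1 m
  simp [h] at this

/-- The frame is adapted to the imaginary support of E. The resulting list is the one for Sp_n · S¹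
with circle through b 0, so Sp_n-invariance brings this larger symmetry with it. -/
theorem exists_isImFrame_of_invariant_spGrp (hn : 1 ≤ n) (hE : IsBasicEdge E)
    (hG : spGrp n ≤ invGroup (E : Set (QSpace n →L[ℝ] QSpace n))) :
    ∃ b, IsImFrame b ∧ ∃ N, (N = ⊥ ∨ N = qEdge n (b 0) ∨ N = qEdge n (b 1) ⊔ qEdge n (b 2) ∨
      N = imHermSkew n) ∧ (E = N ∨ E = qHermSym0 n ⊔ N) := by
  obtain ⟨b, hb, hU⟩ := exists_isImFrame_adapted (U := imSupport E) fun v hv => hv.1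
  refine ⟨b, hb, ⨆ v ∈ imSupport E, qEdge n v, ?_, eq_of_invariant_spGrp hn hb hE hG⟩
  rcases hU with hU | hU | hU | hU
  · rw [hU]
    exact Or.inl iSup_bot_qEdge
  · rw [hU]
    exact Or.inr (Or.inl (iSup_span_singleton_qEdge _))
  · rw [hU]
    exact Or.inr (Or.inr (Or.inl (iSup_span_pair_qEdge _ _)))
  · exact Or.inr (Or.inr (Or.inr (iSup_qEdge_of_forall fun v => ⟨fun hv => hv.1, hU v⟩)))

/-- Normalizing w only rescales the conjugated vector, so conjugators such as 1 + p can be used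
without normalization. -/
theorem mem_imSupport_conj_of_commute {p w v : ℍ[ℝ]} (hw0 : w ≠ 0) (hw : w * p = p * w)
    (hG : spS1Grp n p ≤ invGroup (E : Set (QSpace n →L[ℝ] QSpace n))) (hv : v ∈ imSupport E) :
    star w * v * w ∈ imSupport E := by
  set c : ℝ := ‖w‖⁻¹ with hc
  have hc0 : c ≠ 0 := inv_ne_zero (norm_ne_zero_iff.2 hw0)
  have hu : ‖c • w‖ = 1 := norm_smul_inv_norm_quaternion hw0
  have hmem : rmulIsometry n (c • w) hu ∈ spS1Grp n p := by
    refine Subgroup.mem_sup_right (rmulIsometry_mem_rightScalars hu ?_)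
    change c • w * p * star (c • w) = p
    rw [smul_mul_assoc, hw, ← mul_smul_comm, mul_assoc, quaternion_mul_star hu, mul_one]
  have h1 := mem_imSupport_conj hu (rmulIsometry_apply _ hu) (hG hmem) hv
  rw [Quaternion.star_smul, smul_mul_assoc, smul_mul_assoc, mul_smul_comm, smul_smul] at h1
  exact ((imSupport E).smul_mem_iff (mul_ne_zero hc0 hc0)).1 h1

/-- The support is stable under conjugation by p, which fixes p and negates q and pq, and by 1 + p,
a quarter turn of the plane of q and pq. The first splits it into an axial and a planar part; the
second leaves no invariant line in the plane. -/
theorem IsImFrame.eq_of_invariant_spS1Grp (hn : 1 ≤ n) (hb : IsImFrame b) (hE : IsBasicEdge E)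
    (hG : spS1Grp n (b 0) ≤ invGroup (E : Set (QSpace n →L[ℝ] QSpace n))) :
    ∃ N, (N = ⊥ ∨ N = qEdge n (b 0) ∨ N = qEdge n (b 1) ⊔ qEdge n (b 2) ∨
      N = imHermSkew n) ∧ (E = N ∨ E = qHermSym0 n ⊔ N) := by
  refine ⟨⨆ v ∈ imSupport E, qEdge n v, ?_,
    eq_of_invariant_spGrp hn hb hE (le_sup_left.trans hG)⟩
  set U := imSupport E with hUdef
  have h01 := hb.pair01
  set p := b 0
  set q := b 1
  obtain ⟨σ, hσ, h2⟩ := hb.exists_third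
  have hσ0 : σ ≠ 0 := by
    rintro rfl
    simp at hσ
  have hp0 : p ≠ 0 := hb.ne_zero 0
  have hstar : star p = -p := quaternion_star_of_re h01.re_left
  have hflip : ∀ v ∈ U, -(p * v * p) ∈ U := fun v hv => by
    have := mem_imSupport_conj_of_commute hp0 rfl hG hv
    rwa [hstar, neg_mul, neg_mul] at this
  have hturn : ∀ v ∈ U, (1 - p) * v * (1 + p) ∈ U := fun v hv => by
    have h0 : 1 + p ≠ 0 := fun h => by
      have := congrArg (fun x : ℍ[ℝ] => x.re) h
      simp [h01.re_left] at this
    have := mem_imSupport_conj_of_commute h0 (by rw [add_mul, mul_add, one_mul, mul_one]) hG hv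
    rwa [star_add, star_one, hstar, ← sub_eq_add_neg] at this
  have e1 : p * q * p = q := by
    rw [mul_assoc, h01.anticomm, mul_neg, ← mul_assoc, h01.sq_left, neg_one_mul, neg_neg]
  have e2 : p * (p * q) = -q := by rw [← mul_assoc, h01.sq_left, neg_one_mul]
  have hsplit : ∀ x y z : ℝ, x • p + y • q + z • (p * q) ∈ U →
      x • p ∈ U ∧ y • q + z • (p * q) ∈ U := by
    intro x y z h
    have h3 := hflip _ h
    have e3 : -(p * (x • p + y • q + z • (p * q)) * p) =
        x • p - y • q - z • (p * q) := by
      simp only [mul_add, add_mul, mul_smul_comm, smul_mul_assoc, e1, e2, h01.sq_left, neg_mul,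
        one_mul, h01.anticomm]
      module
    rw [e3] at h3
    constructor
    · have := U.smul_mem (1 / 2 : ℝ) (add_mem h h3)
      convert this using 1
      module
    · have := U.smul_mem (1 / 2 : ℝ) (sub_mem h h3)
      convert this using 1
      module
  have hrot : ∀ y z : ℝ, y • q + z • (p * q) ∈ U → z • q - y • (p * q) ∈ U := by
    intro y z h
    have h3 := U.smul_mem (1 / 2 : ℝ) (hturn _ h)
    convert h3 using 1
    simp only [mul_add, add_mul, sub_mul, mul_smul_comm, smul_mul_assoc, e1, e2, mul_one,
      one_mul, neg_mul, h01.anticomm]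
    module
  have hplane : ∀ y z : ℝ, y • q + z • (p * q) ∈ U → ¬(y = 0 ∧ z = 0) → q ∈ U ∧ p * q ∈ U := by
    intro y z h h0
    have h3 := hrot y z h
    have hs : y * y + z * z ≠ 0 := fun hs => h0 ⟨by nlinarith, by nlinarith⟩
    constructor
    · refine (U.smul_mem_iff hs).1 ?_
      convert add_mem (U.smul_mem y h) (U.smul_mem z h3) using 1
      module
    · refine (U.smul_mem_iff hs).1 ?_
      convert sub_mem (U.smul_mem z h) (U.smul_mem y h3) using 1
      module
  have hb2 : b 2 ∈ U ↔ p * q ∈ U := by rw [h2, U.smul_mem_iff hσ0]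
  have hE2 : qEdge n (b 2) = qEdge n (p * q) := hb.qEdge_two
  rw [hE2]
  by_cases hpU : p ∈ U
  · by_cases hqU : q ∈ U ∧ p * q ∈ U
    · exact Or.inr (Or.inr (Or.inr (iSup_qEdge_of_forall fun v =>
        ⟨fun hv => hv.1, hb.mem_of_mem hpU hqU.1 (hb2.2 hqU.2)⟩)))
    · refine Or.inr (Or.inl ?_)
      have hspan : U = Submodule.span ℝ {p} := by
        refine le_antisymm (fun v hv => ?_) ((Submodule.span_singleton_le_iff_mem _ _).2 hpU)
        obtain ⟨x, y, z, rfl⟩ := h01.eq_sum_of_re hv.1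
        have h3 := (hsplit x y z hv).2
        by_cases h0 : y = 0 ∧ z = 0
        · rw [h0.1, h0.2, zero_smul, zero_smul, add_zero, add_zero]
          exact Submodule.smul_mem _ _ (Submodule.mem_span_singleton_self p)
        · exact absurd (hplane y z h3 h0) hqU
      rw [hspan]
      exact iSup_span_singleton_qEdge _
  · have hx : ∀ x y z : ℝ, x • p + y • q + z • (p * q) ∈ U → x = 0 := fun x y z h => by
      by_contra hx
      exact hpU ((U.smul_mem_iff hx).1 (hsplit x y z h).1)
    by_cases hqU : q ∈ U ∧ p * q ∈ U
    · refine Or.inr (Or.inr (Or.inl ?_))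
      have hspan : U = Submodule.span ℝ {q, p * q} := by
        refine le_antisymm (fun v hv => ?_) fun v hv => ?_
        · obtain ⟨x, y, z, rfl⟩ := h01.eq_sum_of_re hv.1
          rw [hx x y z hv, zero_smul, zero_add]
          exact Submodule.mem_span_pair.2 ⟨y, z, rfl⟩
        · obtain ⟨y, z, rfl⟩ := Submodule.mem_span_pair.1 hv
          exact add_mem (U.smul_mem _ hqU.1) (U.smul_mem _ hqU.2)
      rw [hspan]
      exact iSup_span_pair_qEdge _ _
    · refine Or.inl ?_
      have hbot : U = ⊥ := by
        refine (Submodule.eq_bot_iff _).2 fun v hv => ?_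
        obtain ⟨x, y, z, rfl⟩ := h01.eq_sum_of_re hv.1
        have h3 := (hsplit x y z hv).2
        by_cases h0 : y = 0 ∧ z = 0
        · rw [hx x y z hv, h0.1, h0.2]
          simp
        · exact absurd (hplane y z h3 h0) hqU
      rw [hbot]
      exact iSup_bot_qEdge

theorem spS1Grp_le_spSp1Grp (n : ℕ) (p : ℍ[ℝ]) : spS1Grp n p ≤ spSp1Grp n :=
  (spS1Grp_le_spPinGrp n p).trans (spPinGrp_le_spSp1Grp n p)

theorem qEdge_le_imHermSkew {v : ℍ[ℝ]} (hv : v.re = 0) : qEdge n v ≤ imHermSkew n :=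
  le_iSup₂_of_le (f := fun (v : ℍ[ℝ]) (_ : v ∈ {p : ℍ[ℝ] | p.re = 0}) => qEdge n v) v hv le_rfl

theorem IsImFrame.qEdge_not_le (hn : 1 ≤ n) (hb : IsImFrame b) :
    ¬qEdge n (b 0) ≤ qEdge n (b 1) ⊔ qEdge n (b 2) := fun h =>
  qEdge_ne_bot hn (hb.ne_zero 0) (eq_bot_of_le_of_orthogonal
    (fun _ hA => qEdge_mem_symEnd (hb.2 0) hA)
    (tr_comp_sup_right (hb.tr_comp_qEdge (by decide)) (hb.tr_comp_qEdge (by decide))) h)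

/-- E_0 is orthogonal to all E_v, so it can only be a summand here if it vanishes, as it does for n
= 1. -/
theorem IsImFrame.eq_of_le_imHermSkew (hb : IsImFrame b) {N : Submodule ℝ (QSpace n →L[ℝ] QSpace n)}
    (hle : E ≤ imHermSkew n) (h : E = N ∨ E = qHermSym0 n ⊔ N) : E = N := by
  refine h.elim id fun h => ?_
  have h0 : qHermSym0 n = ⊥ := eq_bot_of_le_of_orthogonal (fun _ hA => hA.1.1)
    hb.tr_comp_qHermSym0_imHermSkew (le_sup_left.trans (h.ge.trans hle))
  rw [h, h0, bot_sup_eq]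

/-- All unit quaternions act on the support, and conjugation moves a unit vector p in it to any q
orthogonal to p; so the support is zero or all of Im ℍ. -/
theorem eq_of_invariant_spSp1Grp (hn : 1 ≤ n) (hE : IsBasicEdge E)
    (hG : spSp1Grp n ≤ invGroup (E : Set (QSpace n →L[ℝ] QSpace n))) :
    ∃ N, (N = ⊥ ∨ N = imHermSkew n) ∧ (E = N ∨ E = qHermSym0 n ⊔ N) := by
  obtain ⟨b, hb⟩ := exists_isImFrame
  refine ⟨⨆ v ∈ imSupport E, qEdge n v, ?_,
    eq_of_invariant_spGrp hn hb hE (le_sup_left.trans hG)⟩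
  by_cases hU : imSupport E = ⊥
  · rw [hU]
    exact Or.inl iSup_bot_qEdge
  obtain ⟨v, hv, hv0⟩ := Submodule.exists_mem_ne_zero_of_ne_bot hU
  have hp : (‖v‖⁻¹ : ℝ) • v ∈ imSupport E := Submodule.smul_mem _ _ hv
  set p := (‖v‖⁻¹ : ℝ) • v
  obtain ⟨q, hpq⟩ := exists_isImPair_left hp.1 (norm_smul_inv_norm_quaternion hv0)
  have hmem : ∀ q, IsImPair p q → q ∈ imSupport E := by
    intro q h
    have h0 : 1 + p * q ≠ 0 := fun h0 => by
      have := congrArg (fun x : ℍ[ℝ] => x.re) h0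
      simp only [Quaternion.re_add, h.re_mul, Quaternion.re_one, Quaternion.re_zero] at this
      norm_num at this
    -- The conjugator `1 + p * q` commutes with itself, which is why `rfl` serves; it sends `p` to
    -- `-2 • q`.
    have h1 := mem_imSupport_conj_of_commute h0 rfl ((spS1Grp_le_spSp1Grp n _).trans hG) hp
    have e1 : p * q * p = q := by
      rw [mul_assoc, h.anticomm, mul_neg, ← mul_assoc, h.sq_left, neg_one_mul, neg_neg]
    have e2 : p * (p * q) = -q := by rw [← mul_assoc, h.sq_left, neg_one_mul]
    have e3 : q * (p * q) = p := by
      rw [← mul_assoc, h.anticomm, neg_mul, mul_assoc, h.sq_right, mul_neg_one, neg_neg]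
    rw [star_add, star_one, quaternion_star_of_re h.re_mul] at h1
    have h2 := Submodule.smul_mem _ (-(1 / 2) : ℝ) h1
    convert h2 using 1
    simp only [mul_add, add_mul, mul_one, one_mul, neg_mul, e1, e2, e3]
    module
  exact Or.inr (iSup_qEdge_of_forall fun w => ⟨fun hw => hw.1,
    hpq.isImFrame.mem_of_mem hp (hmem q hpq) (hmem _ hpq.mul_right)⟩)

/-- Let w be the component of v orthogonal to p. Then E_w lies in E_p and in E_q + E_pq, which are
orthogonal, so it is zero, and this forces w = 0. -/
theorem IsImPair.exists_eq_smul_of_qEdge_le {p q : ℍ[ℝ]} (hn : 1 ≤ n) (h : IsImPair p q)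
    {v : ℍ[ℝ]} (hv : v.re = 0) (hle : qEdge n v ≤ qEdge n p) : ∃ x : ℝ, v = x • p := by
  obtain ⟨x, y, z, rfl⟩ := h.eq_sum_of_re hv
  refine ⟨x, ?_⟩
  set w := y • q + z • (p * q) with hw
  have h1 : qEdge n w ≤ qEdge n p := by
    have h2 := qEdge_add_le (n := n) (x • p + y • q + z • (p * q)) (-x • p)
    rw [show x • p + y • q + z • (p * q) + -x • p = w by rw [hw]; module] at h2
    exact h2.trans (sup_le hle (qEdge_smul_le _ _))
  have h3 : qEdge n w ≤ qEdge n q ⊔ qEdge n (p * q) :=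
    (qEdge_add_le _ _).trans (sup_le_sup (qEdge_smul_le _ _) (qEdge_smul_le _ _))
  have hb := h.isImFrame
  have h4 : qEdge n w = ⊥ := by
    refine eq_bot_of_le_of_orthogonal
      (fun _ hA => qEdge_mem_symEnd h.re_left (h1 hA)) (D := qEdge n w) ?_ le_rfl
    have h5 : ∀ A ∈ qEdge n p, ∀ B ∈ qEdge n q ⊔ qEdge n (p * q), tr (A ∘L B) = 0 :=
      tr_comp_sup_right (hb.tr_comp_qEdge (i := 0) (j := 1) (by decide))
        (hb.tr_comp_qEdge (i := 0) (j := 2) (by decide))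
    exact fun A hA B hB => h5 A (h1 hA) B (h3 hB)
  have hw0 : w = 0 := by
    by_contra hw0
    exact qEdge_ne_bot hn hw0 h4
  rw [add_assoc, ← hw, hw0, add_zero]

theorem qEdge_sup_le_imHermSkew (hb : IsImFrame b) (i j : Fin 3) :
    qEdge n (b i) ⊔ qEdge n (b j) ≤ imHermSkew n :=
  sup_le (qEdge_le_imHermSkew (hb.2 i)) (qEdge_le_imHermSkew (hb.2 j))

theorem isIrreducibleUnder_qHermSym0 (hn : 2 ≤ n) {G : Subgroup (QSpace n ≃ₗᵢ[ℝ] QSpace n)}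
    (hG : spGrp n ≤ G) (hG' : G ≤ spSp1Grp n) : IsIrreducibleUnder G (qHermSym0 n) := by
  refine ⟨hG'.trans (spSp1Grp_le_invGroup_qHermSym0 n), qHermSym0_ne_bot hn, fun E hE hEG => ?_⟩
  obtain ⟨b, hb, N, hN, hEN⟩ := exists_isImFrame_of_invariant_spGrp (by omega)
    (isBasicEdge_of_le_traceless (hE.trans (qHermSym0_le_traceless n))) (hG.trans hEG)
  have hN' : N ≤ imHermSkew n := by
    rcases hN with rfl | rfl | rfl | rfl
    exacts [bot_le, qEdge_le_imHermSkew (hb.2 0), qEdge_sup_le_imHermSkew hb 1 2, le_rfl]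
  rcases hEN with rfl | rfl
  · refine Or.inl (eq_bot_of_le_of_orthogonal (fun _ hA => (hE hA).1.1) (D := E) ?_ le_rfl)
    exact fun A hA B hB => hb.tr_comp_qHermSym0_imHermSkew A (hE hA) B (hN' hB)
  · exact Or.inr (le_antisymm hE le_sup_left)

theorem IsImPair.isIrreducibleUnder_qEdge {p q : ℍ[ℝ]} (hn : 1 ≤ n) (h : IsImPair p q)
    {G : Subgroup (QSpace n ≃ₗᵢ[ℝ] QSpace n)} (hG : spGrp n ≤ G)
    (hG' : G ≤ invGroup (qEdge n p : Set (QSpace n →L[ℝ] QSpace n))) :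
    IsIrreducibleUnder G (qEdge n p) := by
  have hp0 : p ≠ 0 := h.isImFrame.ne_zero 0
  refine ⟨hG', qEdge_ne_bot hn hp0, fun E hE hEG => ?_⟩
  have hEN := h.isImFrame.eq_of_le_imHermSkew (hE.trans (qEdge_le_imHermSkew h.re_left))
    (eq_of_invariant_spGrp hn h.isImFrame
      (isBasicEdge_of_le_traceless (hE.trans (qEdge_le_traceless h))) (hG.trans hEG))
  by_cases hU : imSupport E = ⊥
  · rw [hU, iSup_bot_qEdge] at hEN
    exact Or.inl hEN
  · obtain ⟨v, hv, hv0⟩ := Submodule.exists_mem_ne_zero_of_ne_bot hU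
    obtain ⟨x, rfl⟩ := h.exists_eq_smul_of_qEdge_le hn hv.1 (hv.2.trans hE)
    have hx : x ≠ 0 := by
      rintro rfl
      exact hv0 (zero_smul _ _)
    refine Or.inr (le_antisymm hE ?_)
    rw [← qEdge_smul hx]
    exact hv.2

theorem isIrreducibleUnder_imHermSkew (hn : 1 ≤ n) :
    IsIrreducibleUnder (spSp1Grp n) (imHermSkew n) := by
  obtain ⟨b, hb⟩ := exists_isImFrame
  refine ⟨spSp1Grp_le_invGroup_imHermSkew n, fun h => ?_, fun E hE hEG => ?_⟩
  · exact qEdge_ne_bot hn (hb.ne_zero 0) (le_bot_iff.1 (h ▸ qEdge_le_imHermSkew (hb.2 0)))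
  · obtain ⟨N, hN, hEN⟩ := eq_of_invariant_spSp1Grp hn
      (isBasicEdge_of_le_traceless (hE.trans hb.imHermSkew_le_traceless)) hEG
    rw [hb.eq_of_le_imHermSkew hE hEN]
    exact hN

theorem IsImFrame.isIrreducibleUnder_qEdge_sup (hn : 1 ≤ n) (hb : IsImFrame b) :
    IsIrreducibleUnder (spS1Grp n (b 0)) (qEdge n (b 1) ⊔ qEdge n (b 2)) := by
  refine ⟨(spS1Grp_le_spPinGrp n _).trans hb.spPinGrp_le_invGroup, fun h => ?_, fun E hE hEG => ?_⟩
  · exact qEdge_ne_bot hn (hb.ne_zero 1) (le_bot_iff.1 (h ▸ le_sup_left))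
  · have hle := hE.trans (qEdge_sup_le_imHermSkew hb 1 2)
    obtain ⟨N, hN, hEN⟩ := hb.eq_of_invariant_spS1Grp hn
      (isBasicEdge_of_le_traceless (hle.trans hb.imHermSkew_le_traceless)) hEG
    have hEN := hb.eq_of_le_imHermSkew hle hEN
    subst hEN
    rcases hN with rfl | rfl | rfl | rfl
    · exact Or.inl rfl
    · exact absurd hE (hb.qEdge_not_le hn)
    · exact Or.inr rfl
    · exact absurd ((qEdge_le_imHermSkew (hb.2 0)).trans hE) (hb.qEdge_not_le hn)

end Classification

/-! ### Exact invariance groups on ℍⁿ -/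

section Normalizers

variable {n : ℕ}

theorem IsImPair.mul_ne_mul {p q : ℍ[ℝ]} (h : IsImPair p q) : q * p ≠ p * q := by
  intro h1
  have h2 : (2 : ℝ) • (p * q) = 0 := by
    rw [two_smul]
    nth_rewrite 1 [← h1]
    rw [h.anticomm, neg_add_cancel]
  exact h.mul_right.isImFrame.ne_zero 1 ((smul_eq_zero.1 h2).resolve_left two_ne_zero)

/-- It recovers ε from the real inner product, so that an ℍ-linear isometry is automatically
symplectic. -/
theorem inner_qForm (c : ℍ[ℝ]) (x y : QSpace n) :
    inner ℝ c (qForm n x y) = (inner ℝ (rmul n c x) y : ℝ) := by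
  rw [inner_eq_re_qForm, qForm_rmul_left, Quaternion.inner_def]
  simp only [Quaternion.re_mul, Quaternion.re_star, Quaternion.imI_star, Quaternion.imJ_star,
    Quaternion.imK_star]
  ring

theorem mem_spGrp_of_commute {h : QSpace n ≃ₗᵢ[ℝ] QSpace n}
    (hh : ∀ q x, h (rmul n q x) = rmul n q (h x)) : h ∈ spGrp n :=
  ⟨hh, fun x y => ext_inner_left ℝ fun c => by
    rw [inner_qForm, inner_qForm, ← hh, h.inner_map_map]⟩

/-- Two square roots of `-1` in `ℍ` are conjugate, in a controlled way. -/
theorem exists_ne_zero_intertwining {p p' r : ℍ[ℝ]} (hp : p * p = -1) (hp' : p' * p' = -1)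
    (hr : r ≠ 0) (hrp : -p * r = r * p) :
    ∃ u, u ≠ 0 ∧ p' * u = u * p ∧ (u = 1 - p' * p ∨ u = r) := by
  -- The element 1 - p'p intertwines, since both products equal p + p'. It vanishes only for p' =
  -- -p, and then `r` takes its place.
  by_cases h : 1 - p' * p = 0
  · have h1 : p' = -p := by
      have h2 : p' * p = 1 := (sub_eq_zero.1 h).symm
      have h3 := congrArg (· * p) h2
      simp only [mul_assoc, hp, one_mul, mul_neg_one] at h3
      rw [← h3, neg_neg]
    exact ⟨r, hr, by rw [h1, hrp], Or.inr rfl⟩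
  · refine ⟨_, h, ?_, Or.inl rfl⟩
    rw [mul_sub, sub_mul, mul_one, one_mul, ← mul_assoc, hp', mul_assoc, hp]
    simp [add_comm]

/-- An orthogonal transformation normalizing the right multiplications is, up to a right
multiplication, symplectic. -/
theorem exists_mem_spGrp_of_normalizes (hn : 1 ≤ n) {g : QSpace n ≃ₗᵢ[ℝ] QSpace n}
    (hg : ∀ q, ∃ q', ∀ x, g (rmul n q x) = rmul n q' (g x)) :
    ∃ h ∈ spGrp n, ∃ u : ℍ[ℝ], ‖u‖ = 1 ∧ ∀ x, g x = rmul n u (h x) := by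
  obtain ⟨p, q, hpq⟩ := exists_isImPair
  have hcong : ∀ v w : ℍ[ℝ], (∀ x, rmul n v (g x) = rmul n w (g x)) → v = w := fun v w h =>
    rmul_injective hn fun x => by
      have := h (g.symm x)
      rwa [g.apply_symm_apply] at this
  have hsq : ∀ v v' : ℍ[ℝ], v * v = -1 → (∀ x, g (rmul n v x) = rmul n v' (g x)) →
      v' * v' = -1 := by
    intro v v' hv h
    refine hcong _ _ fun x => ?_
    rw [← rmul_rmul, ← h, ← h, rmul_rmul, hv, rmul_neg, rmul_neg, rmul_one, rmul_one, map_neg]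
  obtain ⟨p', hp'⟩ := hg p
  obtain ⟨q', hq'⟩ := hg q
  have hpr : -p * q = q * p := by rw [hpq.anticomm, neg_mul]
  have hq0 : q ≠ 0 := hpq.isImFrame.ne_zero 1
  have hp0 : p ≠ 0 := hpq.isImFrame.ne_zero 0
  obtain ⟨u, hu0, hu, -⟩ := exists_ne_zero_intertwining hpq.sq_left (hsq _ _ hpq.sq_left hp') hq0 hpr
  -- After `u` has matched `p'` with `p`, `q''` is a square root of -1 anticommuting with `p`. Its
  -- intertwiner `w` with `q`, either 1 - q''q or `p`, commutes with `p`, so `s = u * w` matches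
  -- both pairs at once.
  set q'' := u⁻¹ * q' * u with hq''
  have hq's := hsq _ _ hpq.sq_right hq'
  have hq''s : q'' * q'' = -1 := by
    rw [hq'']
    calc u⁻¹ * q' * u * (u⁻¹ * q' * u) = u⁻¹ * q' * (u * u⁻¹) * (q' * u) := by simp only [mul_assoc]
      _ = u⁻¹ * (q' * q') * u := by rw [mul_inv_cancel₀ hu0]; simp only [mul_assoc, one_mul]
      _ = -1 := by rw [hq's, mul_neg_one, neg_mul, inv_mul_cancel₀ hu0]
  have hanti' : q' * p' = -(p' * q') := by
    refine hcong _ _ fun x => ?_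
    rw [← rmul_rmul, ← hq', ← hp', rmul_neg, ← rmul_rmul, ← hp', ← hq', ← map_neg, ← rmul_neg,
      rmul_rmul, rmul_rmul, hpq.anticomm, mul_neg]
  have hanti : q'' * p = -(p * q'') := by
    have e : p = u⁻¹ * p' * u := by rw [mul_assoc, hu, ← mul_assoc, inv_mul_cancel₀ hu0, one_mul]
    rw [e, hq'']
    calc u⁻¹ * q' * u * (u⁻¹ * p' * u) = u⁻¹ * q' * (u * u⁻¹) * (p' * u) := by simp only [mul_assoc]
      _ = u⁻¹ * (q' * p') * u := by rw [mul_inv_cancel₀ hu0]; simp only [mul_assoc, one_mul]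
      _ = -(u⁻¹ * (p' * (u * u⁻¹) * q') * u) := by
        rw [hanti', mul_inv_cancel₀ hu0, mul_one]; simp
      _ = _ := by simp only [mul_assoc]
  obtain ⟨w, hw0, hw, hw'⟩ := exists_ne_zero_intertwining (p := q) (r := p) hpq.sq_right hq''s hp0
    (by rw [neg_mul, hpq.anticomm, neg_neg])
  have hwp : w * p = p * w := by
    rcases hw' with rfl | rfl
    · rw [sub_mul, mul_sub, one_mul, mul_one, mul_assoc, hpq.anticomm, mul_neg, ← mul_assoc, hanti,
        neg_mul, neg_neg, mul_assoc]
    · rfl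
  set s := u * w with hs
  have hs0 : s ≠ 0 := mul_ne_zero hu0 hw0
  have hsp : p' * s = s * p := by rw [hs, ← mul_assoc, hu, mul_assoc, ← hwp, mul_assoc]
  have hsq' : q' * s = s * q := by
    have e : q' * u = u * q'' := by
      rw [hq'', ← mul_assoc, ← mul_assoc, mul_inv_cancel₀ hu0, one_mul]
    rw [hs, ← mul_assoc, e, mul_assoc, hw, mul_assoc]
  set c : ℝ := ‖s‖⁻¹
  have hc : ‖c • s‖ = 1 := norm_smul_inv_norm_quaternion hs0
  -- Composition with this right multiplication makes `g` commute with R_p and R_q, hence with all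
  -- of ℍ.
  set k := rmulIsometry n (c • s) hc with hk
  have hkg : ∀ v v' : ℍ[ℝ], v' * s = s * v → (∀ x, g (rmul n v x) = rmul n v' (g x)) →
      ∀ x, (k * g) (rmul n v x) = rmul n v ((k * g) x) := by
    intro v v' h1 h2 x
    rw [isometryEquiv_mul_apply, isometryEquiv_mul_apply, hk, rmulIsometry_apply,
      rmulIsometry_apply, h2, rmul_rmul, rmul_rmul, mul_smul_comm, smul_mul_assoc, h1]
  refine ⟨k * g, mem_spGrp_of_commute (hpq.commute_rmul
    (A := ((k * g : QSpace n ≃ₗᵢ[ℝ] QSpace n) : QSpace n →L[ℝ] QSpace n))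
    (hkg p p' hsp hp') (hkg q q' hsq' hq')), star (c • s), by rw [norm_star, hc], fun x => ?_⟩
  rw [isometryEquiv_mul_apply, hk, rmulIsometry_apply, rmul_rmul, quaternion_mul_star hc, rmul_one]

theorem exists_rmul_conj {g : QSpace n ≃ₗᵢ[ℝ] QSpace n}
    (h : ∀ q, ∃ q', ∀ x, act g (rmul n q) x = rmul n q' x) :
    ∀ q, ∃ q', ∀ x, g (rmul n q x) = rmul n q' (g x) := fun q => by
  obtain ⟨q', hq'⟩ := h q
  exact ⟨q', fun x => by rw [← hq', act_apply_apply]⟩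

/-- Adding multiples of Id, g preserves all symmetric ℍ-linear maps, so it normalizes their
commutant, the right multiplications. -/
theorem exists_mem_spGrp_of_mem_invGroup_qHermSym0 (hn : 2 ≤ n) {g : QSpace n ≃ₗᵢ[ℝ] QSpace n}
    (hg : g ∈ invGroup (qHermSym0 n : Set (QSpace n →L[ℝ] QSpace n))) :
    ∃ h ∈ spGrp n, ∃ u : ℍ[ℝ], ‖u‖ = 1 ∧ ∀ x, g x = rmul n u (h x) := by
  have := QSpace.nontrivial (n := n) (by omega)
  refine exists_mem_spGrp_of_normalizes (by omega) (exists_rmul_conj fun q =>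
    exists_eq_rmul_of_commute_qHermSym hn fun A hA x => ?_)
  have hid : ContinuousLinearMap.id ℝ (QSpace n) ∈ qHermSym n := ⟨id_mem_symEnd, fun _ _ => rfl⟩
  obtain ⟨t, A', hA', h1⟩ := exists_smul_id_add_traceless A hA.1
  have hA0 : A' ∈ qHermSym0 n := ⟨by
    rw [← add_sub_cancel_left (t • ContinuousLinearMap.id ℝ (QSpace n)) A', ← h1]
    exact sub_mem hA (Submodule.smul_mem _ _ hid), hA'⟩
  have h2 := act_mem_of_mem_invGroup ((invGroup _).inv_mem hg) hA0
  have h3 : ∀ q x, act g⁻¹ A (rmul n q x) = rmul n q (act g⁻¹ A x) := by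
    rw [h1, act_add, act_smul, act_id]
    exact fun q x => by simp [h2.1.2 q x]
  have h4 : A = act g (act g⁻¹ A) := (act_act_inv g A).symm
  rw [h4]
  obtain ⟨y, rfl⟩ := g.surjective x
  rw [act_apply_apply, act_apply_apply, act_apply_apply, act_apply_apply, h3]

/-- Since (R_p A)(R_p B) = -AB, conjugation by g⁻¹ carries products of two skew ℍ-linear maps to
such products. Hence g normalizes the commutant of these products, the right multiplications. -/
theorem exists_mem_spGrp_of_mem_invGroup_qEdge (hn : 1 ≤ n) {p : ℍ[ℝ]} (hp : p.re = 0)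
    (h1 : ‖p‖ = 1) {g : QSpace n ≃ₗᵢ[ℝ] QSpace n}
    (hg : g ∈ invGroup (qEdge n p : Set (QSpace n →L[ℝ] QSpace n))) :
    ∃ h ∈ spGrp n, ∃ u : ℍ[ℝ], ‖u‖ = 1 ∧ ∀ x, g x = rmul n u (h x) := by
  refine exists_mem_spGrp_of_normalizes hn (exists_rmul_conj fun q =>
    exists_eq_rmul_of_commute_qHermSkew hn fun A hA B hB x => ?_)
  have key : ∀ A ∈ qHermSkew n, ∃ A' ∈ qHermSkew n, ∀ y,
      rmul n p (A (g y)) = g (rmul n p (A' y)) := by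
    intro A hA
    obtain ⟨A', hA', h2⟩ := act_mem_of_mem_invGroup ((invGroup _).inv_mem hg)
      (show rmul n p ∘L A ∈ qEdge n p from ⟨A, hA, rfl⟩)
    refine ⟨A', hA', fun y => ?_⟩
    have h3 : act g (rmul n p ∘L A') = rmul n p ∘L A := by rw [← h2, act_act_inv]
    exact (act_eq_iff.1 h3 y).symm
  obtain ⟨A', hA', hAA⟩ := key A hA
  obtain ⟨B', hB', hBB⟩ := key B hB
  have hprod : ∀ y, A (B (g y)) = g (A' (B' y)) := by
    intro y
    have hsq : ∀ z, rmul n p (rmul n p z) = -z := (isComplexStructure_rmul hp h1).sq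
    have h4 : rmul n p (A (rmul n p (B (g y)))) = -(A (B (g y))) := by rw [hA.2, hsq]
    rw [← neg_eq_iff_eq_neg] at h4
    rw [← h4, hBB, hAA, hA'.2, hsq, map_neg, neg_neg]
  obtain ⟨y, rfl⟩ := g.surjective x
  rw [act_apply_apply, hprod, hprod, act_apply_apply, hB'.2, hA'.2]

theorem invGroup_qHermSym0 (hn : 2 ≤ n) :
    invGroup (qHermSym0 n : Set (QSpace n →L[ℝ] QSpace n)) = spSp1Grp n := by
  refine le_antisymm (fun g hg => ?_) (spSp1Grp_le_invGroup_qHermSym0 n)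
  obtain ⟨h, hh, u, hu, hgu⟩ := exists_mem_spGrp_of_mem_invGroup_qHermSym0 hn hg
  exact mem_spGrp_sup_rightScalars.2 ⟨h, hh, ⟨u, quaternion_mem_unitary hu⟩, Subgroup.mem_top _, hgu⟩

theorem invGroup_imHermSkew (hn : 2 ≤ n) :
    invGroup (imHermSkew n : Set (QSpace n →L[ℝ] QSpace n)) = spSp1Grp n := by
  obtain ⟨b, hb⟩ := exists_isImFrame
  refine le_antisymm (fun g hg => ?_) (spSp1Grp_le_invGroup_imHermSkew n)
  rw [← invGroup_qHermSym0 hn]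
  exact mem_invGroup_of_complement (by rw [hb.traceless_eq_imHermSkew, sup_comm])
    hb.imHermSkew_le_traceless (qHermSym0_le_traceless n)
    (tr_comp_symm hb.tr_comp_qHermSym0_imHermSkew) hg

/-- Once the symplectic factor is removed, R_u preserves E_p. Then ū p u is a multiple of p of norm
one, that is ±p. -/
theorem IsImPair.invGroup_qEdge (hn : 1 ≤ n) {p q : ℍ[ℝ]} (hpq : IsImPair p q) :
    invGroup (qEdge n p : Set (QSpace n →L[ℝ] QSpace n)) = spPinGrp n p := by
  refine le_antisymm (fun g hg => ?_) (spPinGrp_le_invGroup_qEdge n p)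
  obtain ⟨h, hh, u, hu, hgu⟩ :=
    exists_mem_spGrp_of_mem_invGroup_qEdge hn hpq.re_left hpq.norm_left hg
  refine mem_spGrp_sup_rightScalars.2 ⟨h, hh, ⟨u, quaternion_mem_unitary hu⟩, ?_, hgu⟩
  have hk : rmulIsometry n u hu ∈ invGroup (qEdge n p : Set (QSpace n →L[ℝ] QSpace n)) := by
    have : rmulIsometry n u hu = g * h⁻¹ := by
      rw [eq_mul_inv_iff_mul_eq]
      ext1 x
      exact (hgu x).symm
    rw [this]
    exact mul_mem hg (inv_mem (spGrp_le_invGroup_qEdge n p hh))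
  have h1 := mem_imSupport_conj hu (rmulIsometry_apply u hu) hk
    (v := p) ⟨hpq.re_left, le_rfl⟩
  obtain ⟨x, hx⟩ := hpq.exists_eq_smul_of_qEdge_le hn h1.1 h1.2
  have hx1 : |x| = 1 := by
    have h2 := congrArg norm hx
    rw [norm_mul, norm_mul, norm_star, hu, one_mul, mul_one, norm_smul, hpq.norm_left, mul_one,
      Real.norm_eq_abs] at h2
    exact h2.symm
  have h3 : p = x • (u * p * star u) := by
    have hu1 : u * star u = 1 := quaternion_mul_star hu
    calc p = u * star u * p * (u * star u) := by rw [hu1, one_mul, mul_one]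
      _ = u * (star u * p * u) * star u := by simp only [mul_assoc]
      _ = _ := by rw [hx, mul_smul_comm, smul_mul_assoc]
  change u * p * star u = p ∨ u * p * star u = -p
  rcases eq_or_eq_neg_of_abs_eq hx1 with rfl | rfl
  · rw [one_smul] at h3
    exact Or.inl h3.symm
  · rw [neg_one_smul] at h3
    exact Or.inr (neg_eq_iff_eq_neg.1 h3.symm)

theorem IsImFrame.invGroup_complement (hn : 1 ≤ n) {b : Fin 3 → ℍ[ℝ]} (hb : IsImFrame b) :
    invGroup ((qHermSym0 n ⊔ qEdge n (b 1) ⊔ qEdge n (b 2) :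
      Submodule ℝ (QSpace n →L[ℝ] QSpace n)) : Set (QSpace n →L[ℝ] QSpace n)) =
      spPinGrp n (b 0) := by
  rw [sup_assoc]
  refine le_antisymm (fun g hg => ?_) fun g hg => mem_invGroup_sup
    (spSp1Grp_le_invGroup_qHermSym0 n (spPinGrp_le_spSp1Grp n _ hg)) (hb.spPinGrp_le_invGroup hg)
  rw [← hb.pair01.invGroup_qEdge hn]
  refine mem_invGroup_of_complement ?_ ?_ (hb.qEdge_le_traceless 0) ?_ hg
  · rw [hb.traceless_eq, sup_left_comm, sup_comm]
  · exact sup_le (qHermSym0_le_traceless n)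
      (sup_le (hb.qEdge_le_traceless 1) (hb.qEdge_le_traceless 2))
  · refine tr_comp_symm (tr_comp_sup_right ?_ (tr_comp_sup_right
      (hb.tr_comp_qEdge (by decide)) (hb.tr_comp_qEdge (by decide))))
    exact tr_comp_symm fun A hA => hb.tr_comp_qHermSym_qEdge 0 A hA.1

theorem rmul_commute_of_mem_spS1Grp {p : ℍ[ℝ]} {g : QSpace n ≃ₗᵢ[ℝ] QSpace n}
    (hg : g ∈ spS1Grp n p) (x : QSpace n) : g (rmul n p x) = rmul n p (g x) := by
  obtain ⟨h, hh, u, hu, hgu⟩ := mem_spGrp_sup_rightScalars.1 hg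
  have hu' : (u : ℍ[ℝ]) * p * star (u : ℍ[ℝ]) = p := hu
  have h1 : star (u : ℍ[ℝ]) * u = 1 := Unitary.coe_star_mul_self u
  have h2 : (u : ℍ[ℝ]) * p = p * u := by
    conv_rhs => rw [← hu', mul_assoc, h1, mul_one]
  rw [hgu, hgu, hh.1, rmul_rmul, rmul_rmul, h2]

/-- The other coset is represented by R_q, since conjugation by q sends p to -p. R_q is outside the
smaller group because it does not commute with R_p. -/
theorem IsImPair.relIndex_spS1Grp (hn : 1 ≤ n) {p q : ℍ[ℝ]} (h : IsImPair p q) :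
    (spS1Grp n p).relIndex (spPinGrp n p) = 2 := by
  have hqp : q * p * star q = -p := by
    rw [quaternion_star_of_re h.re_right, h.anticomm, neg_mul_neg, mul_assoc, h.sq_right,
      mul_neg_one]
  set a := rmulIsometry n q h.norm_right with ha
  have haP : a ∈ spPinGrp n p :=
    Subgroup.mem_sup_right (rmulIsometry_mem_rightScalars _ (Or.inr hqp))
  have haS : a ∉ spS1Grp n p := by
    intro hmem
    have h1 : ∀ x, rmul n (p * q) x = rmul n (q * p) x := fun x => by
      have := rmul_commute_of_mem_spS1Grp hmem x
      rwa [ha, rmulIsometry_apply, rmulIsometry_apply, rmul_rmul, rmul_rmul] at this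
    exact h.mul_ne_mul (rmul_injective hn h1).symm
  rw [Subgroup.relIndex, Subgroup.index_eq_two_iff]
  refine ⟨⟨a, haP⟩, fun ⟨g, hg⟩ => ?_⟩
  simp only [Subgroup.mem_subgroupOf, Subgroup.coe_mul]
  by_cases hgS : g ∈ spS1Grp n p
  · exact Or.inr ⟨hgS, fun h1 => haS (((spS1Grp n p).mul_mem_cancel_left hgS).1 h1)⟩
  · refine Or.inl ⟨?_, hgS⟩
    obtain ⟨k, hk, u, hu, hgu⟩ := mem_spGrp_sup_rightScalars.1 hg
    have hu' : (u : ℍ[ℝ]) * p * star (u : ℍ[ℝ]) = -p := by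
      refine hu.resolve_left fun h1 => hgS ?_
      exact mem_spGrp_sup_rightScalars.2 ⟨k, hk, u, h1, hgu⟩
    refine mem_spGrp_sup_rightScalars.2
      ⟨k, hk, ⟨q, quaternion_mem_unitary h.norm_right⟩ * u, ?_, fun x => ?_⟩
    · change q * u * p * star (q * (u : ℍ[ℝ])) = p
      calc q * u * p * star (q * (u : ℍ[ℝ])) = q * (u * p * star (u : ℍ[ℝ])) * star q := by
            rw [star_mul]; simp only [mul_assoc]
        _ = p := by rw [hu', mul_neg, neg_mul, hqp, neg_neg]
    · rw [isometryEquiv_mul_apply, hgu, ha, rmulIsometry_apply, hk.1, rmul_rmul]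
      rfl

/-- In a frame adapted to E, right multiplication by b 0 preserves E. It is not symplectic, as it
does not commute with right multiplication by b 1. -/
theorem invGroup_ne_spGrp (hn : 1 ≤ n) {E : Submodule ℝ (QSpace n →L[ℝ] QSpace n)}
    (hE : IsBasicEdge E) : invGroup (E : Set (QSpace n →L[ℝ] QSpace n)) ≠ spGrp n := by
  intro hG
  obtain ⟨b, hb, N, hN, hEN⟩ := exists_isImFrame_of_invariant_spGrp hn hE hG.ge
  have h01 := hb.pair01
  set g := rmulIsometry n (b 0) h01.norm_left with hg
  have hgP : g ∈ spPinGrp n (b 0) := by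
    refine Subgroup.mem_sup_right (rmulIsometry_mem_rightScalars _ (Or.inl ?_))
    change b 0 * b 0 * star (b 0) = b 0
    rw [mul_assoc, quaternion_mul_star h01.norm_left, mul_one]
  have hgS := spPinGrp_le_spSp1Grp n _ hgP
  have hgN : g ∈ invGroup (N : Set (QSpace n →L[ℝ] QSpace n)) := by
    rcases hN with rfl | rfl | rfl | rfl
    · rw [invGroup_bot]
      exact Subgroup.mem_top _
    · exact spPinGrp_le_invGroup_qEdge n _ hgP
    · exact hb.spPinGrp_le_invGroup hgP
    · exact spSp1Grp_le_invGroup_imHermSkew n hgS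
  have hgE : g ∈ spGrp n := by
    rw [← hG]
    rcases hEN with rfl | rfl
    · exact hgN
    · exact mem_invGroup_sup (spSp1Grp_le_invGroup_qHermSym0 n hgS) hgN
  have h1 : ∀ x, rmul n (b 1 * b 0) x = rmul n (b 0 * b 1) x := fun x => by
    have := hgE.1 (b 1) x
    rwa [hg, rmulIsometry_apply, rmulIsometry_apply, rmul_rmul, rmul_rmul] at this
  exact h01.mul_ne_mul (rmul_injective hn h1)

end Normalizers

/-! ### From lists of edges to lists of subequations -/

section Lists

variable {V : Type*} [NormedAddCommGroup V] [InnerProductSpace ℝ V] [FiniteDimensional ℝ V]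

theorem isBasicEdge_iSup {k : ℕ} {C : Fin k → Submodule ℝ (V →L[ℝ] V)} {G : Subgroup (V ≃ₗᵢ[ℝ] V)}
    (hC : ∀ i, C i ≤ traceless V) (hG : ∀ i, G ≤ invGroup (C i : Set (V →L[ℝ] V)))
    (s : Set (Fin k)) : IsBasicEdge (⨆ i ∈ s, C i) ∧
      G ≤ invGroup ((⨆ i ∈ s, C i : Submodule ℝ (V →L[ℝ] V)) : Set (V →L[ℝ] V)) :=
  ⟨isBasicEdge_of_le_traceless (iSup₂_le fun i _ => hC i), fun _ hg =>
    mem_invGroup_iSup fun i => mem_invGroup_iSup fun _ => hG i hg⟩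

omit [FiniteDimensional ℝ V] in
theorem isMinimalSubequation_and_invariant_iff {G : Subgroup (V ≃ₗᵢ[ℝ] V)}
    {F : Set (V →L[ℝ] V)} : (IsMinimalSubequation F ∧ G ≤ invGroup F) ↔
      ∃ E : Submodule ℝ (V →L[ℝ] V),
        (IsBasicEdge E ∧ G ≤ invGroup (E : Set (V →L[ℝ] V))) ∧ F = minimalSubeq E := by
  constructor
  · rintro ⟨⟨E, hE, rfl⟩, hG⟩
    exact ⟨E, ⟨hE, invGroup_minimalSubeq hE ▸ hG⟩, rfl⟩
  · rintro ⟨E, ⟨hE, hG⟩, rfl⟩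
    exact ⟨⟨E, hE, rfl⟩, (invGroup_minimalSubeq hE).symm ▸ hG⟩

omit [FiniteDimensional ℝ V] in
theorem exists_eq_iSup_fin_two {C D E : Submodule ℝ (V →L[ℝ] V)}
    (h : E = ⊥ ∨ E = C ∨ E = D ∨ E = C ⊔ D) : ∃ s : Set (Fin 2), E = ⨆ i ∈ s, ![C, D] i := by
  rcases h with rfl | rfl | rfl | rfl
  · exact ⟨∅, by simp⟩
  · exact ⟨{0}, by simp⟩
  · exact ⟨{1}, by simp⟩
  · exact ⟨{0, 1}, by simp only [iSup_insert, iSup_singleton]; rfl⟩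

theorem isSymDecomposition_two {C D : Submodule ℝ (V →L[ℝ] V)} (h : C ⊔ D = traceless V)
    (ho : ∀ A ∈ C, ∀ B ∈ D, tr (A ∘L B) = 0) : IsSymDecomposition ![C, D] := by
  refine isSymDecomposition_of ?_ fun i j hij => ?_
  · rw [← h, ← Finset.sup_univ_eq_iSup]
    simp [Fin.univ_succ]
  · fin_cases i <;> fin_cases j <;> first | exact absurd hij (by decide) | skip
    exact ho

end Lists

/-! ### Sums of components and the eight subequations of a frame -/

section Symplectic

variable {n : ℕ} {b : Fin 3 → ℍ[ℝ]} {E N : Submodule ℝ (QSpace n →L[ℝ] QSpace n)}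

/-- `E` is a sum of the components `E_0`, `E_{b 0}` and `E_{b 1} ⊕ E_{b 2}`. -/
def IsComponentSum (b : Fin 3 → ℍ[ℝ]) (E : Submodule ℝ (QSpace n →L[ℝ] QSpace n)) : Prop :=
  ∃ N, (N = ⊥ ∨ N = qEdge n (b 0) ∨ N = qEdge n (b 1) ⊔ qEdge n (b 2) ∨
    N = imHermSkew n) ∧ (E = N ∨ E = qHermSym0 n ⊔ N)

theorem IsImFrame.invariant_of_isComponentSum (hb : IsImFrame b) (hE : IsComponentSum b E) :
    IsBasicEdge E ∧ spPinGrp n (b 0) ≤ invGroup (E : Set (QSpace n →L[ℝ] QSpace n)) := by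
  obtain ⟨N, hN, hEN⟩ := hE
  have h1 : N ≤ traceless (QSpace n) ∧
      spPinGrp n (b 0) ≤ invGroup (N : Set (QSpace n →L[ℝ] QSpace n)) := by
    rcases hN with rfl | rfl | rfl | rfl
    · exact ⟨bot_le, by rw [invGroup_bot]; exact le_top⟩
    · exact ⟨hb.qEdge_le_traceless 0, spPinGrp_le_invGroup_qEdge n _⟩
    · exact ⟨sup_le (hb.qEdge_le_traceless 1) (hb.qEdge_le_traceless 2), hb.spPinGrp_le_invGroup⟩
    · exact ⟨hb.imHermSkew_le_traceless,
        (spPinGrp_le_spSp1Grp n _).trans (spSp1Grp_le_invGroup_imHermSkew n)⟩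
  rcases hEN with rfl | rfl
  · exact ⟨isBasicEdge_of_le_traceless h1.1, h1.2⟩
  · exact ⟨isBasicEdge_of_le_traceless (sup_le (qHermSym0_le_traceless n) h1.1), fun g hg =>
      mem_invGroup_sup (spSp1Grp_le_invGroup_qHermSym0 n (spPinGrp_le_spSp1Grp n _ hg)) (h1.2 hg)⟩

/-- The eight sums of E_0, E_{b 0} and E_{b 1} + E_{b 2} match the eight sets through the geometric
descriptions. The equivalence is shared by the cases Sp_n and Sp_n · S¹. -/
theorem IsImFrame.exists_isComponentSum_iff (hn : 1 ≤ n) (hb : IsImFrame b)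
    {F : Set (QSpace n →L[ℝ] QSpace n)} :
    (∃ E, IsComponentSum b E ∧ F = minimalSubeq E) ↔
      F = psdCone _ ∨ F = laplacian _ ∨ F = geomSubeq (quaternionicLines n) ∨
      F = minimalSubeq (qHermSym0 n) ∨
      F = geomSubeq (complexLines (rmul n (b 0))) ∨
      F = geomSubeq (lagrangians (rmul n (b 0))) ∨
      F = geomSubeq (complexLagrangians (rmul n (b 0)) (rmul n (b 1)) (rmul n (b 2))) ∨
      F = minimalSubeq (qEdge n (b 0)) := by
  have := QSpace.nontrivial hn
  have hJ := hb.pair01.cs_left (n := n)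
  rw [← minimalSubeq_bot, ← minimalSubeq_traceless, ← minimalSubeq_imHermSkew hb,
    ← minimalSubeq_hermSkew hJ, ← minimalSubeq_hermSym0 hJ, ← minimalSubeq_complexLagrangians hb,
    hb.hermSkew_eq, hb.hermSym0_eq, hb.traceless_eq_imHermSkew, sup_assoc]
  constructor
  · rintro ⟨E, ⟨N, rfl | rfl | rfl | rfl, rfl | rfl⟩, rfl⟩ <;> simp
  · rintro (rfl | rfl | rfl | rfl | rfl | rfl | rfl | rfl)
    · exact ⟨_, ⟨⊥, by simp, Or.inl rfl⟩, rfl⟩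
    · exact ⟨_, ⟨imHermSkew n, by simp, Or.inr rfl⟩, rfl⟩
    · exact ⟨_, ⟨imHermSkew n, by simp, Or.inl rfl⟩, rfl⟩
    · exact ⟨_, ⟨⊥, by simp, Or.inr (sup_bot_eq _).symm⟩, rfl⟩
    · exact ⟨_, ⟨qEdge n (b 1) ⊔ qEdge n (b 2), by simp, Or.inl rfl⟩, rfl⟩
    · exact ⟨_, ⟨qEdge n (b 0), by simp, Or.inr rfl⟩, rfl⟩
    · exact ⟨_, ⟨qEdge n (b 1) ⊔ qEdge n (b 2), by simp, Or.inr rfl⟩, rfl⟩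
    · exact ⟨_, ⟨qEdge n (b 0), by simp, Or.inl rfl⟩, rfl⟩

theorem IsComponentSum.exists_eq_iSup_fin_four (hb : IsImFrame b) (hE : IsComponentSum b E) :
    ∃ s : Set (Fin 4),
      E = ⨆ i ∈ s, ![qHermSym0 n, qEdge n (b 0), qEdge n (b 1), qEdge n (b 2)] i := by
  obtain ⟨N, hN, hEN⟩ := hE
  rw [hb.imHermSkew_eq] at hN
  rcases hN with rfl | rfl | rfl | rfl <;> rcases hEN with rfl | rfl
  · exact ⟨∅, by simp⟩
  · exact ⟨{0}, by simp⟩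
  · exact ⟨{1}, by simp⟩
  · exact ⟨{0, 1}, by simp only [iSup_insert, iSup_singleton]; rfl⟩
  · exact ⟨{2, 3}, by simp only [iSup_insert, iSup_singleton]; rfl⟩
  · exact ⟨{0, 2, 3}, by simp only [iSup_insert, iSup_singleton]; rfl⟩
  · exact ⟨{1, 2, 3}, by simp only [iSup_insert, iSup_singleton, sup_assoc]; rfl⟩
  · exact ⟨{0, 1, 2, 3}, by simp only [iSup_insert, iSup_singleton, sup_assoc]; rfl⟩

theorem IsComponentSum.exists_eq_iSup_fin_three (hb : IsImFrame b) (hE : IsComponentSum b E) :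
    ∃ s : Set (Fin 3),
      E = ⨆ i ∈ s, ![qHermSym0 n, qEdge n (b 0), qEdge n (b 1) ⊔ qEdge n (b 2)] i := by
  obtain ⟨N, hN, hEN⟩ := hE
  rw [hb.imHermSkew_eq] at hN
  rcases hN with rfl | rfl | rfl | rfl <;> rcases hEN with rfl | rfl
  · exact ⟨∅, by simp⟩
  · exact ⟨{0}, by simp⟩
  · exact ⟨{1}, by simp⟩
  · exact ⟨{0, 1}, by simp only [iSup_insert, iSup_singleton]; rfl⟩
  · exact ⟨{2}, by simp⟩
  · exact ⟨{0, 2}, by simp only [iSup_insert, iSup_singleton]; rfl⟩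
  · exact ⟨{1, 2}, by simp only [iSup_insert, iSup_singleton, sup_assoc]; rfl⟩
  · exact ⟨{0, 1, 2}, by simp only [iSup_insert, iSup_singleton, sup_assoc]; rfl⟩

theorem IsImFrame.isSymDecomposition_four (hb : IsImFrame b) :
    IsSymDecomposition ![qHermSym0 n, qEdge n (b 0), qEdge n (b 1), qEdge n (b 2)] := by
  have h0 : ∀ m, ∀ A ∈ qHermSym0 n, ∀ B ∈ qEdge n (b m), tr (A ∘L B) = 0 :=
    fun m A hA => hb.tr_comp_qHermSym_qEdge m A hA.1
  refine isSymDecomposition_of ?_ fun i j hij => ?_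
  · rw [hb.traceless_eq, ← Finset.sup_univ_eq_iSup]
    simp [Fin.univ_succ]
  · fin_cases i <;> fin_cases j <;> first | exact absurd hij (by decide) | skip
    exacts [h0 0, h0 1, h0 2, hb.tr_comp_qEdge (by decide), hb.tr_comp_qEdge (by decide),
      hb.tr_comp_qEdge (by decide)]

theorem IsImFrame.isSymDecomposition_three (hb : IsImFrame b) :
    IsSymDecomposition ![qHermSym0 n, qEdge n (b 0), qEdge n (b 1) ⊔ qEdge n (b 2)] := by
  have h0 : ∀ m, ∀ A ∈ qHermSym0 n, ∀ B ∈ qEdge n (b m), tr (A ∘L B) = 0 :=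
    fun m A hA => hb.tr_comp_qHermSym_qEdge m A hA.1
  refine isSymDecomposition_of ?_ fun i j hij => ?_
  · rw [hb.traceless_eq, ← Finset.sup_univ_eq_iSup]
    simp [Fin.univ_succ]
  · fin_cases i <;> fin_cases j <;> first | exact absurd hij (by decide) | skip
    exacts [h0 0, tr_comp_sup_right (h0 1) (h0 2),
      tr_comp_sup_right (hb.tr_comp_qEdge (by decide)) (hb.tr_comp_qEdge (by decide))]

end Symplectic

/-! ### The cases O_n and U_n -/

section RealAndComplex

variable {n : ℕ}

theorem classification_orthogonal (hn : 1 ≤ n) :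
    ((IsSymDecomposition ![traceless (EuclideanSpace ℝ (Fin n))] ∧
      (2 ≤ n → IsIrreducibleUnder ⊤ (traceless (EuclideanSpace ℝ (Fin n))))) ∧
      (∀ E : Submodule ℝ (EuclideanSpace ℝ (Fin n) →L[ℝ] EuclideanSpace ℝ (Fin n)),
        (IsBasicEdge E ∧ ⊤ ≤ invGroup (E : Set (EuclideanSpace ℝ (Fin n) →L[ℝ] EuclideanSpace ℝ (Fin n)))) ↔
          E = ⊥ ∨ E = traceless (EuclideanSpace ℝ (Fin n))) ∧
      (∀ F : Set (EuclideanSpace ℝ (Fin n) →L[ℝ] EuclideanSpace ℝ (Fin n)),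
        (IsMinimalSubequation F ∧ ⊤ ≤ invGroup F) ↔
          F = psdCone _ ∨ F = laplacian _)) := by
  have : Nontrivial (EuclideanSpace ℝ (Fin n)) :=
    Module.nontrivial_of_finrank_pos (R := ℝ) (by rw [finrank_euclideanSpace_fin]; omega)
  have hE : ∀ E : Submodule ℝ (EuclideanSpace ℝ (Fin n) →L[ℝ] EuclideanSpace ℝ (Fin n)),
      (IsBasicEdge E ∧ ⊤ ≤ invGroup (E : Set (EuclideanSpace ℝ (Fin n) →L[ℝ] EuclideanSpace ℝ (Fin n)))) ↔
        E = ⊥ ∨ E = traceless (EuclideanSpace ℝ (Fin n)) := by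
    refine fun E => ⟨fun h => eq_bot_or_traceless_of_invariant h.1 h.2, ?_⟩
    rintro (rfl | rfl)
    · exact ⟨isBasicEdge_of_le_traceless bot_le, invGroup_bot.ge⟩
    · exact ⟨isBasicEdge_of_le_traceless le_rfl, invGroup_traceless.ge⟩
  refine ⟨⟨isSymDecomposition_of (by simp) fun i j hij => ?_, fun h2 =>
    isIrreducibleUnder_top_traceless (by rwa [finrank_euclideanSpace_fin])⟩, hE, fun F => ?_⟩
  · exact absurd hij (by rw [Subsingleton.elim i j]; exact lt_irrefl _)
  · rw [isMinimalSubequation_and_invariant_iff]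
    simp only [hE]
    rw [← minimalSubeq_bot, ← minimalSubeq_traceless]
    constructor
    · rintro ⟨E, rfl | rfl, rfl⟩ <;> simp
    · rintro (rfl | rfl)
      exacts [⟨_, Or.inl rfl, rfl⟩, ⟨_, Or.inr rfl, rfl⟩]

theorem unitaryGrp_le_invGroup_hermSkew (n : ℕ) :
    unitaryGrp n ≤ invGroup (hermSkew (mulI n) : Set (EuclideanSpace ℂ (Fin n) →L[ℝ] _)) :=
  fun g (hg : ∀ (c : ℂ) x, g (c • x) = c • g x) =>
    (mem_invGroup_hermSkew (isComplexStructure_mulI n) g).2 (Or.inl (hg Complex.I))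

theorem unitaryGrp_le_invGroup_hermSym0 (n : ℕ) :
    unitaryGrp n ≤ invGroup (hermSym0 (mulI n) : Set (EuclideanSpace ℂ (Fin n) →L[ℝ] _)) := by
  rw [invGroup_hermSym0 (isComplexStructure_mulI n)]
  exact unitaryGrp_le_invGroup_hermSkew n

theorem classification_unitary (hn : 1 ≤ n) :
    ((IsSymDecomposition ![hermSym0 (mulI n), hermSkew (mulI n)] ∧
      (2 ≤ n → IsIrreducibleUnder (unitaryGrp n) (hermSym0 (mulI n))) ∧
      IsIrreducibleUnder (unitaryGrp n) (hermSkew (mulI n))) ∧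
      (∀ E : Submodule ℝ (EuclideanSpace ℂ (Fin n) →L[ℝ] EuclideanSpace ℂ (Fin n)),
        (IsBasicEdge E ∧ unitaryGrp n ≤ invGroup (E : Set (EuclideanSpace ℂ (Fin n) →L[ℝ] EuclideanSpace ℂ (Fin n)))) ↔
          ∃ s : Set (Fin 2), E = ⨆ i ∈ s, ![hermSym0 (mulI n), hermSkew (mulI n)] i) ∧
      (∀ F : Set (EuclideanSpace ℂ (Fin n) →L[ℝ] EuclideanSpace ℂ (Fin n)),
        (IsMinimalSubequation F ∧ unitaryGrp n ≤ invGroup F) ↔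
          F = psdCone _ ∨ F = laplacian _ ∨ F = geomSubeq (complexLines (mulI n)) ∨
          F = geomSubeq (lagrangians (mulI n)))) := by
  have hdim : Module.finrank ℝ (EuclideanSpace ℂ (Fin n)) = 2 * n := by
    rw [← Module.finrank_mul_finrank ℝ ℂ, Complex.finrank_real_complex, finrank_euclideanSpace_fin]
  have : Nontrivial (EuclideanSpace ℂ (Fin n)) :=
    Module.nontrivial_of_finrank_pos (R := ℝ) (by rw [hdim]; omega)
  have hJ := isComplexStructure_mulI n
  have hsup := hermSym0_sup_hermSkew hJ
  have hcases : ∀ E : Submodule ℝ (EuclideanSpace ℂ (Fin n) →L[ℝ] EuclideanSpace ℂ (Fin n)),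
      (IsBasicEdge E ∧ unitaryGrp n ≤ invGroup (E : Set (EuclideanSpace ℂ (Fin n) →L[ℝ] _))) →
      E = ⊥ ∨ E = hermSym0 (mulI n) ∨ E = hermSkew (mulI n) ∨ E = traceless _ := fun E h =>
    eq_of_invariant_of_isTransitiveAlong_complexOrbit hJ (G := unitaryGrp n)
      (fun _ hg => hg Complex.I) (isTransitiveAlong_unitaryGrp n) h.1 h.2
  have hdisj : ∀ E : Submodule ℝ (EuclideanSpace ℂ (Fin n) →L[ℝ] EuclideanSpace ℂ (Fin n)),
      E ≤ hermSym0 (mulI n) → E ≤ hermSkew (mulI n) → E = ⊥ := fun E h h' =>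
    eq_bot_of_le_of_orthogonal (fun _ hA => (h hA).1.1) (D := E)
      (fun A hA B hB => tr_comp_hermSym0_hermSkew hJ A (h hA) B (h' hB)) le_rfl
  have hE : ∀ E : Submodule ℝ (EuclideanSpace ℂ (Fin n) →L[ℝ] EuclideanSpace ℂ (Fin n)),
      (IsBasicEdge E ∧ unitaryGrp n ≤ invGroup (E : Set (EuclideanSpace ℂ (Fin n) →L[ℝ] EuclideanSpace ℂ (Fin n)))) ↔
        ∃ s : Set (Fin 2), E = ⨆ i ∈ s, ![hermSym0 (mulI n), hermSkew (mulI n)] i := by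
    refine fun E => ⟨fun h => exists_eq_iSup_fin_two (hsup.symm ▸ hcases E h), ?_⟩
    rintro ⟨s, rfl⟩
    refine isBasicEdge_iSup ?_ ?_ s
    · rw [Fin.forall_fin_two]
      exact ⟨hermSym0_le_traceless _, hermSkew_le_traceless hJ⟩
    · rw [Fin.forall_fin_two]
      exact ⟨unitaryGrp_le_invGroup_hermSym0 n, unitaryGrp_le_invGroup_hermSkew n⟩
  refine ⟨⟨isSymDecomposition_two hsup (tr_comp_hermSym0_hermSkew hJ), fun h2 =>
    ⟨unitaryGrp_le_invGroup_hermSym0 n, hermSym0_ne_bot hJ (by omega), fun E hle hG => ?_⟩,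
    unitaryGrp_le_invGroup_hermSkew n, hermSkew_ne_bot hJ, fun E hle hG => ?_⟩, hE, fun F => ?_⟩
  · rcases hcases E ⟨isBasicEdge_of_le_traceless (hle.trans (hermSym0_le_traceless _)), hG⟩ with
      h | h | h | h
    · exact Or.inl h
    · exact Or.inr h
    · exact Or.inl (hdisj E hle h.le)
    · exact Or.inr (le_antisymm hle (h ▸ hermSym0_le_traceless _))
  · rcases hcases E ⟨isBasicEdge_of_le_traceless (hle.trans (hermSkew_le_traceless hJ)), hG⟩ with
      h | h | h | h
    · exact Or.inl h
    · exact Or.inl (hdisj E h.le hle)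
    · exact Or.inr h
    · exact Or.inr (le_antisymm hle (h ▸ hermSkew_le_traceless hJ))
  · rw [isMinimalSubequation_and_invariant_iff, ← minimalSubeq_bot, ← minimalSubeq_traceless,
      ← minimalSubeq_hermSkew hJ, ← minimalSubeq_hermSym0 hJ]
    constructor
    · rintro ⟨E, h, rfl⟩
      rcases hcases E h with rfl | rfl | rfl | rfl <;> simp
    · rintro (rfl | rfl | rfl | rfl)
      · exact ⟨_, ⟨isBasicEdge_of_le_traceless bot_le, by rw [invGroup_bot]; exact le_top⟩, rfl⟩
      · exact ⟨_, ⟨isBasicEdge_of_le_traceless le_rfl, by rw [invGroup_traceless]; exact le_top⟩, rfl⟩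
      · exact ⟨_, ⟨isBasicEdge_of_le_traceless (hermSkew_le_traceless hJ),
          unitaryGrp_le_invGroup_hermSkew n⟩, rfl⟩
      · exact ⟨_, ⟨isBasicEdge_of_le_traceless (hermSym0_le_traceless _),
          unitaryGrp_le_invGroup_hermSym0 n⟩, rfl⟩

end RealAndComplex

/-! ### The cases Sp_n · Sp_1, Sp_n and Sp_n · S¹ -/

section Quaternionic

variable {n : ℕ}

theorem classification_spSp1 (hn : 1 ≤ n) :
    ((IsSymDecomposition ![qHermSym0 n, imHermSkew n] ∧
      (2 ≤ n → IsIrreducibleUnder (spSp1Grp n) (qHermSym0 n)) ∧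
      IsIrreducibleUnder (spSp1Grp n) (imHermSkew n)) ∧
      (∀ E : Submodule ℝ (QSpace n →L[ℝ] QSpace n),
        (IsBasicEdge E ∧ spSp1Grp n ≤ invGroup (E : Set (QSpace n →L[ℝ] QSpace n))) ↔
          ∃ s : Set (Fin 2), E = ⨆ i ∈ s, ![qHermSym0 n, imHermSkew n] i) ∧
      (∀ F : Set (QSpace n →L[ℝ] QSpace n),
        (IsMinimalSubequation F ∧ spSp1Grp n ≤ invGroup F) ↔
          F = psdCone _ ∨ F = laplacian _ ∨ F = geomSubeq (quaternionicLines n) ∨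
          F = minimalSubeq (qHermSym0 n)) ∧
      minimalSubeq (imHermSkew n) = geomSubeq (quaternionicLines n) ∧
      (2 ≤ n → invGroup (geomSubeq (quaternionicLines n)) = spSp1Grp n ∧
        invGroup (minimalSubeq (qHermSym0 n)) = spSp1Grp n)) := by
  have := QSpace.nontrivial hn
  obtain ⟨b, hb⟩ := exists_isImFrame
  have him := hb.imHermSkew_le_traceless (n := n)
  have hgeom := minimalSubeq_imHermSkew (n := n) hb
  have hcases : ∀ E : Submodule ℝ (QSpace n →L[ℝ] QSpace n),
      (IsBasicEdge E ∧ spSp1Grp n ≤ invGroup (E : Set (QSpace n →L[ℝ] QSpace n))) →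
        E = ⊥ ∨ E = qHermSym0 n ∨ E = imHermSkew n ∨ E = qHermSym0 n ⊔ imHermSkew n := by
    intro E h
    obtain ⟨N, rfl | rfl, rfl | rfl⟩ := eq_of_invariant_spSp1Grp hn h.1 h.2 <;> simp
  refine ⟨⟨isSymDecomposition_two hb.traceless_eq_imHermSkew.symm hb.tr_comp_qHermSym0_imHermSkew,
    fun h2 => isIrreducibleUnder_qHermSym0 h2 le_sup_left le_rfl,
    isIrreducibleUnder_imHermSkew hn⟩, fun E => ⟨fun h => exists_eq_iSup_fin_two (hcases E h), ?_⟩,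
    fun F => ?_, hgeom, fun h2 => ⟨?_, ?_⟩⟩
  · rintro ⟨s, rfl⟩
    refine isBasicEdge_iSup ?_ ?_ s
    · rw [Fin.forall_fin_two]
      exact ⟨qHermSym0_le_traceless n, him⟩
    · rw [Fin.forall_fin_two]
      exact ⟨spSp1Grp_le_invGroup_qHermSym0 n, spSp1Grp_le_invGroup_imHermSkew n⟩
  · rw [isMinimalSubequation_and_invariant_iff, ← minimalSubeq_bot, ← minimalSubeq_traceless,
      ← hgeom]
    constructor
    · rintro ⟨E, h, rfl⟩
      rw [hb.traceless_eq_imHermSkew]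
      rcases hcases E h with rfl | rfl | rfl | rfl <;> simp
    · rintro (rfl | rfl | rfl | rfl)
      · exact ⟨_, ⟨isBasicEdge_of_le_traceless bot_le, by rw [invGroup_bot]; exact le_top⟩, rfl⟩
      · exact ⟨_, ⟨isBasicEdge_of_le_traceless le_rfl, by rw [invGroup_traceless]; exact le_top⟩, rfl⟩
      · exact ⟨_, ⟨isBasicEdge_of_le_traceless him, spSp1Grp_le_invGroup_imHermSkew n⟩, rfl⟩
      · exact ⟨_, ⟨isBasicEdge_of_le_traceless (qHermSym0_le_traceless n),
          spSp1Grp_le_invGroup_qHermSym0 n⟩, rfl⟩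
  · rw [← hgeom, invGroup_minimalSubeq (isBasicEdge_of_le_traceless him), invGroup_imHermSkew h2]
  · rw [invGroup_minimalSubeq (isBasicEdge_of_le_traceless (qHermSym0_le_traceless n)),
      invGroup_qHermSym0 h2]

theorem spGrp_le_spPinGrp (n : ℕ) (p : ℍ[ℝ]) : spGrp n ≤ spPinGrp n p := le_sup_left

theorem classification_sp (hn : 1 ≤ n) :
    ((∀ b, IsImFrame b →
        IsSymDecomposition ![qHermSym0 n, qEdge n (b 0), qEdge n (b 1), qEdge n (b 2)]) ∧
      (2 ≤ n → IsIrreducibleUnder (spGrp n) (qHermSym0 n)) ∧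
      (∀ b, IsImFrame b → ∀ m, IsIrreducibleUnder (spGrp n) (qEdge n (b m))) ∧
      (∀ E : Submodule ℝ (QSpace n →L[ℝ] QSpace n),
        (IsBasicEdge E ∧ spGrp n ≤ invGroup (E : Set (QSpace n →L[ℝ] QSpace n))) ↔
          ∃ b, IsImFrame b ∧ ∃ s : Set (Fin 4),
            E = ⨆ i ∈ s, ![qHermSym0 n, qEdge n (b 0), qEdge n (b 1), qEdge n (b 2)] i) ∧
      (∀ F : Set (QSpace n →L[ℝ] QSpace n),
        (IsMinimalSubequation F ∧ spGrp n ≤ invGroup F) ↔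
          F = psdCone _ ∨ F = laplacian _ ∨ F = geomSubeq (quaternionicLines n) ∨
          F = minimalSubeq (qHermSym0 n) ∨
          ∃ b, IsImFrame b ∧
            (F = geomSubeq (complexLines (rmul n (b 0))) ∨
              F = geomSubeq (lagrangians (rmul n (b 0))) ∨
              F = geomSubeq
                (complexLagrangians (rmul n (b 0)) (rmul n (b 1)) (rmul n (b 2))) ∨
              F = minimalSubeq (qEdge n (b 0))))) := by
  refine ⟨fun b hb => hb.isSymDecomposition_four, fun h2 =>
    isIrreducibleUnder_qHermSym0 h2 le_rfl le_sup_left, fun b hb m => ?_, fun E => ⟨?_, ?_⟩,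
    fun F => ?_⟩
  · obtain ⟨m', hm⟩ := exists_ne m
    exact (hb.pair hm.symm).isIrreducibleUnder_qEdge hn le_rfl (spGrp_le_invGroup_qEdge n _)
  · rintro ⟨hE, hG⟩
    obtain ⟨b, hb, hE'⟩ := exists_isImFrame_of_invariant_spGrp hn hE hG
    exact ⟨b, hb, IsComponentSum.exists_eq_iSup_fin_four hb hE'⟩
  · rintro ⟨b, hb, s, rfl⟩
    refine isBasicEdge_iSup (fun i => ?_) (fun i => ?_) s
    · fin_cases i
      exacts [qHermSym0_le_traceless n, hb.qEdge_le_traceless 0, hb.qEdge_le_traceless 1,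
        hb.qEdge_le_traceless 2]
    · fin_cases i
      exacts [le_sup_left.trans (spSp1Grp_le_invGroup_qHermSym0 n), spGrp_le_invGroup_qEdge n _,
        spGrp_le_invGroup_qEdge n _, spGrp_le_invGroup_qEdge n _]
  · rw [isMinimalSubequation_and_invariant_iff]
    have key : (∃ E : Submodule ℝ (QSpace n →L[ℝ] QSpace n),
        (IsBasicEdge E ∧ spGrp n ≤ invGroup (E : Set (QSpace n →L[ℝ] QSpace n))) ∧
          F = minimalSubeq E) ↔
        ∃ b, IsImFrame b ∧ ∃ E, IsComponentSum b E ∧ F = minimalSubeq E := by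
      constructor
      · rintro ⟨E, ⟨hE, hG⟩, rfl⟩
        obtain ⟨b, hb, hE'⟩ := exists_isImFrame_of_invariant_spGrp hn hE hG
        exact ⟨b, hb, E, hE', rfl⟩
      · rintro ⟨b, hb, E, hE, rfl⟩
        have h1 := hb.invariant_of_isComponentSum hE
        exact ⟨E, ⟨h1.1, (spGrp_le_spPinGrp n _).trans h1.2⟩, rfl⟩
    rw [key]
    constructor
    · rintro ⟨b, hb, h⟩
      rw [hb.exists_isComponentSum_iff hn] at h
      rcases h with h | h | h | h | h
      · exact Or.inl h
      · exact Or.inr (Or.inl h)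
      · exact Or.inr (Or.inr (Or.inl h))
      · exact Or.inr (Or.inr (Or.inr (Or.inl h)))
      · exact Or.inr (Or.inr (Or.inr (Or.inr ⟨b, hb, h⟩)))
    · intro h
      -- The first four subequations do not depend on a frame, so an arbitrary one serves for them.
      obtain ⟨b0, hb0⟩ := exists_isImFrame
      rcases h with h | h | h | h | ⟨b, hb, h⟩
      · exact ⟨b0, hb0, (hb0.exists_isComponentSum_iff hn).2 (Or.inl h)⟩
      · exact ⟨b0, hb0, (hb0.exists_isComponentSum_iff hn).2 (Or.inr (Or.inl h))⟩
      · exact ⟨b0, hb0, (hb0.exists_isComponentSum_iff hn).2 (Or.inr (Or.inr (Or.inl h)))⟩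
      · exact ⟨b0, hb0, (hb0.exists_isComponentSum_iff hn).2
          (Or.inr (Or.inr (Or.inr (Or.inl h))))⟩
      · exact ⟨b, hb, (hb.exists_isComponentSum_iff hn).2 (Or.inr (Or.inr (Or.inr (Or.inr h))))⟩

theorem classification_spS1 (hn : 1 ≤ n) (b : Fin 3 → ℍ[ℝ]) (hb : IsImFrame b) :
      (IsSymDecomposition ![qHermSym0 n, qEdge n (b 0), qEdge n (b 1) ⊔ qEdge n (b 2)] ∧
        (2 ≤ n → IsIrreducibleUnder (spS1Grp n (b 0)) (qHermSym0 n)) ∧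
        IsIrreducibleUnder (spS1Grp n (b 0)) (qEdge n (b 0)) ∧
        IsIrreducibleUnder (spS1Grp n (b 0)) (qEdge n (b 1) ⊔ qEdge n (b 2))) ∧
      (∀ E : Submodule ℝ (QSpace n →L[ℝ] QSpace n),
        (IsBasicEdge E ∧ spS1Grp n (b 0) ≤ invGroup (E : Set (QSpace n →L[ℝ] QSpace n))) ↔
          ∃ s : Set (Fin 3),
            E = ⨆ i ∈ s, ![qHermSym0 n, qEdge n (b 0), qEdge n (b 1) ⊔ qEdge n (b 2)] i) ∧
      (∀ F : Set (QSpace n →L[ℝ] QSpace n),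
        (IsMinimalSubequation F ∧ spS1Grp n (b 0) ≤ invGroup F) ↔
          F = psdCone _ ∨ F = laplacian _ ∨ F = geomSubeq (quaternionicLines n) ∨
          F = minimalSubeq (qHermSym0 n) ∨
          F = geomSubeq (complexLines (rmul n (b 0))) ∨
          F = geomSubeq (lagrangians (rmul n (b 0))) ∨
          F = geomSubeq (complexLagrangians (rmul n (b 0)) (rmul n (b 1)) (rmul n (b 2))) ∨
          F = minimalSubeq (qEdge n (b 0))) := by
  have hle := spS1Grp_le_spPinGrp n (b 0)
  have hle' := spS1Grp_le_spSp1Grp n (b 0)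
  have hEdge0 := hle.trans (spPinGrp_le_invGroup_qEdge n (b 0))
  refine ⟨⟨hb.isSymDecomposition_three, fun h2 =>
    isIrreducibleUnder_qHermSym0 h2 le_sup_left hle',
    hb.pair01.isIrreducibleUnder_qEdge hn le_sup_left hEdge0,
    hb.isIrreducibleUnder_qEdge_sup hn⟩, fun E => ⟨fun h =>
      IsComponentSum.exists_eq_iSup_fin_three hb (hb.eq_of_invariant_spS1Grp hn h.1 h.2), ?_⟩,
    fun F => ?_⟩
  · rintro ⟨s, rfl⟩
    refine isBasicEdge_iSup (fun i => ?_) (fun i => ?_) s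
    · fin_cases i
      exacts [qHermSym0_le_traceless n, hb.qEdge_le_traceless 0,
        sup_le (hb.qEdge_le_traceless 1) (hb.qEdge_le_traceless 2)]
    · fin_cases i
      exacts [hle'.trans (spSp1Grp_le_invGroup_qHermSym0 n), hEdge0,
        hle.trans hb.spPinGrp_le_invGroup]
  · rw [isMinimalSubequation_and_invariant_iff, ← hb.exists_isComponentSum_iff hn]
    constructor
    · rintro ⟨E, h, rfl⟩
      exact ⟨E, hb.eq_of_invariant_spS1Grp hn h.1 h.2, rfl⟩
    · rintro ⟨E, hE, rfl⟩
      have h1 := hb.invariant_of_isComponentSum hE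
      exact ⟨E, ⟨h1.1, hle.trans h1.2⟩, rfl⟩

end Quaternionic

end

/-! ### Assembly of the theorem -/

theorem mainTheorem10 {V : Type*} [NormedAddCommGroup V] [InnerProductSpace ℝ V]
    [FiniteDimensional ℝ V] [Nontrivial V] (n : ℕ) (hn : 1 ≤ n) :
    -- Minimal subequations, their edges and their invariance groups.
    (∀ E : Submodule ℝ (V →L[ℝ] V), IsBasicEdge E →
      IsSubequation (minimalSubeq E) ∧ edge (minimalSubeq E) = E ∧
      (∀ Q, IsSubequation Q → edge Q = E → minimalSubeq E ⊆ Q) ∧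
      invGroup (minimalSubeq E) = invGroup (E : Set (V →L[ℝ] V))) ∧
    -- Sums of irreducible components of the traceless part are basic invariant edges.
    (∀ (G : Subgroup (V ≃ₗᵢ[ℝ] V)) (k : ℕ) (C : Fin k → Submodule ℝ (V →L[ℝ] V)),
      IsSymDecomposition C → (∀ i, IsIrreducibleUnder G (C i)) →
      (⨆ i, C i) = traceless V ∧
      ∀ s : Set (Fin k), IsBasicEdge (⨆ i ∈ s, C i) ∧
        G ≤ invGroup ((⨆ i ∈ s, C i : Submodule ℝ (V →L[ℝ] V)) : Set (V →L[ℝ] V))) ∧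
    -- Real Monge-Ampère and Laplacian.
    (minimalSubeq (⊥ : Submodule ℝ (V →L[ℝ] V)) = psdCone V ∧ invGroup (psdCone V) = ⊤ ∧
      minimalSubeq (traceless V) = laplacian V ∧ invGroup (laplacian V) = ⊤) ∧
    -- Complex Monge-Ampère and Lagrangian.
    (∀ J : V →L[ℝ] V, IsComplexStructure J →
      minimalSubeq (hermSkew J) = geomSubeq (complexLines J) ∧
      minimalSubeq (hermSym0 J) = geomSubeq (lagrangians J) ∧
      (∀ g, g ∈ invGroup (geomSubeq (complexLines J)) ↔
        (∀ x, g (J x) = J (g x)) ∨ (∀ x, g (J x) = -J (g x))) ∧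
      (∀ g, g ∈ invGroup (geomSubeq (lagrangians J)) ↔
        (∀ x, g (J x) = J (g x)) ∨ (∀ x, g (J x) = -J (g x)))) ∧
    -- The case of `O_n`.
    ((IsSymDecomposition ![traceless (EuclideanSpace ℝ (Fin n))] ∧
      (2 ≤ n → IsIrreducibleUnder ⊤ (traceless (EuclideanSpace ℝ (Fin n))))) ∧
      (∀ E : Submodule ℝ (EuclideanSpace ℝ (Fin n) →L[ℝ] EuclideanSpace ℝ (Fin n)),
        (IsBasicEdge E ∧ ⊤ ≤ invGroup (E : Set (EuclideanSpace ℝ (Fin n) →L[ℝ] EuclideanSpace ℝ (Fin n)))) ↔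
          E = ⊥ ∨ E = traceless (EuclideanSpace ℝ (Fin n))) ∧
      (∀ F : Set (EuclideanSpace ℝ (Fin n) →L[ℝ] EuclideanSpace ℝ (Fin n)),
        (IsMinimalSubequation F ∧ ⊤ ≤ invGroup F) ↔
          F = psdCone _ ∨ F = laplacian _)) ∧
    -- The case of `U_n`.
    ((IsSymDecomposition ![hermSym0 (mulI n), hermSkew (mulI n)] ∧
      (2 ≤ n → IsIrreducibleUnder (unitaryGrp n) (hermSym0 (mulI n))) ∧
      IsIrreducibleUnder (unitaryGrp n) (hermSkew (mulI n))) ∧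
      (∀ E : Submodule ℝ (EuclideanSpace ℂ (Fin n) →L[ℝ] EuclideanSpace ℂ (Fin n)),
        (IsBasicEdge E ∧ unitaryGrp n ≤ invGroup (E : Set (EuclideanSpace ℂ (Fin n) →L[ℝ] EuclideanSpace ℂ (Fin n)))) ↔
          ∃ s : Set (Fin 2), E = ⨆ i ∈ s, ![hermSym0 (mulI n), hermSkew (mulI n)] i) ∧
      (∀ F : Set (EuclideanSpace ℂ (Fin n) →L[ℝ] EuclideanSpace ℂ (Fin n)),
        (IsMinimalSubequation F ∧ unitaryGrp n ≤ invGroup F) ↔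
          F = psdCone _ ∨ F = laplacian _ ∨ F = geomSubeq (complexLines (mulI n)) ∨
          F = geomSubeq (lagrangians (mulI n)))) ∧
    -- The case of `Sp_n · Sp_1`.
    ((IsSymDecomposition ![qHermSym0 n, imHermSkew n] ∧
      (2 ≤ n → IsIrreducibleUnder (spSp1Grp n) (qHermSym0 n)) ∧
      IsIrreducibleUnder (spSp1Grp n) (imHermSkew n)) ∧
      (∀ E : Submodule ℝ (QSpace n →L[ℝ] QSpace n),
        (IsBasicEdge E ∧ spSp1Grp n ≤ invGroup (E : Set (QSpace n →L[ℝ] QSpace n))) ↔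
          ∃ s : Set (Fin 2), E = ⨆ i ∈ s, ![qHermSym0 n, imHermSkew n] i) ∧
      (∀ F : Set (QSpace n →L[ℝ] QSpace n),
        (IsMinimalSubequation F ∧ spSp1Grp n ≤ invGroup F) ↔
          F = psdCone _ ∨ F = laplacian _ ∨ F = geomSubeq (quaternionicLines n) ∨
          F = minimalSubeq (qHermSym0 n)) ∧
      minimalSubeq (imHermSkew n) = geomSubeq (quaternionicLines n) ∧
      (2 ≤ n → invGroup (geomSubeq (quaternionicLines n)) = spSp1Grp n ∧
        invGroup (minimalSubeq (qHermSym0 n)) = spSp1Grp n)) ∧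
    -- The case of `Sp_n`.
    ((∀ b, IsImFrame b →
        IsSymDecomposition ![qHermSym0 n, qEdge n (b 0), qEdge n (b 1), qEdge n (b 2)]) ∧
      (2 ≤ n → IsIrreducibleUnder (spGrp n) (qHermSym0 n)) ∧
      (∀ b, IsImFrame b → ∀ m, IsIrreducibleUnder (spGrp n) (qEdge n (b m))) ∧
      (∀ E : Submodule ℝ (QSpace n →L[ℝ] QSpace n),
        (IsBasicEdge E ∧ spGrp n ≤ invGroup (E : Set (QSpace n →L[ℝ] QSpace n))) ↔
          ∃ b, IsImFrame b ∧ ∃ s : Set (Fin 4),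
            E = ⨆ i ∈ s, ![qHermSym0 n, qEdge n (b 0), qEdge n (b 1), qEdge n (b 2)] i) ∧
      (∀ F : Set (QSpace n →L[ℝ] QSpace n),
        (IsMinimalSubequation F ∧ spGrp n ≤ invGroup F) ↔
          F = psdCone _ ∨ F = laplacian _ ∨ F = geomSubeq (quaternionicLines n) ∨
          F = minimalSubeq (qHermSym0 n) ∨
          ∃ b, IsImFrame b ∧
            (F = geomSubeq (complexLines (rmul n (b 0))) ∨
              F = geomSubeq (lagrangians (rmul n (b 0))) ∨
              F = geomSubeq
                (complexLagrangians (rmul n (b 0)) (rmul n (b 1)) (rmul n (b 2))) ∨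
              F = minimalSubeq (qEdge n (b 0))))) ∧
    -- The case of `Sp_n · S¹`.
    (∀ b, IsImFrame b →
      (IsSymDecomposition ![qHermSym0 n, qEdge n (b 0), qEdge n (b 1) ⊔ qEdge n (b 2)] ∧
        (2 ≤ n → IsIrreducibleUnder (spS1Grp n (b 0)) (qHermSym0 n)) ∧
        IsIrreducibleUnder (spS1Grp n (b 0)) (qEdge n (b 0)) ∧
        IsIrreducibleUnder (spS1Grp n (b 0)) (qEdge n (b 1) ⊔ qEdge n (b 2))) ∧
      (∀ E : Submodule ℝ (QSpace n →L[ℝ] QSpace n),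
        (IsBasicEdge E ∧ spS1Grp n (b 0) ≤ invGroup (E : Set (QSpace n →L[ℝ] QSpace n))) ↔
          ∃ s : Set (Fin 3),
            E = ⨆ i ∈ s, ![qHermSym0 n, qEdge n (b 0), qEdge n (b 1) ⊔ qEdge n (b 2)] i) ∧
      (∀ F : Set (QSpace n →L[ℝ] QSpace n),
        (IsMinimalSubequation F ∧ spS1Grp n (b 0) ≤ invGroup F) ↔
          F = psdCone _ ∨ F = laplacian _ ∨ F = geomSubeq (quaternionicLines n) ∨
          F = minimalSubeq (qHermSym0 n) ∨
          F = geomSubeq (complexLines (rmul n (b 0))) ∨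
          F = geomSubeq (lagrangians (rmul n (b 0))) ∨
          F = geomSubeq (complexLagrangians (rmul n (b 0)) (rmul n (b 1)) (rmul n (b 2))) ∨
          F = minimalSubeq (qEdge n (b 0))) ∧
      -- The edges of the examples.
      imHermSkew n = qEdge n (b 0) ⊔ qEdge n (b 1) ⊔ qEdge n (b 2) ∧
      hermSkew (rmul n (b 0)) = qEdge n (b 1) ⊔ qEdge n (b 2) ∧
      hermSym0 (rmul n (b 0)) = qHermSym0 n ⊔ qEdge n (b 0) ∧
      minimalSubeq (qHermSym0 n ⊔ qEdge n (b 1) ⊔ qEdge n (b 2)) =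
        geomSubeq (complexLagrangians (rmul n (b 0)) (rmul n (b 1)) (rmul n (b 2))) ∧
      -- The exact invariance groups of the two new examples.
      invGroup (minimalSubeq (qEdge n (b 0))) = spPinGrp n (b 0) ∧
      invGroup (geomSubeq
        (complexLagrangians (rmul n (b 0)) (rmul n (b 1)) (rmul n (b 2)))) =
          spPinGrp n (b 0) ∧
      spS1Grp n (b 0) ≤ spPinGrp n (b 0) ∧
      (spS1Grp n (b 0)).relIndex (spPinGrp n (b 0)) = 2) ∧
    -- No minimal subequation has invariance group exactly `Sp_n`.
    (∀ F : Set (QSpace n →L[ℝ] QSpace n), IsMinimalSubequation F → invGroup F ≠ spGrp n) := by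
  refine ⟨fun E hE => ⟨isSubequation_minimalSubeq hE, edge_minimalSubeq hE,
      fun Q hQ h => minimalSubeq_subset hQ h, invGroup_minimalSubeq hE⟩,
    fun G k C hC hG => ⟨iSup_eq_traceless hC, isBasicEdge_iSup
      (iSup_le_traceless_of_isSymDecomposition hC) fun i => (hG i).1⟩,
    ⟨minimalSubeq_bot, invGroup_psdCone, minimalSubeq_traceless, invGroup_laplacian⟩,
    fun J hJ => ⟨minimalSubeq_hermSkew hJ, minimalSubeq_hermSym0 hJ, fun g => ?_, fun g => ?_⟩,
    classification_orthogonal hn, classification_unitary hn, classification_spSp1 hn, classification_sp hn, fun b hb => ?_, ?_⟩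
  · rw [invGroup_geomSubeq_complexLines hJ]
    exact mem_invGroup_hermSkew hJ g
  · rw [invGroup_geomSubeq_lagrangians hJ]
    exact mem_invGroup_hermSkew hJ g
  · obtain ⟨h1, h2, h3⟩ := classification_spS1 hn b hb
    refine ⟨h1, h2, h3, hb.imHermSkew_eq, hb.hermSkew_eq, hb.hermSym0_eq,
      minimalSubeq_complexLagrangians hb, ?_, ?_, spS1Grp_le_spPinGrp n _,
      hb.pair01.relIndex_spS1Grp hn⟩
    · rw [invGroup_minimalSubeq (isBasicEdge_of_le_traceless (hb.qEdge_le_traceless 0)),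
        hb.pair01.invGroup_qEdge hn]
    · rw [← minimalSubeq_complexLagrangians hb, invGroup_minimalSubeq
        (isBasicEdge_of_le_traceless (sup_le (sup_le (qHermSym0_le_traceless n)
          (hb.qEdge_le_traceless 1)) (hb.qEdge_le_traceless 2))), hb.invGroup_complement hn]
  · rintro F ⟨E, hE, rfl⟩
    rw [invGroup_minimalSubeq hE]
    exact invGroup_ne_spGrp hn hE
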